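/- Let $r,m,d\ge 0$ be integers, $\mathbb I=\{\frac{1-2r-m}{2},\frac{3-2r-m}{2},\dots,\frac{2r+m-1}{2}\}$, and call $a\in\mathbb I$ black if $|a|\le\frac{m-1}{2}$ and white otherwise. Let $W_d$ be the Weyl group of type $B_d$, i.e. the group of permutations $\sigma$ of $\{\pm1,\dots,\pm d\}$ with $\sigma(-i)=-\sigma(i)$, with simple reflections $s_0$ (the sign change of $1$) and $s_i=(i,i+1)(-i,-i-1)$ for $1\le i\le d-1$, length function $l$ and Chevalley–Bruhat order $<$. It acts on the right on $\mathbb I^d$: for $i>0$, $f\cdot s_i$ is $f$ with $f(i)$ and $f(i+1)$ exchanged, and $f\cdot s_0$ is $f$ with $f(1)$ replaced by $-f(1)$ if $f(1)$ is white, and $f\cdot s_0=f$ if $f(1)$ is black. Let $K$ be a field with nonzero elements $q,p$ that carries a field involution $\bar{\phantom{x}}$ with $\bar q=q^{-1}$, $\bar p=p^{-1}$; we consider (a) $K=\mathbb Q(q,p)$ with $q,p$ independent indeterminates, and (b) $K=\mathbb Q(q)$ and $p=q^k$ with $k\in\mathbb Z$. Put $q_0=p$ and $q_i=q$ for $i\ge1$.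 Let $\mathscr H$ be the Hecke algebra of type $B_d$ over $K$, with generators $H_0,\dots,H_{d-1}$, the braid relations of type $B_d$ and $(H_i-q_i)(H_i+q_i^{-1})=0$. Its bar involution is the ring automorphism that extends $\bar{\phantom{x}}$ on $K$ and sends $H_i$ to $H_i^{-1}$. For a reduced expression $\sigma=s_{i_1}\cdots s_{i_n}$ put $H_\sigma=H_{i_1}\cdots H_{i_n}$. The vector space with basis $\{M_g\mid g\in\mathbb I^d\}$ is a right $\mathscr H$-module by $$M_g H_i=\begin{cases}M_{g\cdot s_i}+(q-q^{-1})M_g & i>0,\ g(i)<g(i+1),\\ M_{g\cdot s_i} & i>0,\ g(i)>g(i+1),\\ qM_g & i>0,\ g(i)=g(i+1),\\ M_{g\cdot s_0}+(p-p^{-1})M_g & i=0,\ g(1)>\tfrac{m-1}{2},\\ M_{g\cdot s_0} & i=0,\ g(1)<\tfrac{1-m}{2},\\ pM_g & i=0,\ g(1)\text{ black}.\end{cases}$$ Let $f\in\mathbb I^d$ satisfy $\frac{m-1}{2}\ge f(1)\ge f(2)\ge\dots\ge f(d)$, let $W_f$ be its stabilizer in $W_d$ (a reflection subgroup $W_{m_1}\times\dots\times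 W_{m_k}\times S_{m_{k+1}}\times\dots\times S_{m_l}$, possibly non-parabolic), let ${}^fW$ be the set of minimal length representatives of the right cosets of $W_f$ in $W_d$, and let $\mathbb M_f=M_f\mathscr H$ be the quasi-permutation module. (1) In both cases (a) and (b) there is a map $\psi_\imath\colon\mathbb M_f\to\mathbb M_f$ that is anti-linear (additive with $\psi_\imath(cx)=\bar c\,\psi_\imath(x)$ for $c\in K$) and satisfies $\psi_\imath(M_{f\cdot\sigma})=M_f\,\overline{H_\sigma}$ for all $\sigma\in{}^fW$, in particular $\psi_\imath(M_f)=M_f$; moreover $\psi_\imath(xh)=\psi_\imath(x)\,\bar h$ for all $x\in\mathbb M_f$, $h\in\mathscr H$, and $\psi_\imath^2=\mathrm{Id}$. (2) In case (b), for each $\sigma\in{}^fW$ there is a unique $C_\sigma\in\mathbb M_f$ such that $\psi_\imath(C_\sigma)=C_\sigma$ and $C_\sigma\in M_{f\cdot\sigma}+\sum_{w\in{}^fW}q^{-1}\mathbb Z[q^{-1}]M_{f\cdot w}$. Moreover $C_\sigma\in M_{f\cdot\sigma}+\sum_{w\in{}^fW,\,w<\sigma}q^{-1}\mathbb Z[q^{-1}]M_{f\cdot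 w}$, and $\{C_\sigma\mid\sigma\in{}^fW\}$ is a $\mathbb Q(q)$-basis of $\mathbb M_f$. -/

import Mathlib

set_option linter.unusedSimpArgs false
set_option linter.unnecessarySeqFocus false

noncomputable section

namespace QuasiKL

open scoped RightActions

/-! ## Parameters -/

/-- The restriction of `ratBar b` to polynomials. -/
def ratBarPoly {F : Type*} [Field F] (b : F →+* F) : Polynomial F →+* RatFunc F :=
  Polynomial.eval₂RingHom ((algebraMap F (RatFunc F)).comp b) (RatFunc.X)⁻¹

theorem ratBarPoly_injective {F : Type*} [Field F] (b : F →+* F) :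
    Function.Injective (ratBarPoly b) := by
  have h1 : Function.Injective (Polynomial.aeval (R := F) ((RatFunc.X : RatFunc F)⁻¹)) := by
    rw [← transcendental_iff_injective]
    intro h
    have := h.inv
    rw [inv_inv] at this
    exact RatFunc.transcendental_X this
  have h2 : ratBarPoly b =
      (Polynomial.aeval (R := F) ((RatFunc.X : RatFunc F)⁻¹)).toRingHom.comp
        (Polynomial.mapRingHom b) := by
    apply Polynomial.ringHom_ext
    · intro a; simp [ratBarPoly]
    · simp [ratBarPoly]
  rw [h2]
  exact h1.comp (Polynomial.map_injective b b.injective)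

/-- The extension of a field endomorphism `b` of `F` to `F(X)` with `X ↦ X⁻¹`. -/
def ratBar {F : Type*} [Field F] (b : F →+* F) : RatFunc F →+* RatFunc F :=
  RatFunc.liftRingHom (ratBarPoly b)
    (nonZeroDivisors_le_comap_nonZeroDivisors_of_injective _ (ratBarPoly_injective b))

theorem ratBar_X {F : Type*} [Field F] (b : F →+* F) :
    ratBar b RatFunc.X = (RatFunc.X)⁻¹ := by
  rw [ratBar, RatFunc.liftRingHom_X]; simp [ratBarPoly]

theorem ratBar_C {F : Type*} [Field F] (b : F →+* F) (x : F) :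
    ratBar b (RatFunc.C x) = RatFunc.C (b x) := by
  rw [ratBar, RatFunc.liftRingHom_C]; simp [ratBarPoly]

theorem ratBar_ratBar {F : Type*} [Field F] (b : F →+* F) (hb : ∀ x, b (b x) = x)
    (x : RatFunc F) : ratBar b (ratBar b x) = x := by
  have : (ratBar b).comp (ratBar b) = RingHom.id _ := by
    apply IsLocalization.ringHom_ext (nonZeroDivisors (Polynomial F))
    apply Polynomial.ringHom_ext
    · intro a
      simp [ratBar_C, hb]
    · simp [ratBar_X]
  exact RingHom.congr_fun this x


/-- A field with nonzero elements `q`, `p` and a bar involution `q ↦ q⁻¹`, `p ↦ p⁻¹`. -/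
structure HeckeParam (K : Type) [Field K] where
  q : K
  p : K
  q_ne : q ≠ 0
  p_ne : p ≠ 0
  bar : K →+* K
  bar_q : bar q = q⁻¹
  bar_p : bar p = p⁻¹
  bar_bar : ∀ x, bar (bar x) = x

/-- The field `ℚ(q)`. -/
abbrev Qq : Type := RatFunc ℚ

/-- The field `ℚ(q, p) = ℚ(q)(p)`. -/
abbrev Qqp : Type := RatFunc Qq

/-- The bar involution of `ℚ(q)`, with `q ↦ q⁻¹`. -/
def barQq : Qq →+* Qq := ratBar (RingHom.id ℚ)

theorem barQq_barQq (x : Qq) : barQq (barQq x) = x :=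
  ratBar_ratBar _ (fun _ => rfl) x

/-- Two independent parameters: `q` and `p` are indeterminates over `ℚ`. -/
def twoParam : HeckeParam Qqp where
  q := RatFunc.C RatFunc.X
  p := RatFunc.X
  q_ne := by rw [Ne, map_eq_zero]; exact RatFunc.X_ne_zero
  p_ne := RatFunc.X_ne_zero
  bar := ratBar barQq
  bar_q := by rw [ratBar_C, barQq, ratBar_X, map_inv₀]
  bar_p := ratBar_X _
  bar_bar := ratBar_ratBar _ barQq_barQq

/-- One parameter: `q` is an indeterminate over `ℚ` and `p = q ^ k`. -/
def oneParam (k : ℤ) : HeckeParam Qq where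
  q := RatFunc.X
  p := RatFunc.X ^ k
  q_ne := RatFunc.X_ne_zero
  p_ne := zpow_ne_zero k RatFunc.X_ne_zero
  bar := barQq
  bar_q := ratBar_X _
  bar_p := by rw [map_zpow₀, barQq, ratBar_X, inv_zpow]
  bar_bar := barQq_barQq

/-! ## The Weyl group of type B as the group of signed permutations

The index `i : Fin d` stands for the integer `i + 1`, and `(i, ε)` for `ε * (i + 1)`. -/

/-- The set `{-d, …, -1, 1, …, d}`. -/
abbrev SgnIdx (d : ℕ) : Type := Fin d × ℤˣ

/-- The permutation `x ↦ -x` of `{-d, …, -1, 1, …, d}`. -/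
def negIdx (d : ℕ) : Equiv.Perm (SgnIdx d) :=
  (Equiv.refl (Fin d)).prodCongr (Equiv.neg ℤˣ)

/-- `W_d`: the permutations `σ` of `{±1, …, ±d}` with `σ (-x) = - σ x`. -/
abbrev WB (d : ℕ) : Type := Subgroup.centralizer {negIdx d}

/-- The predecessor of an index; it is only used for indices `i` with `i ≠ 0`. -/
def prevIdx {d : ℕ} (i : Fin d) : Fin d := ⟨i.val - 1, by omega⟩

/-- The underlying permutation of `simpleRefl`. -/
def simplePerm {d : ℕ} (i : Fin d) : Equiv.Perm (SgnIdx d) :=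
  if i.val = 0 then Equiv.swap (i, 1) (i, -1)
  else (Equiv.swap (prevIdx i) i).prodCongr (Equiv.refl ℤˣ)

theorem simplePerm_zero_apply {d : ℕ} (i : Fin d) (hi : i.val = 0) (j : Fin d) (ε : ℤˣ) :
    simplePerm i (j, ε) = (j, if j = i then -ε else ε) := by
  rw [simplePerm, if_pos hi]
  by_cases hj : j = i
  · subst hj
    rcases Int.units_eq_one_or ε with rfl | rfl <;> simp
  · rw [Equiv.swap_apply_of_ne_of_ne] <;> simp [hj]

theorem simplePerm_pos_apply {d : ℕ} (i : Fin d) (hi : i.val ≠ 0) (j : Fin d) (ε : ℤˣ) :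
    simplePerm i (j, ε) = (Equiv.swap (prevIdx i) i j, ε) := by
  rw [simplePerm, if_neg hi]; rfl

theorem simplePerm_mem {d : ℕ} (i : Fin d) :
    simplePerm i ∈ Subgroup.centralizer {negIdx d} := by
  rw [Subgroup.mem_centralizer_singleton_iff]
  ext1 ⟨j, ε⟩
  by_cases hi : i.val = 0
  · simp only [Equiv.Perm.mul_apply, negIdx, simplePerm_zero_apply i hi]
    by_cases hj : j = i <;> simp [hj]
  · simp [Equiv.Perm.mul_apply, negIdx, simplePerm_pos_apply i hi]

/-- The simple reflection `s_i`: the sign change of the first index for `i = 0`, and the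
transposition of the adjacent indices `i`, `i + 1` for `i > 0`. -/
def simpleRefl {d : ℕ} (i : Fin d) : WB d := ⟨simplePerm i, simplePerm_mem i⟩

/-- The product `s_{i_1} ⋯ s_{i_k}` of a word. -/
def wordProd {d : ℕ} (l : List (Fin d)) : WB d := (l.map simpleRefl).prod

/-- The length function of `W_d` with respect to the simple reflections. -/
def len {d : ℕ} (σ : WB d) : ℕ :=
  sInf {n | ∃ l : List (Fin d), l.length = n ∧ wordProd l = σ}

/-- A reduced expression of `σ`. -/
def IsReducedExpr {d : ℕ} (l : List (Fin d)) (σ : WB d) : Prop :=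
  wordProd l = σ ∧ l.length = len σ

/-- Reflections are the conjugates of the simple reflections. -/
def IsRefl {d : ℕ} (t : WB d) : Prop :=
  ∃ (u : WB d) (i : Fin d), t = u * simpleRefl i * u⁻¹

/-- The strict Chevalley-Bruhat order on `W_d`: `u < v` if there is a nonempty chain from `u` to
`v` in which each step is right multiplication by a reflection that increases the length. -/
def BruhatLT {d : ℕ} : WB d → WB d → Prop :=
  Relation.TransGen fun u v => ∃ t, IsRefl t ∧ v = u * t ∧ len u < len v

/-! ## Weights

The element `a : Fin (2 * r + m)` stands for the half-integer `a - (2 * r + m - 1) / 2`. Under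
this order isomorphism onto `[(1 - 2r - m) / 2, (2r + m - 1) / 2]` negation is `Fin.rev`, and the
three parts of the index set are the first `r`, the middle `m` and the last `r` elements. -/

/-- The index set `{(1 - 2r - m) / 2, …, (2r + m - 1) / 2}`. -/
abbrev Idx (r m : ℕ) : Type := Fin (2 * r + m)

/-- The middle part `[(1 - m) / 2, (m - 1) / 2]` (black). -/
def IsBlack {r m : ℕ} (a : Idx r m) : Prop := r ≤ a.val ∧ a.val < r + m

/-- The upper part `[(m + 1) / 2, r + (m - 1) / 2]` (white and positive). -/
def IsPlus {r m : ℕ} (a : Idx r m) : Prop := r + m ≤ a.val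

instance {r m : ℕ} (a : Idx r m) : Decidable (IsBlack a) := by unfold IsBlack; infer_instance

instance {r m : ℕ} (a : Idx r m) : Decidable (IsPlus a) := by unfold IsPlus; infer_instance

/-- The effect of a sign change on an index: black indices are fixed, white ones are negated. -/
def signFlip {r m : ℕ} (a : Idx r m) : Idx r m := if IsBlack a then a else Fin.rev a

theorem signFlip_val {r m : ℕ} (a : Idx r m) :
    (signFlip a).val = if r ≤ a.val ∧ a.val < r + m then a.val else 2 * r + m - 1 - a.val := by
  by_cases h : r ≤ a.val ∧ a.val < r + m
  · simp [signFlip, IsBlack, h]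
  · simp only [signFlip, IsBlack, h, if_false, Fin.val_rev]; omega

theorem signFlip_signFlip {r m : ℕ} (a : Idx r m) : signFlip (signFlip a) = a := by
  apply Fin.ext
  have ha := a.isLt
  have h1 := signFlip_val a
  have h2 := signFlip_val (signFlip a)
  split_ifs at h1 h2 <;> omega

theorem isBlack_signFlip {r m : ℕ} (a : Idx r m) : IsBlack (signFlip a) ↔ IsBlack a := by
  have h := signFlip_val a
  have ha := a.isLt
  unfold IsBlack
  split_ifs at h <;> omega

/-- An index is black, white and positive, or white and negative. -/
theorem color_cases {r m : ℕ} (a : Idx r m) :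
    (IsBlack a ∧ ¬ IsPlus a ∧ ¬ IsPlus (signFlip a) ∧ r ≤ a.val ∧ a.val < r + m ∧
      (signFlip a).val = a.val) ∨
    (¬ IsBlack a ∧ IsPlus a ∧ ¬ IsPlus (signFlip a) ∧ r + m ≤ a.val ∧ (signFlip a).val < r ∧
      (signFlip a).val + a.val + 1 = 2 * r + m) ∨
    (¬ IsBlack a ∧ ¬ IsPlus a ∧ IsPlus (signFlip a) ∧ a.val < r ∧ r + m ≤ (signFlip a).val ∧
      (signFlip a).val + a.val + 1 = 2 * r + m) := by
  have h := signFlip_val a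
  have ha := a.isLt
  unfold IsBlack IsPlus
  split_ifs at h <;> omega

/-- Weights `f = (f(1), …, f(d))`. -/
abbrev Weight (r m d : ℕ) : Type := Fin d → Idx r m

/-- Extension of a weight to `{±1, …, ±d}`. -/
def extWeight {r m d : ℕ} (f : Weight r m d) (x : SgnIdx d) : Idx r m :=
  if x.2 = 1 then f x.1 else signFlip (f x.1)

/-- The right action `f · σ = (f(σ(1)), …, f(σ(d)))` of `W_d` on weights. -/
def wact {r m d : ℕ} (f : Weight r m d) (σ : WB d) : Weight r m d :=
  fun i => extWeight f (σ.1 (i, 1))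

theorem wact_one {r m d : ℕ} (f : Weight r m d) : wact f 1 = f := by
  funext i; simp [wact, extWeight]

theorem extWeight_neg {r m d : ℕ} (f : Weight r m d) (x : SgnIdx d) :
    extWeight f (negIdx d x) = signFlip (extWeight f x) := by
  obtain ⟨j, ε⟩ := x
  rcases Int.units_eq_one_or ε with rfl | rfl <;> simp [extWeight, negIdx, signFlip_signFlip]

theorem apply_neg {d : ℕ} (σ : WB d) (x : SgnIdx d) :
    σ.1 (negIdx d x) = negIdx d (σ.1 x) := by
  have h := Subgroup.mem_centralizer_singleton_iff.1 σ.2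
  exact Equiv.congr_fun h x

theorem extWeight_wact {r m d : ℕ} (f : Weight r m d) (σ : WB d) (x : SgnIdx d) :
    extWeight (wact f σ) x = extWeight f (σ.1 x) := by
  obtain ⟨j, ε⟩ := x
  rcases Int.units_eq_one_or ε with rfl | rfl
  · simp [extWeight, wact]
  · have h : ((j, -1) : SgnIdx d) = negIdx d (j, 1) := by simp [negIdx]
    rw [h, extWeight_neg, apply_neg, extWeight_neg]
    congr 1

theorem wact_mul {r m d : ℕ} (f : Weight r m d) (σ τ : WB d) :
    wact f (σ * τ) = wact (wact f σ) τ := by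
  funext i
  conv_rhs => rw [wact, extWeight_wact]
  rfl

/-- Anti-dominant weights: `(m - 1) / 2 ≥ f(1) ≥ ⋯ ≥ f(d)`. -/
def AntiDominant {r m d : ℕ} (f : Weight r m d) : Prop :=
  Antitone f ∧ ∀ i, (f i).val < r + m

/-- The stabilizer `W_f` of `f` in `W_d`. -/
def stab {r m d : ℕ} (f : Weight r m d) : Subgroup (WB d) where
  carrier := {σ | wact f σ = f}
  one_mem' := wact_one f
  mul_mem' := by
    intro σ τ hσ hτ
    change wact f (σ * τ) = f
    rw [wact_mul, hσ, hτ]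
  inv_mem' := by
    intro σ hσ
    change wact f σ⁻¹ = f
    conv_lhs => rw [← show wact f σ = f from hσ]
    rw [← wact_mul, mul_inv_cancel, wact_one]

/-- The set `{}^f W` of minimal length representatives of the right cosets `W_f σ`. -/
def minReps {r m d : ℕ} (f : Weight r m d) : Set (WB d) :=
  {σ | ∀ w ∈ stab f, len σ ≤ len (w * σ)}

/-! ## The Hecke algebra of type B -/

section Hecke

variable {K : Type} [Field K]

/-- `q_0 = p` and `q_i = q` for `i > 0`. -/
def HeckeParam.par (P : HeckeParam K) {d : ℕ} (i : Fin d) : K := if i.val = 0 then P.p else P.q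

theorem HeckeParam.par_ne (P : HeckeParam K) {d : ℕ} (i : Fin d) : P.par i ≠ 0 := by
  unfold HeckeParam.par; split_ifs
  exacts [P.p_ne, P.q_ne]

theorem HeckeParam.bar_par (P : HeckeParam K) {d : ℕ} (i : Fin d) :
    P.bar (P.par i) = (P.par i)⁻¹ := by
  unfold HeckeParam.par; split_ifs
  exacts [P.bar_p, P.bar_q]

/-- The defining relations of the Hecke algebra of type B. -/
inductive HeckeRel (P : HeckeParam K) (d : ℕ) :
    FreeAlgebra K (Fin d) → FreeAlgebra K (Fin d) → Prop
  | quad (i : Fin d) : HeckeRel P d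
      ((FreeAlgebra.ι K i - algebraMap K _ (P.par i)) *
        (FreeAlgebra.ι K i + algebraMap K _ (P.par i)⁻¹)) 0
  | braid (i j : Fin d) (hi : 1 ≤ i.val) (hj : j.val = i.val + 1) : HeckeRel P d
      (FreeAlgebra.ι K i * FreeAlgebra.ι K j * FreeAlgebra.ι K i)
      (FreeAlgebra.ι K j * FreeAlgebra.ι K i * FreeAlgebra.ι K j)
  | comm (i j : Fin d) (h : i.val + 1 < j.val ∨ j.val + 1 < i.val) : HeckeRel P d
      (FreeAlgebra.ι K i * FreeAlgebra.ι K j) (FreeAlgebra.ι K j * FreeAlgebra.ι K i)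
  | braid_zero (i j : Fin d) (hi : i.val = 0) (hj : j.val = 1) : HeckeRel P d
      (FreeAlgebra.ι K i * FreeAlgebra.ι K j * FreeAlgebra.ι K i * FreeAlgebra.ι K j)
      (FreeAlgebra.ι K j * FreeAlgebra.ι K i * FreeAlgebra.ι K j * FreeAlgebra.ι K i)

/-- The Hecke algebra of type `B_d`. -/
abbrev Hecke (P : HeckeParam K) (d : ℕ) : Type := RingQuot (HeckeRel P d)

/-- The generator `H_i`. -/
def Hgen (P : HeckeParam K) {d : ℕ} (i : Fin d) : Hecke P d :=
  RingQuot.mkAlgHom K (HeckeRel P d) (FreeAlgebra.ι K i)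

/-- The product `H_{i_1} ⋯ H_{i_k}` of a word; it is `H_σ` for a reduced expression of `σ`. -/
def Hword (P : HeckeParam K) {d : ℕ} (l : List (Fin d)) : Hecke P d := (l.map (Hgen P)).prod

theorem Hgen_quad (P : HeckeParam K) {d : ℕ} (i : Fin d) :
    (Hgen P i - algebraMap K _ (P.par i)) * (Hgen P i + algebraMap K _ (P.par i)⁻¹) = 0 := by
  simpa [Hgen] using RingQuot.mkAlgHom_rel K (HeckeRel.quad (P := P) i)

theorem Hgen_braid (P : HeckeParam K) {d : ℕ} (i j : Fin d) (hi : 1 ≤ i.val)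
    (hj : j.val = i.val + 1) :
    Hgen P i * Hgen P j * Hgen P i = Hgen P j * Hgen P i * Hgen P j := by
  simpa [Hgen] using RingQuot.mkAlgHom_rel K (HeckeRel.braid (P := P) i j hi hj)

theorem Hgen_comm (P : HeckeParam K) {d : ℕ} (i j : Fin d)
    (h : i.val + 1 < j.val ∨ j.val + 1 < i.val) :
    Hgen P i * Hgen P j = Hgen P j * Hgen P i := by
  simpa [Hgen] using RingQuot.mkAlgHom_rel K (HeckeRel.comm (P := P) i j h)

theorem Hgen_braid_zero (P : HeckeParam K) {d : ℕ} (i j : Fin d) (hi : i.val = 0)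
    (hj : j.val = 1) :
    Hgen P i * Hgen P j * Hgen P i * Hgen P j = Hgen P j * Hgen P i * Hgen P j * Hgen P i := by
  simpa [Hgen] using RingQuot.mkAlgHom_rel K (HeckeRel.braid_zero (P := P) i j hi hj)

/-- The inverse `H_i⁻¹ = H_i - (q_i - q_i⁻¹)`. -/
def Hinv (P : HeckeParam K) {d : ℕ} (i : Fin d) : Hecke P d :=
  Hgen P i - algebraMap K _ (P.par i - (P.par i)⁻¹)

theorem Hgen_quad' (P : HeckeParam K) {d : ℕ} (i : Fin d) :
    Hgen P i * Hgen P i = algebraMap K _ (P.par i - (P.par i)⁻¹) * Hgen P i + 1 := by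
  have h := Hgen_quad P i
  have h1 : algebraMap K (Hecke P d) (P.par i) * algebraMap K (Hecke P d) (P.par i)⁻¹ = 1 := by
    rw [← map_mul, mul_inv_cancel₀ (P.par_ne i), map_one]
  have h2 := Algebra.commutes (P.par i)⁻¹ (Hgen P i)
  rw [sub_mul, mul_add, mul_add, h1, ← h2] at h
  rw [map_sub, sub_mul, ← sub_eq_zero, ← h]
  abel

theorem Hgen_mul_Hinv (P : HeckeParam K) {d : ℕ} (i : Fin d) : Hgen P i * Hinv P i = 1 := by
  rw [Hinv, mul_sub, Hgen_quad', ← Algebra.commutes]; abel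

theorem Hinv_mul_Hgen (P : HeckeParam K) {d : ℕ} (i : Fin d) : Hinv P i * Hgen P i = 1 := by
  rw [Hinv, sub_mul, Hgen_quad']; abel

/-- `H_i` as a unit. -/
def Hunit (P : HeckeParam K) {d : ℕ} (i : Fin d) : (Hecke P d)ˣ :=
  ⟨Hgen P i, Hinv P i, Hgen_mul_Hinv P i, Hinv_mul_Hgen P i⟩

/-- The Hecke algebra with the scalars acting through the bar involution of the ground field. -/
def BarHecke (P : HeckeParam K) (d : ℕ) : Type := Hecke P d

instance (P : HeckeParam K) (d : ℕ) : Ring (BarHecke P d) := inferInstanceAs (Ring (Hecke P d))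

instance (P : HeckeParam K) (d : ℕ) : Algebra K (BarHecke P d) :=
  RingHom.toAlgebra' (S := BarHecke P d) ((algebraMap K (Hecke P d)).comp P.bar)
    (fun c x => Algebra.commutes (P.bar c) (show Hecke P d from x))

theorem BarHecke.algebraMap_apply (P : HeckeParam K) (d : ℕ) (c : K) :
    algebraMap K (BarHecke P d) c = (algebraMap K (Hecke P d) (P.bar c) : Hecke P d) := rfl

/-- The algebra homomorphism with `H_i ↦ H_i⁻¹`. -/
def barLift (P : HeckeParam K) (d : ℕ) : FreeAlgebra K (Fin d) →ₐ[K] BarHecke P d :=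
  FreeAlgebra.lift K (A := BarHecke P d) (fun i => Hinv P i)

theorem barLift_ι (P : HeckeParam K) {d : ℕ} (i : Fin d) :
    barLift P d (FreeAlgebra.ι K i) = (Hinv P i : Hecke P d) :=
  FreeAlgebra.lift_ι_apply (A := BarHecke P d) _ _

theorem heckeBar_rel (P : HeckeParam K) (d : ℕ) ⦃x y : FreeAlgebra K (Fin d)⦄
    (h : HeckeRel P d x y) :
    barLift P d x = barLift P d y := by
  cases h with
  | quad i =>
    simp only [map_mul, map_sub, map_add, barLift_ι, AlgHom.commutes, map_zero,
      BarHecke.algebraMap_apply, P.bar_par, map_inv₀, inv_inv]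
    change (Hinv P i - algebraMap K (Hecke P d) (P.par i)⁻¹) *
      (Hinv P i + algebraMap K (Hecke P d) (P.par i)) = (0 : Hecke P d)
    rw [← Hgen_quad P i, Hinv, map_sub]
    congr 1 <;> abel
  | braid i j hi hj =>
    simp only [map_mul, barLift_ι]
    have h : Hunit P i * Hunit P j * Hunit P i = Hunit P j * Hunit P i * Hunit P j :=
      Units.ext (Hgen_braid P i j hi hj)
    have h' := congrArg (fun u => ((u⁻¹ : (Hecke P d)ˣ) : Hecke P d)) h
    simp only [mul_inv_rev, Units.val_mul, ← mul_assoc] at h'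
    exact h'
  | comm i j h =>
    simp only [map_mul, barLift_ι]
    have h : Hunit P j * Hunit P i = Hunit P i * Hunit P j :=
      Units.ext (Hgen_comm P i j h).symm
    have h' := congrArg (fun u => ((u⁻¹ : (Hecke P d)ˣ) : Hecke P d)) h
    simp only [mul_inv_rev, Units.val_mul] at h'
    exact h'
  | braid_zero i j hi hj =>
    simp only [map_mul, barLift_ι]
    have h : Hunit P j * Hunit P i * Hunit P j * Hunit P i =
        Hunit P i * Hunit P j * Hunit P i * Hunit P j :=
      Units.ext (Hgen_braid_zero P i j hi hj).symm
    have h' := congrArg (fun u => ((u⁻¹ : (Hecke P d)ˣ) : Hecke P d)) h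
    simp only [mul_inv_rev, Units.val_mul, ← mul_assoc] at h'
    exact h'

/-- The bar involution of the Hecke algebra: the ring homomorphism that extends the bar involution
of the ground field and sends `H_i` to `H_i⁻¹`. -/
def heckeBar (P : HeckeParam K) (d : ℕ) : Hecke P d →+* Hecke P d :=
  (RingQuot.liftAlgHom K (B := BarHecke P d) ⟨barLift P d, heckeBar_rel P d⟩).toRingHom

theorem heckeBar_Hgen (P : HeckeParam K) {d : ℕ} (i : Fin d) :
    heckeBar P d (Hgen P i) = Hinv P i := by
  change RingQuot.liftAlgHom K (B := BarHecke P d) ⟨barLift P d, heckeBar_rel P d⟩ (Hgen P i) = _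
  rw [Hgen, RingQuot.liftAlgHom_mkAlgHom_apply, barLift_ι]

theorem heckeBar_algebraMap (P : HeckeParam K) (d : ℕ) (c : K) :
    heckeBar P d (algebraMap K _ c) = algebraMap K _ (P.bar c) :=
  (RingQuot.liftAlgHom K (B := BarHecke P d) ⟨barLift P d, heckeBar_rel P d⟩).commutes c

theorem heckeBar_heckeBar (P : HeckeParam K) {d : ℕ} (x : Hecke P d) :
    heckeBar P d (heckeBar P d x) = x := by
  let F : Hecke P d →ₐ[K] Hecke P d :=
    { (heckeBar P d).comp (heckeBar P d) with
      commutes' := fun c => by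
        change heckeBar P d (heckeBar P d (algebraMap K _ c)) = _
        rw [heckeBar_algebraMap, heckeBar_algebraMap, P.bar_bar] }
  have hF : F = AlgHom.id K _ := by
    apply RingQuot.ringQuot_ext' K
    apply FreeAlgebra.hom_ext
    funext i
    change heckeBar P d (heckeBar P d (Hgen P i)) = Hgen P i
    rw [heckeBar_Hgen, Hinv, map_sub, heckeBar_Hgen, heckeBar_algebraMap, map_sub, map_inv₀,
      P.bar_par, inv_inv, Hinv, ← neg_sub (P.par i), map_neg]
    abel
  exact AlgHom.congr_fun hF x

end Hecke

/-! ## The tensor module and the quasi-permutation modules -/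

section Tensor

variable {K : Type} [Field K]

/-- The `d`-th tensor power of the vector space with basis `v_a`, `a ∈ Idx r m`, given as the
vector space with basis `M_f = v_{f(1)} ⊗ ⋯ ⊗ v_{f(d)}`, where `f` runs over all weights. -/
def TensorSpace (_P : HeckeParam K) (r m d : ℕ) : Type := Weight r m d →₀ K

instance (P : HeckeParam K) (r m d : ℕ) : AddCommGroup (TensorSpace P r m d) :=
  inferInstanceAs (AddCommGroup (Weight r m d →₀ K))

instance (P : HeckeParam K) (r m d : ℕ) : Module K (TensorSpace P r m d) :=
  inferInstanceAs (Module K (Weight r m d →₀ K))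

/-- The standard basis vector `M_f`. -/
def stdVec (P : HeckeParam K) {r m d : ℕ} (f : Weight r m d) : TensorSpace P r m d :=
  Finsupp.single f (1 : K)

/-- The vector `M_f · H_i`. -/
def genActVec (P : HeckeParam K) {r m d : ℕ} (i : Fin d) (f : Weight r m d) :
    TensorSpace P r m d :=
  if i.val = 0 then
    if IsBlack (f i) then P.p • stdVec P f
    else if IsPlus (f i) then
      stdVec P (wact f (simpleRefl i)) + (P.p - P.p⁻¹) • stdVec P f
    else stdVec P (wact f (simpleRefl i))
  else
    if f (prevIdx i) < f i then
      stdVec P (wact f (simpleRefl i)) + (P.q - P.q⁻¹) • stdVec P f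
    else if f i < f (prevIdx i) then stdVec P (wact f (simpleRefl i))
    else P.q • stdVec P f

/-- The linear operator `x ↦ x · H_i`. -/
def genAct (P : HeckeParam K) (r m : ℕ) {d : ℕ} (i : Fin d) :
    Module.End K (TensorSpace P r m d) :=
  Finsupp.linearCombination K (genActVec P i)

theorem genAct_stdVec (P : HeckeParam K) {r m d : ℕ} (i : Fin d) (f : Weight r m d) :
    genAct P r m i (stdVec P f) = genActVec P i f :=
  (Finsupp.linearCombination_single K 1 f).trans (one_smul K _)

theorem end_ext (P : HeckeParam K) {r m d : ℕ} {S T : Module.End K (TensorSpace P r m d)}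
    (h : ∀ f, S (stdVec P f) = T (stdVec P f)) : S = T :=
  Finsupp.lhom_ext' fun f => LinearMap.ext_ring (h f)

theorem wact_simple_zero {r m d : ℕ} (f : Weight r m d) (i : Fin d) (hi : i.val = 0) :
    wact f (simpleRefl i) = Function.update f i (signFlip (f i)) := by
  funext j
  change extWeight f (simplePerm i (j, 1)) = _
  rw [simplePerm_zero_apply i hi]
  by_cases hj : j = i
  · subst hj; simp [extWeight]
  · simp [extWeight, hj]

theorem wact_simple_pos {r m d : ℕ} (f : Weight r m d) (i : Fin d) (hi : i.val ≠ 0) :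
    wact f (simpleRefl i) =
      Function.update (Function.update f (prevIdx i) (f i)) i (f (prevIdx i)) := by
  funext j
  change extWeight f (simplePerm i (j, 1)) = _
  rw [simplePerm_pos_apply i hi]
  by_cases hj : j = i
  · subst hj; simp [extWeight]
  · by_cases hj' : j = prevIdx i
    · subst hj'; simp [extWeight, hj]
    · simp [extWeight, hj, hj', Equiv.swap_apply_of_ne_of_ne]

theorem prevIdx_ne {d : ℕ} (i : Fin d) (hi : i.val ≠ 0) : prevIdx i ≠ i := by
  intro h; have := congrArg Fin.val h; simp [prevIdx] at this; omega

/-- The action of `H_i`, `i > 0`, for the values `x`, `y` at the places `a = i - 1`, `b = i`. -/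
theorem genAct_pos (P : HeckeParam K) {r m d : ℕ} (i : Fin d) (hi : i.val ≠ 0)
    (f g : Weight r m d) (a : Fin d) (x y : Idx r m) (ha : a = prevIdx i) (hx : f a = x)
    (hy : f i = y) (hga : g a = y) (hgi : g i = x) (hg : ∀ j, j ≠ a → j ≠ i → g j = f j) :
    genAct P r m i (stdVec P f) =
      if x < y then stdVec P g + (P.q - P.q⁻¹) • stdVec P f
      else if y < x then stdVec P g else P.q • stdVec P f := by
  have : wact f (simpleRefl i) = g := by
    rw [wact_simple_pos f i hi]
    funext j
    by_cases h1 : j = i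
    · subst h1; simp [← ha, hx, hgi]
    · by_cases h2 : j = a
      · subst h2; simp [← ha, h1, hy, hga]
      · simp [← ha, h1, h2, hg]
  rw [genAct_stdVec, genActVec, if_neg hi, this, ← ha, hx, hy]

theorem genAct_zero (P : HeckeParam K) {r m d : ℕ} (i : Fin d) (hi : i.val = 0)
    (f g : Weight r m d) (x : Idx r m) (hx : f i = x) (hgi : g i = signFlip x)
    (hg : ∀ j, j ≠ i → g j = f j) :
    genAct P r m i (stdVec P f) =
      if IsBlack x then P.p • stdVec P f
      else if IsPlus x then stdVec P g + (P.p - P.p⁻¹) • stdVec P f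
      else stdVec P g := by
  have : wact f (simpleRefl i) = g := by
    rw [wact_simple_zero f i hi]
    funext j
    by_cases h1 : j = i
    · subst h1; simp [hx, hgi]
    · simp [h1, hg]
  rw [genAct_stdVec, genActVec, if_pos hi, this, hx]

theorem genAct_quad (P : HeckeParam K) (r m : ℕ) {d : ℕ} (i : Fin d) :
    (genAct P r m i - algebraMap K _ (P.par i)) * (genAct P r m i + algebraMap K _ (P.par i)⁻¹)
      = 0 := by
  apply end_ext
  intro f
  by_cases hi : i.val = 0
  · have hp := P.p_ne
    let G (x : Idx r m) : Weight r m d := Function.update f i x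
    have T (x) : genAct P r m i (stdVec P (G x)) = _ :=
      genAct_zero P i hi (G x) (G (signFlip x)) x (by simp [G]) (by simp [G])
        (by intro k hk; simp [G, hk])
    have hf : f = G (f i) := by simp [G]
    rw [hf]
    generalize f i = x
    clear_value G
    have hx := signFlip_signFlip x
    have h1 := isBlack_signFlip x
    rcases color_cases x with ⟨h2, h3, h4, -⟩ | ⟨h2, h3, h4, -⟩ | ⟨h2, h3, h4, -⟩ <;>
    · simp only [HeckeParam.par, hi, if_true, Module.End.mul_apply, LinearMap.sub_apply,
        LinearMap.add_apply, Module.algebraMap_end_apply, map_add, map_smul, T, h1, h2,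
        h3, h4, hx, if_false, LinearMap.zero_apply]
      match_scalars <;> field_simp <;> ring
  · have hq := P.q_ne
    obtain ⟨a, ha⟩ : ∃ a, a = prevIdx i := ⟨_, rfl⟩
    have hai : a ≠ i := by rw [ha]; exact prevIdx_ne i hi
    let G (x y : Idx r m) : Weight r m d := Function.update (Function.update f a x) i y
    have Ga (x y) : G x y a = x := by simp [G, hai]
    have Gi (x y) : G x y i = y := by simp [G]
    have T (x y) : genAct P r m i (stdVec P (G x y)) = _ :=
      genAct_pos P i hi (G x y) (G y x) a x y ha (Ga ..) (Gi ..) (Ga ..) (Gi ..)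
        (by intro k h1 h2; simp [G, h1, h2])
    have hf : f = G (f a) (f i) := by simp [G]
    rw [hf]
    generalize f a = x, f i = y
    clear_value G
    rcases lt_trichotomy x y with h | h | h
    · simp only [HeckeParam.par, hi, if_true, Module.End.mul_apply, LinearMap.sub_apply,
        LinearMap.add_apply, Module.algebraMap_end_apply, map_add, map_smul, T, h,
        h.not_gt, if_false, LinearMap.zero_apply]
      match_scalars <;> field_simp <;> ring
    · subst h
      simp only [HeckeParam.par, hi, Module.End.mul_apply, LinearMap.sub_apply,
        LinearMap.add_apply, Module.algebraMap_end_apply, map_add, map_smul, T, lt_irrefl,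
        if_false, LinearMap.zero_apply]
      match_scalars <;> field_simp <;> ring
    · simp only [HeckeParam.par, hi, if_true, Module.End.mul_apply, LinearMap.sub_apply,
        LinearMap.add_apply, Module.algebraMap_end_apply, map_add, map_smul, T, h,
        h.not_gt, if_false, LinearMap.zero_apply]
      match_scalars <;> field_simp <;> ring

theorem genAct_comm_of_lt (P : HeckeParam K) (r m : ℕ) {d : ℕ} (i j : Fin d)
    (h : i.val + 1 < j.val) :
    genAct P r m i * genAct P r m j = genAct P r m j * genAct P r m i := by
  apply end_ext
  intro f
  obtain ⟨b, hb⟩ : ∃ b, b = prevIdx j := ⟨_, rfl⟩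
  have hbj : b ≠ j := by rw [hb]; exact prevIdx_ne j (by omega)
  have hij : i ≠ j := by intro h'; have := congrArg Fin.val h'; omega
  have hib : i ≠ b := by intro h'; have := congrArg Fin.val h'; simp [hb, prevIdx] at this; omega
  by_cases hi : i.val = 0
  · let G (x y z : Idx r m) : Weight r m d :=
      Function.update (Function.update (Function.update f i x) b y) j z
    have Gi (x y z) : G x y z i = x := by simp [G, hij, hib]
    have Gb (x y z) : G x y z b = y := by simp [G, hbj]
    have Gj (x y z) : G x y z j = z := by simp [G]
    have Go (x y z k) (h1 : k ≠ i) (h2 : k ≠ b) (h3 : k ≠ j) : G x y z k = f k := by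
      simp [G, h1, h2, h3]
    have hf : f = G (f i) (f b) (f j) := by simp [G]
    have Ti (x y z) : genAct P r m i (stdVec P (G x y z)) = _ :=
      genAct_zero P i hi (G x y z) (G (signFlip x) y z) x (Gi ..) (Gi ..) (by
        intro k h1
        by_cases h3 : k = j
        · subst h3; simp [Gj]
        · by_cases h2 : k = b
          · subst h2; simp [Gb]
          · simp [Go, h1, h2, h3])
    have Tj (x y z) : genAct P r m j (stdVec P (G x y z)) = _ :=
      genAct_pos P j (by omega) (G x y z) (G x z y) b y z hb (Gb ..) (Gj ..) (Gb ..) (Gj ..) (by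
        intro k h1 h2
        by_cases h3 : k = i
        · subst h3; simp [Gi]
        · simp [Go, h1, h2, h3])
    rw [hf]
    generalize f i = x, f b = y, f j = z
    clear_value G
    simp only [Module.End.mul_apply, Ti, Tj]
    split_ifs <;> simp only [map_add, map_smul, Ti, Tj, if_true, if_false, *] <;>
      (try module)
  · obtain ⟨a, ha⟩ : ∃ a, a = prevIdx i := ⟨_, rfl⟩
    have hai : a ≠ i := by rw [ha]; exact prevIdx_ne i hi
    have haj : a ≠ j := by
      intro h'; have := congrArg Fin.val h'; simp [ha, prevIdx] at this; omega
    have hab : a ≠ b := by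
      intro h'; have := congrArg Fin.val h'; simp [ha, hb, prevIdx] at this; omega
    let G (w x y z : Idx r m) : Weight r m d :=
      Function.update (Function.update (Function.update (Function.update f a w) i x) b y) j z
    have Ga (w x y z) : G w x y z a = w := by simp [G, haj, hai, hab]
    have Gi (w x y z) : G w x y z i = x := by simp [G, hij, hib]
    have Gb (w x y z) : G w x y z b = y := by simp [G, hbj]
    have Gj (w x y z) : G w x y z j = z := by simp [G]
    have Go (w x y z k) (h0 : k ≠ a) (h1 : k ≠ i) (h2 : k ≠ b) (h3 : k ≠ j) :
        G w x y z k = f k := by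
      simp [G, h0, h1, h2, h3]
    have hf : f = G (f a) (f i) (f b) (f j) := by simp [G]
    have Ti (w x y z) : genAct P r m i (stdVec P (G w x y z)) = _ :=
      genAct_pos P i hi (G w x y z) (G x w y z) a w x ha (Ga ..) (Gi ..) (Ga ..) (Gi ..) (by
        intro k h0 h1
        by_cases h3 : k = j
        · subst h3; simp [Gj]
        · by_cases h2 : k = b
          · subst h2; simp [Gb]
          · simp [Go, h0, h1, h2, h3])
    have Tj (w x y z) : genAct P r m j (stdVec P (G w x y z)) = _ :=
      genAct_pos P j (by omega) (G w x y z) (G w x z y) b y z hb (Gb ..) (Gj ..) (Gb ..) (Gj ..)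
        (by
        intro k h2 h3
        by_cases h0 : k = a
        · subst h0; simp [Ga]
        · by_cases h1 : k = i
          · subst h1; simp [Gi]
          · simp [Go, h0, h1, h2, h3])
    rw [hf]
    generalize f a = w, f i = x, f b = y, f j = z
    clear_value G
    simp only [Module.End.mul_apply, Ti, Tj]
    split_ifs <;> simp only [map_add, map_smul, Ti, Tj, if_true, if_false, *] <;>
      (try module)

theorem genAct_comm (P : HeckeParam K) (r m : ℕ) {d : ℕ} (i j : Fin d)
    (h : i.val + 1 < j.val ∨ j.val + 1 < i.val) :
    genAct P r m i * genAct P r m j = genAct P r m j * genAct P r m i := by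
  rcases h with h | h
  · exact genAct_comm_of_lt P r m i j h
  · exact (genAct_comm_of_lt P r m j i h).symm

theorem genAct_braid (P : HeckeParam K) (r m : ℕ) {d : ℕ} (i j : Fin d) (hi : 1 ≤ i.val)
    (hj : j.val = i.val + 1) :
    genAct P r m i * genAct P r m j * genAct P r m i =
      genAct P r m j * genAct P r m i * genAct P r m j := by
  apply end_ext
  intro f
  obtain ⟨a, ha⟩ : ∃ a, a = prevIdx i := ⟨_, rfl⟩
  have hai : a ≠ i := by rw [ha]; exact prevIdx_ne i (by omega)
  have hij : i ≠ j := by intro h; have := congrArg Fin.val h; omega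
  have hpj : i = prevIdx j := by apply Fin.ext; simp [prevIdx]; omega
  have haj : a ≠ j := by
    intro h; have := congrArg Fin.val h; simp [ha, prevIdx] at this; omega
  let G (x y z : Idx r m) : Weight r m d :=
    Function.update (Function.update (Function.update f a x) i y) j z
  have Ga (x y z) : G x y z a = x := by simp [G, hai, haj]
  have Gi (x y z) : G x y z i = y := by simp [G, hij]
  have Gj (x y z) : G x y z j = z := by simp [G]
  have Go (x y z k) (h1 : k ≠ a) (h2 : k ≠ i) (h3 : k ≠ j) : G x y z k = f k := by
    simp [G, h1, h2, h3]
  have hf : f = G (f a) (f i) (f j) := by simp [G]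
  have Ti (x y z) : genAct P r m i (stdVec P (G x y z)) = _ :=
    genAct_pos P i (by omega) (G x y z) (G y x z) a x y ha (Ga ..) (Gi ..) (Ga ..) (Gi ..) (by
      intro k h1 h2
      by_cases h3 : k = j
      · subst h3; simp [Gj]
      · simp [Go, h1, h2, h3])
  have Tj (x y z) : genAct P r m j (stdVec P (G x y z)) = _ :=
    genAct_pos P j (by omega) (G x y z) (G x z y) i y z hpj (Gi ..) (Gj ..) (Gi ..) (Gj ..) (by
      intro k h1 h2
      by_cases h3 : k = a
      · subst h3; simp [Ga]
      · simp [Go, h1, h2, h3])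
  rw [hf]
  generalize f a = x, f i = y, f j = z
  clear_value G
  have hq := P.q_ne
  clear ha hpj hi hj hai hij haj Ga Gi Gj Go
  rcases lt_trichotomy x y with h1 | h1 | h1 <;> rcases lt_trichotomy y z with h2 | h2 | h2 <;>
  rcases lt_trichotomy x z with h3 | h3 | h3 <;>
  first
  | (exfalso; order)
  | (try subst h1
     try subst h2
     try subst h3
     simp only [Module.End.mul_apply, map_add, map_smul, Ti, Tj, lt_irrefl, if_true, if_false, *,
       not_lt_of_gt]
     try (match_scalars <;> (try field_simp) <;> (try ring)))

theorem genAct_braid_zero (P : HeckeParam K) (r m : ℕ) {d : ℕ} (i j : Fin d) (hi : i.val = 0)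
    (hj : j.val = 1) :
    genAct P r m i * genAct P r m j * genAct P r m i * genAct P r m j =
      genAct P r m j * genAct P r m i * genAct P r m j * genAct P r m i := by
  apply end_ext
  intro f
  have hpj : i = prevIdx j := by apply Fin.ext; simp [prevIdx]; omega
  have hij : i ≠ j := by intro h; have := congrArg Fin.val h; omega
  let G (x y : Idx r m) : Weight r m d := Function.update (Function.update f i x) j y
  have Gi (x y) : G x y i = x := by simp [G, hij]
  have Gj (x y) : G x y j = y := by simp [G]
  have Ti (x y) : genAct P r m i (stdVec P (G x y)) = _ :=
    genAct_zero P i hi (G x y) (G (signFlip x) y) x (Gi ..) (Gi ..) (by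
      intro k h1
      by_cases h2 : k = j
      · subst h2; simp [Gj]
      · simp [G, h1, h2])
  have Tj (x y) : genAct P r m j (stdVec P (G x y)) = _ :=
    genAct_pos P j (by omega) (G x y) (G y x) i x y hpj (Gi ..) (Gj ..) (Gi ..) (Gj ..)
      (by intro k h1 h2; simp [G, h1, h2])
  have hf : f = G (f i) (f j) := by simp [G]
  rw [hf]
  generalize f i = x, f j = y
  clear_value G
  have hq := P.q_ne
  have hp := P.p_ne
  have hx1 := signFlip_signFlip x
  have hy1 := signFlip_signFlip y
  have hx2 := isBlack_signFlip x
  have hy2 := isBlack_signFlip y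
  have hbx := color_cases x
  have hby := color_cases y
  clear hpj hi hj hij Gi Gj hf
  generalize hx' : signFlip x = x' at *
  generalize hy' : signFlip y = y' at *
  rcases hbx with ⟨c1, c2, c3, c4, c5, c6⟩ | ⟨c1, c2, c3, c4, c5, c6⟩ | ⟨c1, c2, c3, c4, c5, c6⟩ <;>
  rcases hby with ⟨e1, e2, e3, e4, e5, e6⟩ | ⟨e1, e2, e3, e4, e5, e6⟩ | ⟨e1, e2, e3, e4, e5, e6⟩ <;>
  rcases lt_trichotomy x.val y.val with h1 | h1 | h1 <;>
  (try (exfalso; omega)) <;>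
  rcases lt_trichotomy x.val y'.val with h2 | h2 | h2 <;>
  (try (exfalso; omega)) <;>
  rcases lt_trichotomy x'.val y.val with h3 | h3 | h3 <;>
  (try (exfalso; omega)) <;>
  rcases lt_trichotomy x'.val y'.val with h4 | h4 | h4 <;>
  (try (exfalso; omega)) <;>
  clear c4 c5 e4 e5 <;>
  (try replace h1 := Fin.ext h1) <;> (try replace h2 := Fin.ext h2) <;>
  (try replace h3 := Fin.ext h3) <;> (try replace h4 := Fin.ext h4) <;>
  (try replace c6 := Fin.ext c6) <;> (try replace e6 := Fin.ext e6) <;>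
  (try subst c6) <;> (try subst e6) <;>
  (try subst h1) <;> (try subst h2) <;> (try subst h3) <;> (try subst h4) <;>
  simp only [Module.End.mul_apply, map_add, map_smul, Ti, Tj, lt_irrefl, if_true, if_false, *,
    not_lt_of_gt, Fin.lt_def] <;>
  (try (match_scalars <;> (try field_simp) <;> (try ring)))

theorem genAct_rel (P : HeckeParam K) (r m d : ℕ) ⦃x y : FreeAlgebra K (Fin d)⦄
    (h : HeckeRel P d x y) :
    FreeAlgebra.lift K (fun i => MulOpposite.op (genAct P r m i)) x =
      FreeAlgebra.lift K (fun i => MulOpposite.op (genAct P r m i)) y := by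
  cases h with
  | quad i =>
    have h := genAct_quad P r m i
    have h' : (genAct P r m i + algebraMap K _ (P.par i)⁻¹) *
        (genAct P r m i - algebraMap K _ (P.par i)) = 0 := by
      rw [← h, add_mul, mul_sub, mul_sub, sub_mul, mul_add, mul_add,
        ← Algebra.commutes (P.par i)⁻¹, ← Algebra.commutes (P.par i),
        ← Algebra.commutes (P.par i)⁻¹]
      abel
    apply MulOpposite.unop_injective
    simpa using h'
  | braid i j hi hj =>
    simp only [map_mul, FreeAlgebra.lift_ι_apply, ← MulOpposite.op_mul, ← mul_assoc]
    rw [genAct_braid P r m i j hi hj]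
  | comm i j h =>
    simp only [map_mul, FreeAlgebra.lift_ι_apply, ← MulOpposite.op_mul]
    rw [genAct_comm P r m i j h]
  | braid_zero i j hi hj =>
    simp only [map_mul, FreeAlgebra.lift_ι_apply, ← MulOpposite.op_mul, ← mul_assoc]
    rw [genAct_braid_zero P r m i j hi hj]

/-- The right action of the Hecke algebra on the tensor space, as a homomorphism. -/
def heckeRep (P : HeckeParam K) (r m d : ℕ) :
    Hecke P d →ₐ[K] (Module.End K (TensorSpace P r m d))ᵐᵒᵖ :=
  RingQuot.liftAlgHom K
    ⟨FreeAlgebra.lift K (fun i => MulOpposite.op (genAct P r m i)), genAct_rel P r m d⟩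

/-- The right module structure of the tensor space over the Hecke algebra: `x <• h` is `x · h`. -/
instance (P : HeckeParam K) (r m d : ℕ) : Module (Hecke P d)ᵐᵒᵖ (TensorSpace P r m d) :=
  Module.compHom _ (AlgHom.opComm (heckeRep P r m d)).toRingHom

theorem smul_eq_heckeRep (P : HeckeParam K) {r m d : ℕ} (x : TensorSpace P r m d)
    (h : Hecke P d) : x <• h = (heckeRep P r m d h).unop x := rfl

theorem stdVec_smul_Hgen (P : HeckeParam K) {r m d : ℕ} (f : Weight r m d) (i : Fin d) :
    stdVec P f <• Hgen P i = genActVec P i f := by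
  rw [smul_eq_heckeRep, heckeRep, Hgen, RingQuot.liftAlgHom_mkAlgHom_apply,
    FreeAlgebra.lift_ι_apply, MulOpposite.unop_op, genAct_stdVec]

instance (P : HeckeParam K) (r m d : ℕ) :
    IsScalarTower K (Hecke P d)ᵐᵒᵖ (TensorSpace P r m d) where
  smul_assoc c h x := by
    change (heckeRep P r m d (c • h).unop).unop x = c • (heckeRep P r m d h.unop).unop x
    rw [MulOpposite.unop_smul, map_smul]; rfl

/-- The quasi-permutation module `𝕄_f`, the cyclic right module generated by `M_f`. -/
def QPerm (P : HeckeParam K) {r m d : ℕ} (f : Weight r m d) :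
    Submodule (Hecke P d)ᵐᵒᵖ (TensorSpace P r m d) :=
  Submodule.span _ {stdVec P f}

/-- The generator `M_f` of `𝕄_f`. -/
def QPerm.gen (P : HeckeParam K) {r m d : ℕ} (f : Weight r m d) : QPerm P f :=
  ⟨stdVec P f, Submodule.mem_span_singleton_self _⟩

/-- `ψ` is the bar involution of `𝕄_f`: it is anti-linear, it fixes `M_f`, it is compatible with
the bar involution of the Hecke algebra, it is an involution, and it sends `M_{f · σ}` to
`M_f · (bar H_σ)` for every minimal length representative `σ`. -/
structure IsBarInvolution (P : HeckeParam K) {r m d : ℕ} (f : Weight r m d)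
    (ψ : QPerm P f →ₛₗ[P.bar] QPerm P f) : Prop where
  map_gen : ψ (QPerm.gen P f) = QPerm.gen P f
  map_act : ∀ (x : QPerm P f) (h : Hecke P d), ψ (x <• h) = ψ x <• heckeBar P d h
  involutive : ∀ x, ψ (ψ x) = x
  map_std : ∀ σ ∈ minReps f, ∀ l, IsReducedExpr l σ →
    ∃ x : QPerm P f, (x : TensorSpace P r m d) = stdVec P (wact f σ) ∧
      ψ x = QPerm.gen P f <• heckeBar P d (Hword P l)

/-- The subset `q⁻¹ ℤ[q⁻¹]` of the ground field. -/
def qInvIntPoly (P : HeckeParam K) : Set K :=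
  {c | ∃ g : Polynomial ℤ, c = P.q⁻¹ * Polynomial.aeval P.q⁻¹ g}

/-- The additive group `∑_{w ∈ S} q⁻¹ ℤ[q⁻¹] M_{f · w}`. -/
def qInvSpan (P : HeckeParam K) {r m d : ℕ} (f : Weight r m d) (S : Set (WB d)) :
    AddSubgroup (TensorSpace P r m d) :=
  AddSubgroup.closure {x | ∃ w ∈ S, ∃ c ∈ qInvIntPoly P, x = c • stdVec P (wact f w)}

end Tensor

end QuasiKL

end

open QuasiKL

/-!
Write `M_σ` for `M_{f · σ}`, where `σ` runs over the minimal length representatives. These vectors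
form a basis of `𝕄_f`, and `M_f H_σ = M_σ`. So the anti-linear map `ψ` with
`ψ(M_σ) = M_f · (bar H_σ)` exists on `𝕄_f`, and everything in part (1) follows once
`ψ(M_σ H_i) = ψ(M_σ) H_i⁻¹` is known for all `σ` and `i` (`tensorBar_stdVec_smul_Hgen`). If
`f · σ s_i ≠ f · σ`, then `σ s_i` is again a minimal length representative and the claim is immediate
from the quadratic relation. If `f · σ s_i = f · σ`, then `M_f · (bar H_σ)` has to be an eigenvector
of `H_i` with eigenvalue `q_i` (`barVec_smul_of_wact_eq`). For `i > 0` the element `σ s_i σ⁻¹` is a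
simple reflection `s_c` of the stabilizer of `f`, so that `H_σ H_i = H_c H_σ`. For `i = 0` it is the
sign change at a black place `a + 1`, which need not be simple, as the stabilizer need not be parabolic.
Here `σ = s_a ⋯ s_1 σ'` with additive lengths, where `σ'` commutes with `s_0`. The letters
`s_a, …, s_1` only permute the first entries of `f`, all of which are black, and `H_0` acts by the
scalar `p` on every `M_g` with `g(1)` black (`smul_heckeBar_Helt_zero`).

The combinatorics of `W_d` is derived from one notion: `PosOn w t` says that `w` maps the positive
root of the reflection `t` to a positive root. It yields the strong exchange property, the criterion
for `len w < len (w * t)`, the lifting property of the Bruhat order, and Matsumoto's theorem for the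
words `H_{i_1} ⋯ H_{i_n}` (`Hword_eq_of_isReducedExpr`). The minimal length representatives are the
`σ` that preserve the order of any two places of `{±1, …, ±d}` at which `f · σ` takes the same value
(`mem_minReps_iff`). This makes them unique in their cosets.

For `p = q ^ k` the matrix of `ψ` is unitriangular for the Bruhat order with entries in `ℤ[q, q⁻¹]`
(`barVec_sub_mem`), so part (2) is Lusztig's lemma. Its form here is that an anti-invariant
combination `x` of the `M_w` in a lower set is `y - ψ(y)` with coefficients of `y` in `q⁻¹ ℤ[q⁻¹]`
(`LusztigData.exists_sub_map`), applied to `x = ψ(M_σ) - M_σ`.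
-/

namespace QuasiKL

open scoped RightActions

/-! ### Signed values and positivity of roots -/

/-- The integer `ε * (i + 1)` that the pair `(i, ε)` encodes. -/
def sval {d : ℕ} (x : SgnIdx d) : ℤ := (x.2 : ℤ) * ((x.1.val : ℤ) + 1)

@[simp] theorem sval_one {d : ℕ} (k : Fin d) : sval (k, 1) = (k.val : ℤ) + 1 := by simp [sval]

@[simp] theorem sval_neg_one {d : ℕ} (k : Fin d) : sval (k, -1) = -((k.val : ℤ) + 1) := by
  simp [sval]

theorem sval_injective {d : ℕ} : Function.Injective (sval (d := d)) := by
  rintro ⟨i, ε⟩ ⟨j, δ⟩ h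
  rcases Int.units_eq_one_or ε with rfl | rfl <;> rcases Int.units_eq_one_or δ with rfl | rfl <;>
    simp only [sval_one, sval_neg_one] at h
  · rw [Fin.ext (by omega : i.val = j.val)]
  · omega
  · omega
  · rw [Fin.ext (by omega : i.val = j.val)]

@[simp] theorem sval_negIdx {d : ℕ} (x : SgnIdx d) : sval (negIdx d x) = -sval x := by
  obtain ⟨i, ε⟩ := x
  simp [sval, negIdx]

theorem sval_ne_zero {d : ℕ} (x : SgnIdx d) : sval x ≠ 0 := by
  obtain ⟨i, ε⟩ := x
  rcases Int.units_eq_one_or ε with rfl | rfl <;> simp only [sval_one, sval_neg_one] <;> omega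

theorem negIdx_negIdx {d : ℕ} (x : SgnIdx d) : negIdx d (negIdx d x) = x := by
  obtain ⟨i, ε⟩ := x; simp [negIdx]

theorem sval_apply_negIdx {d : ℕ} (w : WB d) (x : SgnIdx d) :
    sval (w.1 (negIdx d x)) = -sval (w.1 x) := by rw [apply_neg, sval_negIdx]

theorem eq_of_apply_one {d : ℕ} {u v : WB d} (h : ∀ k, u.1 (k, 1) = v.1 (k, 1)) : u = v := by
  apply Subtype.ext
  apply Equiv.ext
  rintro ⟨k, ε⟩
  rcases Int.units_eq_one_or ε with rfl | rfl
  · exact h k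
  · have e : ((k, -1) : SgnIdx d) = negIdx d (k, 1) := by simp [negIdx]
    rw [e, apply_neg, apply_neg, h]

theorem sval_simpleRefl_zero {d : ℕ} (i : Fin d) (hi : i.val = 0) (x : SgnIdx d) :
    sval ((simpleRefl i).1 x) = if sval x = 1 ∨ sval x = -1 then -sval x else sval x := by
  obtain ⟨j, ε⟩ := x
  change sval (simplePerm i (j, ε)) = _
  rw [simplePerm_zero_apply i hi]
  by_cases hj : j = i
  · subst hj
    rcases Int.units_eq_one_or ε with rfl | rfl <;> simp [hi]
  · have : j.val ≠ 0 := fun h => hj (Fin.ext (by omega))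
    rw [if_neg hj, if_neg]
    rcases Int.units_eq_one_or ε with rfl | rfl <;>
      simp only [sval_one, sval_neg_one] <;> omega

theorem sval_simpleRefl_pos {d : ℕ} (i : Fin d) (hi : i.val ≠ 0) (x : SgnIdx d) :
    sval ((simpleRefl i).1 x) = if sval x = i.val then (i.val : ℤ) + 1
      else if sval x = i.val + 1 then (i.val : ℤ)
      else if sval x = -i.val then -((i.val : ℤ) + 1)
      else if sval x = -((i.val : ℤ) + 1) then -(i.val : ℤ) else sval x := by
  obtain ⟨j, ε⟩ := x
  change sval (simplePerm i (j, ε)) = _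
  rw [simplePerm_pos_apply i hi]
  have hp : (prevIdx i).val = i.val - 1 := rfl
  by_cases h1 : j = i
  · subst h1
    rw [Equiv.swap_apply_right]
    rcases Int.units_eq_one_or ε with rfl | rfl <;> simp only [sval_one, sval_neg_one] <;>
      split_ifs <;> omega
  · by_cases h2 : j = prevIdx i
    · subst h2
      rw [Equiv.swap_apply_left]
      rcases Int.units_eq_one_or ε with rfl | rfl <;> simp only [sval_one, sval_neg_one] <;>
        split_ifs <;> omega
    · rw [Equiv.swap_apply_of_ne_of_ne h2 h1]
      have h1' : j.val ≠ i.val := fun h => h1 (Fin.ext h)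
      have h2' : j.val ≠ i.val - 1 := fun h => h2 (Fin.ext h)
      rcases Int.units_eq_one_or ε with rfl | rfl <;> simp only [sval_one, sval_neg_one] <;>
        split_ifs <;> omega

theorem simpleRefl_mul_self {d : ℕ} (i : Fin d) : simpleRefl i * simpleRefl i = 1 := by
  apply eq_of_apply_one
  intro k
  apply sval_injective
  change sval ((simpleRefl i).1 ((simpleRefl i).1 (k, 1))) = sval (k, 1)
  by_cases hi : i.val = 0
  · simp only [sval_simpleRefl_zero i hi]; split_ifs <;> omega
  · simp only [sval_simpleRefl_pos i hi]; split_ifs <;> omega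

theorem simpleRefl_inv {d : ℕ} (i : Fin d) : (simpleRefl i)⁻¹ = simpleRefl i :=
  inv_eq_of_mul_eq_one_left (simpleRefl_mul_self i)

theorem simpleRefl_apply_apply {d : ℕ} (i : Fin d) (x : SgnIdx d) :
    (simpleRefl i).1 ((simpleRefl i).1 x) = x := by
  have := congrArg (fun w : WB d => w.1 x) (simpleRefl_mul_self i)
  exact this

/-- Simple reflections preserve the order of every pair that they do not exchange. -/
theorem sval_simpleRefl_lt {d : ℕ} (i : Fin d) {x y : SgnIdx d} (h : sval x < sval y)
    (hne : y ≠ (simpleRefl i).1 x) :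
    sval ((simpleRefl i).1 x) < sval ((simpleRefl i).1 y) := by
  have hne' : sval y ≠ sval ((simpleRefl i).1 x) := fun e => hne (sval_injective e)
  have hx := sval_ne_zero x
  have hy := sval_ne_zero y
  by_cases hi : i.val = 0
  · simp only [sval_simpleRefl_zero i hi] at hne' ⊢; split_ifs at hne' ⊢ <;> omega
  · simp only [sval_simpleRefl_pos i hi] at hne' ⊢; split_ifs at hne' ⊢ <;> omega

/-- An involution that exchanges one pair `x`, `y`, hence also `-x`, `-y`, and fixes everything
else. These are the reflections, described without reference to conjugation. -/
structure SwapsOnePair {d : ℕ} (t : WB d) : Prop where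
  mul_self : t * t = 1
  ne_one : t ≠ 1
  moved : ∀ x y, t.1 x ≠ x → t.1 y ≠ y →
    y = x ∨ y = t.1 x ∨ y = negIdx d x ∨ y = negIdx d (t.1 x)

theorem SwapsOnePair.apply_apply {d : ℕ} {t : WB d} (ht : SwapsOnePair t) (x : SgnIdx d) :
    t.1 (t.1 x) = x :=
  congrArg (fun w : WB d => w.1 x) ht.mul_self

theorem SwapsOnePair.exists_lt {d : ℕ} {t : WB d} (ht : SwapsOnePair t) :
    ∃ x, sval x < sval (t.1 x) := by
  by_contra! h
  apply ht.ne_one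
  apply eq_of_apply_one
  intro k
  apply sval_injective
  have h1 := h (t.1 (k, 1))
  rw [ht.apply_apply] at h1
  exact le_antisymm (h _) h1

theorem swapsOnePair_simpleRefl {d : ℕ} (i : Fin d) : SwapsOnePair (simpleRefl i) where
  mul_self := simpleRefl_mul_self i
  ne_one := by
    intro h
    have h' := congrArg (fun w : WB d => sval (w.1 (i, 1))) h
    change sval ((simpleRefl i).1 (i, 1)) = sval (i, 1) at h'
    by_cases hi : i.val = 0
    · simp [sval_simpleRefl_zero i hi, hi] at h'
    · simp [sval_simpleRefl_pos i hi] at h'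
  moved := by
    intro x y hx hy
    simp only [← (sval_injective (d := d)).ne_iff] at hx hy
    simp only [← (sval_injective (d := d)).eq_iff, sval_negIdx]
    by_cases hi : i.val = 0
    · simp only [sval_simpleRefl_zero i hi] at hx hy ⊢; split_ifs at hx hy ⊢ <;> omega
    · simp only [sval_simpleRefl_pos i hi] at hx hy ⊢; split_ifs at hx hy ⊢ <;> omega

theorem SwapsOnePair.conj {d : ℕ} {t : WB d} (ht : SwapsOnePair t) (u : WB d) :
    SwapsOnePair (u * t * u⁻¹) where
  mul_self := by
    have := ht.mul_self
    calc u * t * u⁻¹ * (u * t * u⁻¹) = u * (t * t) * u⁻¹ := by group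
      _ = 1 := by rw [this]; group
  ne_one := by
    intro h
    apply ht.ne_one
    calc t = u⁻¹ * (u * t * u⁻¹) * u := by group
      _ = 1 := by rw [h]; group
  moved := by
    intro x y hx hy
    obtain ⟨x, rfl⟩ := u.1.surjective x
    obtain ⟨y, rfl⟩ := u.1.surjective y
    have e (z) : (u * t * u⁻¹).1 (u.1 z) = u.1 (t.1 z) := by
      change u.1 (t.1 (u⁻¹.1 (u.1 z))) = _
      congr 2
      exact u.1.symm_apply_apply z
    rw [e] at hx hy
    rw [e, ← apply_neg, ← apply_neg]
    simp only [u.1.injective.eq_iff, u.1.injective.ne_iff] at hx hy ⊢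
    exact ht.moved x y hx hy

theorem IsRefl.swapsOnePair {d : ℕ} {t : WB d} (ht : IsRefl t) : SwapsOnePair t := by
  obtain ⟨u, i, rfl⟩ := ht
  exact (swapsOnePair_simpleRefl i).conj u

/-- Two reflections that agree at a moved point are equal. -/
theorem SwapsOnePair.eq_of_apply_eq {d : ℕ} {t t' : WB d} (ht : SwapsOnePair t)
    (ht' : SwapsOnePair t') {x : SgnIdx d} (hx : t.1 x ≠ x) (h : t.1 x = t'.1 x) : t = t' := by
  apply eq_of_apply_one
  intro k
  have key : ∀ {a b : WB d}, SwapsOnePair a → SwapsOnePair b → a.1 x ≠ x → a.1 x = b.1 x →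
      ∀ y, a.1 y ≠ y → a.1 y = b.1 y := by
    intro a b ha hb hx h y hy
    have e1 : a.1 (a.1 x) = b.1 (a.1 x) := by
      rw [ha.apply_apply, h, hb.apply_apply]
    rcases ha.moved x y hx hy with rfl | rfl | rfl | rfl
    · exact h
    · exact e1
    · rw [apply_neg, apply_neg, h]
    · rw [apply_neg, apply_neg, e1]
  by_cases h1 : t.1 (k, 1) = (k, 1)
  · by_cases h2 : t'.1 (k, 1) = (k, 1)
    · rw [h1, h2]
    · exact (key ht' ht (h ▸ hx) h.symm _ h2).symm
  · exact key ht ht' hx h _ h1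

/-- `w` maps the positive root of the reflection `t` to a positive root: it preserves the order
of the points that `t` exchanges. -/
def PosOn {d : ℕ} (w t : WB d) : Prop :=
  ∀ x, sval x < sval (t.1 x) → sval (w.1 x) < sval (w.1 (t.1 x))

theorem posOn_one {d : ℕ} (t : WB d) : PosOn 1 t := fun _ h => h

/-- If `w` does not preserve the order of one pair that `t` exchanges, it reverses all of them: the
only other such pair is the negative of the first. -/
theorem not_posOn {d : ℕ} {w t : WB d} (ht : SwapsOnePair t) (h : ¬ PosOn w t) (x : SgnIdx d)
    (hx : sval x < sval (t.1 x)) : sval (w.1 (t.1 x)) < sval (w.1 x) := by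
  unfold PosOn at h
  push Not at h
  obtain ⟨x₀, h1, h2⟩ := h
  have h3 : sval (w.1 (t.1 x₀)) ≠ sval (w.1 x₀) := by
    intro e
    have := w.1.injective (sval_injective e)
    rw [this] at h1
    exact lt_irrefl _ h1
  have h4 : sval (w.1 (t.1 x₀)) < sval (w.1 x₀) := lt_of_le_of_ne h2 h3
  have m0 : t.1 x₀ ≠ x₀ := fun e => by rw [e] at h1; exact lt_irrefl _ h1
  have m : t.1 x ≠ x := fun e => by rw [e] at hx; exact lt_irrefl _ hx
  rcases ht.moved x₀ x m0 m with rfl | rfl | rfl | rfl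
  · exact h4
  · rw [ht.apply_apply] at hx; omega
  · rw [apply_neg] at hx; simp only [sval_negIdx] at hx; omega
  · rw [apply_neg, ht.apply_apply, sval_apply_negIdx, sval_apply_negIdx]; omega

theorem posOn_mul_self {d : ℕ} {w t : WB d} (ht : SwapsOnePair t) :
    PosOn (w * t) t ↔ ¬ PosOn w t := by
  constructor
  · intro h h'
    obtain ⟨x, hx⟩ := ht.exists_lt
    have h1 := h x hx
    have h2 := h' x hx
    change sval (w.1 (t.1 x)) < sval (w.1 (t.1 (t.1 x))) at h1
    rw [ht.apply_apply] at h1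
    omega
  · intro h x hx
    change sval (w.1 (t.1 x)) < sval (w.1 (t.1 (t.1 x)))
    rw [ht.apply_apply]
    exact not_posOn ht h x hx

/-- The simple reflection `s_i` permutes the positive roots other than its own. -/
theorem posOn_mul_simpleRefl {d : ℕ} {w t : WB d} (ht : SwapsOnePair t) (i : Fin d)
    (hne : t ≠ simpleRefl i) :
    PosOn (w * simpleRefl i) t ↔ PosOn w (simpleRefl i * t * simpleRefl i) := by
  have hlt : ∀ {t : WB d}, SwapsOnePair t → t ≠ simpleRefl i → ∀ x, sval x < sval (t.1 x) →
      sval ((simpleRefl i).1 x) < sval ((simpleRefl i).1 (t.1 x)) := by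
    intro t ht hne x hx
    apply sval_simpleRefl_lt i hx
    intro e
    exact hne (ht.eq_of_apply_eq (swapsOnePair_simpleRefl i) (x := x)
      (fun e => by rw [e] at hx; exact lt_irrefl _ hx) e)
  have hs := simpleRefl_apply_apply i
  have ht' : SwapsOnePair (simpleRefl i * t * simpleRefl i) := by
    have := ht.conj (simpleRefl i)
    rwa [simpleRefl_inv] at this
  have hne' : simpleRefl i * t * simpleRefl i ≠ simpleRefl i := by
    intro e
    apply hne
    calc t = (simpleRefl i)⁻¹ * (simpleRefl i * t * simpleRefl i) * (simpleRefl i)⁻¹ := by group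
      _ = simpleRefl i := by rw [e, simpleRefl_inv, simpleRefl_mul_self, one_mul]
  constructor
  · intro h y hy
    have h1 := hlt ht' hne' y hy
    change sval ((simpleRefl i).1 y) <
      sval ((simpleRefl i).1 ((simpleRefl i).1 (t.1 ((simpleRefl i).1 y)))) at h1
    rw [hs] at h1
    have h2 := h _ h1
    change sval (w.1 ((simpleRefl i).1 ((simpleRefl i).1 y))) < _ at h2
    rw [hs] at h2
    exact h2
  · intro h x hx
    have h1 := hlt ht hne x hx
    have h2 := h ((simpleRefl i).1 x)
    change sval ((simpleRefl i).1 x) <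
      sval ((simpleRefl i).1 (t.1 ((simpleRefl i).1 ((simpleRefl i).1 x)))) →
      sval (w.1 ((simpleRefl i).1 x)) <
      sval (w.1 ((simpleRefl i).1 (t.1 ((simpleRefl i).1 ((simpleRefl i).1 x))))) at h2
    rw [hs] at h2
    exact h2 h1

/-! ### Generation by simple reflections -/

/-- The value `w(k)` as an integer. -/
def wval {d : ℕ} (w : WB d) (k : Fin d) : ℤ := sval (w.1 (k, 1))

theorem wval_mul_simpleRefl_zero {d : ℕ} (w : WB d) (i : Fin d) (hi : i.val = 0) (k : Fin d) :
    wval (w * simpleRefl i) k = if k = i then -wval w k else wval w k := by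
  change sval (w.1 (simplePerm i (k, 1))) = _
  rw [simplePerm_zero_apply i hi]
  by_cases hk : k = i
  · subst hk
    have e : ((k, -1) : SgnIdx d) = negIdx d (k, 1) := by simp [negIdx]
    rw [if_pos rfl, if_pos rfl, e, sval_apply_negIdx, wval]
  · rw [if_neg hk, if_neg hk, wval]

theorem wval_mul_simpleRefl_pos {d : ℕ} (w : WB d) (i : Fin d) (hi : i.val ≠ 0) (k : Fin d) :
    wval (w * simpleRefl i) k = wval w (Equiv.swap (prevIdx i) i k) := by
  change sval (w.1 (simplePerm i (k, 1))) = _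
  rw [simplePerm_pos_apply i hi, wval]

theorem wval_injective {d : ℕ} (w : WB d) : Function.Injective (wval w) := by
  intro j k h
  have := w.1.injective (sval_injective h)
  exact congrArg Prod.fst this

theorem posOn_simpleRefl_zero {d : ℕ} (w : WB d) (i : Fin d) (hi : i.val = 0) :
    PosOn w (simpleRefl i) ↔ 0 < wval w i := by
  have e : (simpleRefl i).1 (i, -1) = (i, 1) := by
    change simplePerm i (i, -1) = _
    rw [simplePerm_zero_apply i hi]; simp
  have e' : ((i, -1) : SgnIdx d) = negIdx d (i, 1) := by simp [negIdx]
  have hx : sval (i, -1) < sval ((simpleRefl i).1 (i, -1)) := by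
    rw [e, sval_one, sval_neg_one]; omega
  constructor
  · intro h
    have := h _ hx
    rw [e, e', sval_apply_negIdx] at this
    unfold wval; omega
  · intro h
    by_contra h'
    have := not_posOn (swapsOnePair_simpleRefl i) h' _ hx
    rw [e, e', sval_apply_negIdx] at this
    unfold wval at h; omega

theorem posOn_simpleRefl_pos {d : ℕ} (w : WB d) (i : Fin d) (hi : i.val ≠ 0) :
    PosOn w (simpleRefl i) ↔ wval w (prevIdx i) < wval w i := by
  have e : (simpleRefl i).1 (prevIdx i, 1) = (i, 1) := by
    change simplePerm i (prevIdx i, 1) = _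
    rw [simplePerm_pos_apply i hi]; simp
  have hx : sval (prevIdx i, 1) < sval ((simpleRefl i).1 (prevIdx i, 1)) := by
    rw [e, sval_one, sval_one, prevIdx]; simp only; omega
  constructor
  · intro h
    have := h _ hx
    rwa [e] at this
  · intro h
    by_contra h'
    have := not_posOn (swapsOnePair_simpleRefl i) h' _ hx
    rw [e] at this
    unfold wval at h; omega

theorem strictMono_of_prevIdx_lt {d : ℕ} {g : Fin d → ℤ}
    (h : ∀ i : Fin d, i.val ≠ 0 → g (prevIdx i) < g i) : StrictMono g := by
  cases d with
  | zero => exact fun i => i.elim0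
  | succ n =>
    rw [Fin.strictMono_iff_lt_succ]
    intro i
    have := h i.succ (by simp)
    have e : prevIdx i.succ = i.castSucc := by apply Fin.ext; simp [prevIdx]
    rwa [e] at this

theorem eq_id_of_strictMono {d : ℕ} {g : Fin d → Fin d} (h : StrictMono g) : g = id := by
  have hs : Function.Surjective g := Finite.injective_iff_surjective.1 h.injective
  exact (h.range_inj strictMono_id).1 (by rw [hs.range_eq, Set.range_id])

/-- An element without descents is trivial. -/
theorem eq_one_of_posOn {d : ℕ} {w : WB d} (h : ∀ i, PosOn w (simpleRefl i)) : w = 1 := by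
  have hm : StrictMono (wval w) :=
    strictMono_of_prevIdx_lt fun i hi => (posOn_simpleRefl_pos w i hi).1 (h i)
  have hpos : ∀ k, 0 < wval w k := by
    intro k
    let z : Fin d := ⟨0, by have := k.isLt; omega⟩
    have h0 := (posOn_simpleRefl_zero w z rfl).1 (h z)
    exact h0.trans_le (hm.monotone (Fin.mk_le_of_le_val (Nat.zero_le _)))
  have h2 : ∀ k, w.1 (k, 1) = ((w.1 (k, 1)).1, 1) := by
    intro k
    have := hpos k
    unfold wval at this
    rcases hx : w.1 (k, 1) with ⟨j, ε⟩
    rw [hx] at this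
    rcases Int.units_eq_one_or ε with rfl | rfl
    · rfl
    · rw [sval_neg_one] at this; omega
  have h3 : (fun k => (w.1 (k, 1)).1) = id := by
    apply eq_id_of_strictMono
    intro j k hjk
    have := hm hjk
    unfold wval at this
    rw [h2 j, h2 k, sval_one, sval_one] at this
    change (w.1 (j, 1)).1 < (w.1 (k, 1)).1
    exact Fin.lt_def.2 (by omega)
  apply eq_of_apply_one
  intro k
  rw [h2 k, congrFun h3 k]
  rfl

theorem wordProd_append {d : ℕ} (l l' : List (Fin d)) :
    wordProd (l ++ l') = wordProd l * wordProd l' := by simp [wordProd]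

theorem wordProd_concat {d : ℕ} (l : List (Fin d)) (i : Fin d) :
    wordProd (l ++ [i]) = wordProd l * simpleRefl i := by simp [wordProd]

theorem wordProd_cons {d : ℕ} (l : List (Fin d)) (i : Fin d) :
    wordProd (i :: l) = simpleRefl i * wordProd l := by simp [wordProd]

theorem wordProd_nil {d : ℕ} : wordProd ([] : List (Fin d)) = 1 := rfl

theorem wordProd_reverse {d : ℕ} (l : List (Fin d)) : wordProd l.reverse = (wordProd l)⁻¹ := by
  induction l with
  | nil => simp [wordProd_nil]
  | cons i l ih =>
    rw [List.reverse_cons, wordProd_concat, wordProd_cons, ih, mul_inv_rev, simpleRefl_inv]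

/-- A weighted sum of the values of `w`; removing a descent increases it. -/
def sortedness {d : ℕ} (w : WB d) : ℤ := ∑ k : Fin d, ((k.val : ℤ) + 1) * wval w k

theorem sortedness_lt {d : ℕ} {w : WB d} {i : Fin d} (h : ¬ PosOn w (simpleRefl i)) :
    sortedness w < sortedness (w * simpleRefl i) := by
  by_cases hi : i.val = 0
  · rw [posOn_simpleRefl_zero w i hi] at h
    have h0 : wval w i ≠ 0 := sval_ne_zero _
    apply Finset.sum_lt_sum
    · intro k _
      rw [wval_mul_simpleRefl_zero w i hi]
      split_ifs with hk
      · subst hk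
        apply mul_le_mul_of_nonneg_left <;> omega
      · exact le_rfl
    · refine ⟨i, Finset.mem_univ _, ?_⟩
      rw [wval_mul_simpleRefl_zero w i hi, if_pos rfl]
      apply mul_lt_mul_of_pos_left <;> omega
  · rw [posOn_simpleRefl_pos w i hi] at h
    have hne := prevIdx_ne i hi
    have h0 : wval w i ≠ wval w (prevIdx i) := (wval_injective w).ne hne.symm
    rw [← sub_pos, sortedness, sortedness, ← Finset.sum_sub_distrib,
      Fintype.sum_eq_add (prevIdx i) i hne]
    · simp only [wval_mul_simpleRefl_pos w i hi, Equiv.swap_apply_left, Equiv.swap_apply_right]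
      have : ((prevIdx i).val : ℤ) + 1 = i.val := by simp only [prevIdx]; omega
      rw [this]
      ring_nf
      omega
    · rintro k ⟨h1, h2⟩
      rw [wval_mul_simpleRefl_pos w i hi, Equiv.swap_apply_of_ne_of_ne h1 h2, sub_self]

/-- The simple reflections generate `W_d`: an element of `w * ⟨s_0, …, s_{d-1}⟩` with the largest
`sortedness` has no descents. -/
theorem exists_word {d : ℕ} (w : WB d) : ∃ l : List (Fin d), wordProd l = w := by
  obtain ⟨v, ⟨l, rfl⟩, hv⟩ := Set.exists_max_image {v | ∃ l, v = w * wordProd l} sortedness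
    (Set.toFinite _) ⟨w, [], by simp [wordProd_nil]⟩
  refine ⟨l.reverse, ?_⟩
  have h1 : w * wordProd l = 1 := by
    apply eq_one_of_posOn
    intro i
    by_contra h
    have h2 := sortedness_lt h
    have h3 := hv (w * wordProd l * simpleRefl i) ⟨l ++ [i], by rw [wordProd_concat, mul_assoc]⟩
    omega
  rw [wordProd_reverse, eq_comm]
  exact eq_inv_of_mul_eq_one_left h1

/-! ### Length and the strong exchange property -/

theorem exists_isReducedExpr {d : ℕ} (w : WB d) : ∃ l, IsReducedExpr l w := by
  obtain ⟨l₀, h₀⟩ := exists_word w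
  obtain ⟨l, h1, h2⟩ := Nat.sInf_mem (s := {n | ∃ l : List (Fin d), l.length = n ∧ wordProd l = w})
    ⟨_, l₀, rfl, h₀⟩
  exact ⟨l, h2, h1⟩

theorem len_wordProd_le {d : ℕ} (l : List (Fin d)) : len (wordProd l) ≤ l.length :=
  Nat.sInf_le ⟨l, rfl, rfl⟩

theorem len_one {d : ℕ} : len (1 : WB d) = 0 := Nat.le_zero.1 (len_wordProd_le (d := d) [])

theorem eq_one_of_len_eq_zero {d : ℕ} {w : WB d} (h : len w = 0) : w = 1 := by
  obtain ⟨l, h1, h2⟩ := exists_isReducedExpr w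
  rw [h, List.length_eq_zero_iff] at h2
  rw [← h1, h2, wordProd_nil]

theorem len_inv {d : ℕ} (w : WB d) : len w⁻¹ = len w := by
  have key : ∀ w : WB d, len w⁻¹ ≤ len w := by
    intro w
    obtain ⟨l, rfl, h⟩ := exists_isReducedExpr w
    rw [← wordProd_reverse, ← h, ← List.length_reverse]
    exact len_wordProd_le _
  refine le_antisymm (key w) ?_
  have := key w⁻¹
  rwa [inv_inv] at this

theorem len_mul_simpleRefl_le {d : ℕ} (w : WB d) (i : Fin d) :
    len (w * simpleRefl i) ≤ len w + 1 := by
  obtain ⟨l, rfl, h⟩ := exists_isReducedExpr w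
  rw [← wordProd_concat, ← h]
  simpa using len_wordProd_le (l ++ [i])

/-- Strong exchange: if `w` maps the root of `t` to a negative root, then a letter can be deleted
from any word for `w` to obtain a word for `w * t`. -/
theorem exists_word_mul_of_not_posOn {d : ℕ} (l : List (Fin d)) :
    ∀ {t : WB d}, SwapsOnePair t → ¬ PosOn (wordProd l) t →
      ∃ l' : List (Fin d), l'.length + 1 = l.length ∧ wordProd l' = wordProd l * t := by
  induction l using List.reverseRecOn with
  | nil => intro t _ h; exact absurd (posOn_one t) h
  | append_singleton l i ih =>
    intro t ht h
    by_cases hti : t = simpleRefl i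
    · subst hti
      refine ⟨l, by simp, ?_⟩
      rw [wordProd_concat, mul_assoc, simpleRefl_mul_self, mul_one]
    · rw [wordProd_concat, posOn_mul_simpleRefl ht i hti] at h
      have ht' := ht.conj (simpleRefl i)
      rw [simpleRefl_inv] at ht'
      obtain ⟨l', h1, h2⟩ := ih ht' h
      refine ⟨l' ++ [i], by simp [h1], ?_⟩
      rw [wordProd_concat, h2, wordProd_concat]
      calc wordProd l * (simpleRefl i * t * simpleRefl i) * simpleRefl i
          = wordProd l * simpleRefl i * t * (simpleRefl i * simpleRefl i) := by group
        _ = _ := by rw [simpleRefl_mul_self, mul_one]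

theorem len_mul_lt_of_not_posOn {d : ℕ} {w t : WB d} (ht : SwapsOnePair t) (h : ¬ PosOn w t) :
    len (w * t) < len w := by
  obtain ⟨l, rfl, h2⟩ := exists_isReducedExpr w
  obtain ⟨l', h3, h4⟩ := exists_word_mul_of_not_posOn l ht h
  rw [← h4, ← h2]
  have := len_wordProd_le l'
  omega

theorem len_lt_len_mul_iff {d : ℕ} {w t : WB d} (ht : SwapsOnePair t) :
    len w < len (w * t) ↔ PosOn w t := by
  constructor
  · intro h
    by_contra h'
    have := len_mul_lt_of_not_posOn ht h'
    omega
  · intro h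
    have h1 : ¬ PosOn (w * t) t := fun h' => (posOn_mul_self ht).1 h' h
    have h2 := len_mul_lt_of_not_posOn ht h1
    rwa [mul_assoc, ht.mul_self, mul_one] at h2

theorem len_mul_simpleRefl_of_posOn {d : ℕ} {w : WB d} {i : Fin d}
    (h : PosOn w (simpleRefl i)) : len (w * simpleRefl i) = len w + 1 := by
  have h1 := (len_lt_len_mul_iff (swapsOnePair_simpleRefl i)).2 h
  have h2 := len_mul_simpleRefl_le w i
  omega

theorem len_mul_simpleRefl_of_not_posOn {d : ℕ} {w : WB d} {i : Fin d}
    (h : ¬ PosOn w (simpleRefl i)) : len (w * simpleRefl i) + 1 = len w := by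
  have h1 := len_mul_lt_of_not_posOn (swapsOnePair_simpleRefl i) h
  have h2 := len_mul_simpleRefl_le (w * simpleRefl i) i
  rw [mul_assoc, simpleRefl_mul_self, mul_one] at h2
  omega

/-! ### The Bruhat order -/

theorem BruhatLT.len_lt {d : ℕ} {u v : WB d} (h : BruhatLT u v) : len u < len v := by
  induction h with
  | single h => obtain ⟨t, _, _, h⟩ := h; exact h
  | tail _ h ih => obtain ⟨t, _, _, h⟩ := h; exact ih.trans h

theorem bruhatLT_mul_simpleRefl {d : ℕ} {w : WB d} {i : Fin d} (h : PosOn w (simpleRefl i)) :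
    BruhatLT w (w * simpleRefl i) :=
  Relation.TransGen.single ⟨simpleRefl i, ⟨1, i, by simp⟩, rfl,
    (len_lt_len_mul_iff (swapsOnePair_simpleRefl i)).2 h⟩

theorem BruhatLT.trans {d : ℕ} {u v w : WB d} (h : BruhatLT u v) (h' : BruhatLT v w) :
    BruhatLT u w := Relation.TransGen.trans h h'

/-- Lifting property: for `v < v * s`, right multiplication by `s` maps elements below `v` to
elements below `v * s`. -/
theorem BruhatLT.mul_simpleRefl {d : ℕ} {u v : WB d} {i : Fin d} (h : BruhatLT u v)
    (hv : PosOn v (simpleRefl i)) : BruhatLT (u * simpleRefl i) (v * simpleRefl i) := by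
  have key : ∀ {u w : WB d}, (∃ t, IsRefl t ∧ w = u * t ∧ len u < len w) →
      u * simpleRefl i = w ∨ BruhatLT (u * simpleRefl i) (w * simpleRefl i) := by
    rintro u w ⟨t, ht, rfl, hlt⟩
    by_cases hti : t = simpleRefl i
    · left; rw [hti]
    · right
      have hp := (len_lt_len_mul_iff ht.swapsOnePair).1 hlt
      have ht' : IsRefl (simpleRefl i * t * simpleRefl i) := by
        obtain ⟨x, j, rfl⟩ := ht
        refine ⟨simpleRefl i * x, j, ?_⟩
        rw [mul_inv_rev, simpleRefl_inv]; group
      refine Relation.TransGen.single ⟨simpleRefl i * t * simpleRefl i, ht', ?_, ?_⟩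
      · calc u * t * simpleRefl i = u * 1 * t * simpleRefl i := by group
          _ = u * (simpleRefl i * simpleRefl i) * t * simpleRefl i := by rw [simpleRefl_mul_self]
          _ = _ := by group
      · have e : u * t * simpleRefl i =
            u * simpleRefl i * (simpleRefl i * t * simpleRefl i) := by
          calc u * t * simpleRefl i = u * 1 * t * simpleRefl i := by group
          _ = u * (simpleRefl i * simpleRefl i) * t * simpleRefl i := by rw [simpleRefl_mul_self]
          _ = _ := by group
        rw [e, len_lt_len_mul_iff ht'.swapsOnePair,
          posOn_mul_simpleRefl ht'.swapsOnePair]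
        · have e2 : simpleRefl i * (simpleRefl i * t * simpleRefl i) * simpleRefl i = t := by
            calc _ = simpleRefl i * simpleRefl i * t * (simpleRefl i * simpleRefl i) := by group
              _ = t := by rw [simpleRefl_mul_self]; group
          rw [e2]; exact hp
        · intro e3
          apply hti
          calc t = (simpleRefl i)⁻¹ * (simpleRefl i * t * simpleRefl i) * (simpleRefl i)⁻¹ := by
                group
            _ = simpleRefl i := by rw [e3, simpleRefl_inv, simpleRefl_mul_self, one_mul]
  induction h using Relation.TransGen.head_induction_on with
  | single h =>
    rcases key h with e | e
    · rw [e]; exact bruhatLT_mul_simpleRefl hv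
    · exact e
  | head h h' ih =>
    rcases key h with e | e
    · rw [e]; exact BruhatLT.trans h' (bruhatLT_mul_simpleRefl hv)
    · exact e.trans ih

/-! ### Independence of the reduced expression -/

theorem simpleRefl_zero_apply {d : ℕ} {i : Fin d} (hi : i.val = 0) (ε : ℤˣ) :
    (simpleRefl i).1 (i, ε) = (i, -ε) := by
  change simplePerm i (i, ε) = _
  rw [simplePerm_zero_apply i hi, if_pos rfl]

theorem simpleRefl_zero_apply_of_ne {d : ℕ} {i j : Fin d} (hi : i.val = 0) (hj : j ≠ i) (ε : ℤˣ) :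
    (simpleRefl i).1 (j, ε) = (j, ε) := by
  change simplePerm i (j, ε) = _
  rw [simplePerm_zero_apply i hi, if_neg hj]

theorem simpleRefl_pos_apply {d : ℕ} {i : Fin d} (hi : i.val ≠ 0) (ε : ℤˣ) :
    (simpleRefl i).1 (i, ε) = (prevIdx i, ε) := by
  change simplePerm i (i, ε) = _
  rw [simplePerm_pos_apply i hi, Equiv.swap_apply_right]

theorem simpleRefl_pos_apply_prevIdx {d : ℕ} {i : Fin d} (hi : i.val ≠ 0) (ε : ℤˣ) :
    (simpleRefl i).1 (prevIdx i, ε) = (i, ε) := by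
  change simplePerm i (prevIdx i, ε) = _
  rw [simplePerm_pos_apply i hi, Equiv.swap_apply_left]

theorem simpleRefl_pos_apply_of_ne {d : ℕ} {i j : Fin d} (hi : i.val ≠ 0) (h : j ≠ prevIdx i)
    (hj : j ≠ i) (ε : ℤˣ) : (simpleRefl i).1 (j, ε) = (j, ε) := by
  change simplePerm i (j, ε) = _
  rw [simplePerm_pos_apply i hi, Equiv.swap_apply_of_ne_of_ne h hj]

theorem SwapsOnePair.conj_simpleRefl {d : ℕ} {t : WB d} (ht : SwapsOnePair t) (i : Fin d) :
    SwapsOnePair (simpleRefl i * t * simpleRefl i) := by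
  have := ht.conj (simpleRefl i)
  rwa [simpleRefl_inv] at this

theorem simpleRefl_comm {d : ℕ} {i j : Fin d} (h : i.val + 1 < j.val) :
    simpleRefl i * simpleRefl j = simpleRefl j * simpleRefl i := by
  have hj0 : j.val ≠ 0 := by omega
  have hpj := prevIdx_ne j hj0
  have n1 : j ≠ i := by intro e; have := congrArg Fin.val e; omega
  have hp : (prevIdx j).val = j.val - 1 := rfl
  have n2 : prevIdx j ≠ i := by intro e; have := congrArg Fin.val e; omega
  have f (k : Fin d) (hk : i.val < k.val) : (simpleRefl i).1 (k, 1) = (k, 1) := by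
    have n3 : k ≠ i := by intro e; have := congrArg Fin.val e; omega
    by_cases hi0 : i.val = 0
    · exact simpleRefl_zero_apply_of_ne hi0 n3 1
    · refine simpleRefl_pos_apply_of_ne hi0 ?_ n3 1
      intro e; have := congrArg Fin.val e; simp only [prevIdx] at this; omega
  have e : simpleRefl j = simpleRefl i * simpleRefl j * simpleRefl i := by
    apply (swapsOnePair_simpleRefl j).eq_of_apply_eq
      ((swapsOnePair_simpleRefl j).conj_simpleRefl i) (x := (j, 1))
    · rw [simpleRefl_pos_apply hj0]
      intro e; exact hpj (congrArg Prod.fst e)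
    · change _ = (simpleRefl i).1 ((simpleRefl j).1 ((simpleRefl i).1 (j, 1)))
      rw [f j (by omega), simpleRefl_pos_apply hj0, f _ (by omega)]
  calc simpleRefl i * simpleRefl j
      = simpleRefl i * simpleRefl j * (simpleRefl i * simpleRefl i) := by
        rw [simpleRefl_mul_self, mul_one]
    _ = (simpleRefl i * simpleRefl j * simpleRefl i) * simpleRefl i := by group
    _ = _ := by rw [← e]

theorem simpleRefl_braid {d : ℕ} {i j : Fin d} (hi : i.val ≠ 0) (hj : j.val = i.val + 1) :
    simpleRefl i * simpleRefl j * simpleRefl i = simpleRefl j * simpleRefl i * simpleRefl j := by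
  have hj0 : j.val ≠ 0 := by omega
  have hpj : prevIdx j = i := by apply Fin.ext; simp [prevIdx]; omega
  have n1 := prevIdx_ne i hi
  have n2 : j ≠ i := by intro e; have := congrArg Fin.val e; omega
  have n3 : j ≠ prevIdx i := by
    intro e; have := congrArg Fin.val e; simp only [prevIdx] at this; omega
  have ei := simpleRefl_pos_apply_prevIdx hi 1
  have ej := simpleRefl_pos_apply_prevIdx hj0 1
  rw [hpj] at ej
  have h1 : (simpleRefl i * simpleRefl j * simpleRefl i).1 (prevIdx i, 1) = (j, 1) := by
    change (simpleRefl i).1 ((simpleRefl j).1 ((simpleRefl i).1 (prevIdx i, 1))) = _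
    rw [ei, ej, simpleRefl_pos_apply_of_ne hi n3 n2]
  apply ((swapsOnePair_simpleRefl j).conj_simpleRefl i).eq_of_apply_eq
      ((swapsOnePair_simpleRefl i).conj_simpleRefl j) (x := (prevIdx i, 1))
  · rw [h1]
    intro e; exact n3 (congrArg Prod.fst e)
  · rw [h1]
    change _ = (simpleRefl j).1 ((simpleRefl i).1 ((simpleRefl j).1 (prevIdx i, 1)))
    rw [simpleRefl_pos_apply_of_ne hj0 (by rwa [hpj]) n3.symm, ei, ej]

theorem simpleRefl_braid_zero {d : ℕ} {i j : Fin d} (hi : i.val = 0) (hj : j.val = 1) :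
    simpleRefl i * simpleRefl j * simpleRefl i * simpleRefl j =
      simpleRefl j * simpleRefl i * simpleRefl j * simpleRefl i := by
  have hj0 : j.val ≠ 0 := by omega
  have hpj : prevIdx j = i := by apply Fin.ext; simp [prevIdx]; omega
  have n : j ≠ i := by intro e; have := congrArg Fin.val e; omega
  have ej := fun ε => simpleRefl_pos_apply_prevIdx hj0 ε
  rw [hpj] at ej
  have ej' := fun ε => simpleRefl_pos_apply hj0 ε
  rw [hpj] at ej'
  have h1 : (simpleRefl i * simpleRefl j * simpleRefl i).1 (i, 1) = (j, -1) := by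
    change (simpleRefl i).1 ((simpleRefl j).1 ((simpleRefl i).1 (i, 1))) = _
    rw [simpleRefl_zero_apply hi, ej, simpleRefl_zero_apply_of_ne hi n]
  have e : simpleRefl i * simpleRefl j * simpleRefl i =
      simpleRefl j * (simpleRefl i * simpleRefl j * simpleRefl i) * simpleRefl j := by
    have hs := (swapsOnePair_simpleRefl j).conj_simpleRefl i
    apply hs.eq_of_apply_eq (hs.conj_simpleRefl j) (x := (i, 1))
    · rw [h1]
      intro e; exact n (congrArg Prod.fst e)
    · rw [h1]
      change _ = (simpleRefl j).1 ((simpleRefl i).1 ((simpleRefl j).1 ((simpleRefl i).1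
        ((simpleRefl j).1 (i, 1)))))
      rw [ej, simpleRefl_zero_apply_of_ne hi n, ej', simpleRefl_zero_apply hi, ej]
  calc simpleRefl i * simpleRefl j * simpleRefl i * simpleRefl j
      = simpleRefl j * (simpleRefl i * simpleRefl j * simpleRefl i) * simpleRefl j *
        simpleRefl j := by rw [← e]
    _ = simpleRefl j * simpleRefl i * simpleRefl j * simpleRefl i *
        (simpleRefl j * simpleRefl j) := by group
    _ = _ := by rw [simpleRefl_mul_self, mul_one]

section Matsumoto

variable {K : Type} [Field K]

theorem Hword_append (P : HeckeParam K) {d : ℕ} (l l' : List (Fin d)) :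
    Hword P (l ++ l') = Hword P l * Hword P l' := by simp [Hword]

theorem Hword_concat (P : HeckeParam K) {d : ℕ} (l : List (Fin d)) (i : Fin d) :
    Hword P (l ++ [i]) = Hword P l * Hgen P i := by simp [Hword]

theorem Hword_cons (P : HeckeParam K) {d : ℕ} (l : List (Fin d)) (i : Fin d) :
    Hword P (i :: l) = Hgen P i * Hword P l := by simp [Hword]

theorem IsReducedExpr.of_concat {d : ℕ} {l : List (Fin d)} {i : Fin d} {w : WB d}
    (h : IsReducedExpr (l ++ [i]) w) : IsReducedExpr l (w * simpleRefl i) := by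
  obtain ⟨h1, h2⟩ := h
  have e : wordProd l = w * simpleRefl i := by
    rw [← h1, wordProd_concat, mul_assoc, simpleRefl_mul_self, mul_one]
  have h3 := len_wordProd_le l
  have h4 := len_mul_simpleRefl_le (w * simpleRefl i) i
  rw [mul_assoc, simpleRefl_mul_self, mul_one] at h4
  rw [List.length_append, List.length_singleton] at h2
  rw [e] at h3
  exact ⟨e, by omega⟩

theorem IsReducedExpr.not_posOn {d : ℕ} {l : List (Fin d)} {i : Fin d} {w : WB d}
    (h : IsReducedExpr (l ++ [i]) w) : ¬ PosOn w (simpleRefl i) := by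
  intro h'
  have h1 := h.of_concat.2
  have h2 := h.2
  have h3 := len_mul_simpleRefl_of_posOn h'
  rw [List.length_append, List.length_singleton] at h2
  omega

/-- If `w` has the distinct descents `s_i` and `s_j`, then `w = v * u` with additive lengths, where
`u` is the longest element of the subgroup generated by `s_i` and `s_j`. The reduced expressions
`a ++ [i]` and `b ++ [j]` of `u` are the two sides of a braid relation. -/
theorem exists_dihedral_factor (P : HeckeParam K) {d : ℕ} {w : WB d} {i j : Fin d} (hij : i < j)
    (hi : ¬ PosOn w (simpleRefl i)) (hj : ¬ PosOn w (simpleRefl j)) :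
    ∃ (v : WB d) (a b : List (Fin d)), Hword P (a ++ [i]) = Hword P (b ++ [j]) ∧
      v * wordProd (a ++ [i]) = w ∧ v * wordProd (b ++ [j]) = w ∧
      len v + (a ++ [i]).length = len w ∧ len v + (b ++ [j]).length = len w := by
  have hne : i ≠ j := hij.ne
  have hj0 : j.val ≠ 0 := by have := Fin.lt_def.1 hij; omega
  have ss' : ∀ (x : WB d) (k : Fin d), x * simpleRefl k * simpleRefl k = x := fun x k => by
    rw [mul_assoc, simpleRefl_mul_self, mul_one]
  have hlen := fun (x : WB d) (k : Fin d) (h : ¬ PosOn x (simpleRefl k)) =>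
    len_mul_simpleRefl_of_not_posOn h
  have hinj := wval_injective w
  rcases Nat.lt_or_ge (i.val + 1) j.val with h | h
  · -- commuting reflections
    have hpi : prevIdx j ≠ i := by intro e; have := congrArg Fin.val e; simp [prevIdx] at this; omega
    have h2 : ¬ PosOn (w * simpleRefl i) (simpleRefl j) := by
      rw [posOn_simpleRefl_pos _ j hj0] at hj ⊢
      by_cases hi0 : i.val = 0
      · rw [wval_mul_simpleRefl_zero w i hi0, wval_mul_simpleRefl_zero w i hi0, if_neg hpi,
          if_neg hne.symm]
        exact hj
      · have hq : prevIdx j ≠ prevIdx i := by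
          intro e; have := congrArg Fin.val e; simp [prevIdx] at this; omega
        have hq' : j ≠ prevIdx i := by
          intro e; have := congrArg Fin.val e; simp [prevIdx] at this; omega
        rw [wval_mul_simpleRefl_pos w i hi0, wval_mul_simpleRefl_pos w i hi0,
          Equiv.swap_apply_of_ne_of_ne hq hpi, Equiv.swap_apply_of_ne_of_ne hq' hne.symm]
        exact hj
    have hc := simpleRefl_comm h
    have l1 := hlen _ _ hi
    have l2 := hlen _ _ h2
    refine ⟨w * simpleRefl i * simpleRefl j, [j], [i], ?_, ?_, ?_, ?_, ?_⟩
    · simp [Hword, Hgen_comm P i j (Or.inl h)]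
    · simp [wordProd, ← mul_assoc, ss']
    · simp only [wordProd, List.cons_append, List.nil_append, List.map_cons, List.map_nil,
        List.prod_cons, List.prod_nil, mul_one, hc]
      simp [← mul_assoc, ss']
    · simp; omega
    · simp; omega
  · have hji : j.val = i.val + 1 := by have := Fin.lt_def.1 hij; omega
    have hpji : prevIdx j = i := by apply Fin.ext; simp [prevIdx]; omega
    have h0j : wval w i ≠ wval w j := hinj.ne hne
    rw [posOn_simpleRefl_pos _ j hj0, hpji] at hj
    by_cases hi0 : i.val = 0
    · -- the braid relation of length four
      have hi' := hi
      rw [posOn_simpleRefl_zero _ i hi0] at hi'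
      have hz : wval w i ≠ 0 := sval_ne_zero _
      have E0 (x : WB d) : wval (x * simpleRefl i) i = -wval x i ∧
          wval (x * simpleRefl i) j = wval x j :=
        ⟨by rw [wval_mul_simpleRefl_zero x i hi0, if_pos rfl],
          by rw [wval_mul_simpleRefl_zero x i hi0, if_neg hne.symm]⟩
      have E1 (x : WB d) : wval (x * simpleRefl j) i = wval x j ∧
          wval (x * simpleRefl j) j = wval x i := by
        constructor <;> rw [wval_mul_simpleRefl_pos x j hj0, hpji]
        · rw [Equiv.swap_apply_left]
        · rw [Equiv.swap_apply_right]
      have l1 := hlen _ _ hi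
      have l2 := hlen (w * simpleRefl i) j (by
        rw [posOn_simpleRefl_pos _ j hj0, hpji, (E0 _).1, (E0 _).2]; omega)
      have l3 := hlen (w * simpleRefl i * simpleRefl j) i (by
        rw [posOn_simpleRefl_zero _ i hi0, (E1 _).1, (E0 _).2]; omega)
      have l4 := hlen (w * simpleRefl i * simpleRefl j * simpleRefl i) j (by
        rw [posOn_simpleRefl_pos _ j hj0, hpji, (E0 _).1, (E0 _).2, (E1 _).1, (E1 _).2, (E0 _).1,
          (E0 _).2]; omega)
      have hb := simpleRefl_braid_zero hi0 (j := j) (by omega)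
      refine ⟨w * simpleRefl i * simpleRefl j * simpleRefl i * simpleRefl j, [j, i, j], [i, j, i],
        ?_, ?_, ?_, ?_, ?_⟩
      · have := Hgen_braid_zero P i j hi0 (by omega)
        simp only [Hword, List.cons_append, List.nil_append, List.map_cons, List.map_nil,
          List.prod_cons, List.prod_nil, mul_one, ← mul_assoc, this]
      · simp [wordProd, ← mul_assoc, ss']
      · have e : wordProd ([i, j, i] ++ [j]) = wordProd ([j, i, j] ++ [i]) := by
          simpa [wordProd, ← mul_assoc] using hb
        rw [e]
        simp [wordProd, ← mul_assoc, ss']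
      · simp; omega
      · simp; omega
    · -- the braid relation of length three
      have hi' := hi
      rw [posOn_simpleRefl_pos _ i hi0] at hi'
      obtain ⟨a, ha⟩ : ∃ a, a = prevIdx i := ⟨_, rfl⟩
      have hai : a ≠ i := by rw [ha]; exact prevIdx_ne i hi0
      have haj : a ≠ j := by
        intro e; have := congrArg Fin.val e; simp [ha, prevIdx] at this; omega
      have h1 : wval w a ≠ wval w i := hinj.ne hai
      rw [← ha] at hi'
      have E0 (x : WB d) : wval (x * simpleRefl i) a = wval x i ∧
          wval (x * simpleRefl i) i = wval x a ∧ wval (x * simpleRefl i) j = wval x j := by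
        refine ⟨?_, ?_, ?_⟩ <;> rw [wval_mul_simpleRefl_pos x i hi0, ← ha]
        · rw [Equiv.swap_apply_left]
        · rw [Equiv.swap_apply_right]
        · rw [Equiv.swap_apply_of_ne_of_ne haj.symm hne.symm]
      have E1 (x : WB d) : wval (x * simpleRefl j) a = wval x a ∧
          wval (x * simpleRefl j) i = wval x j ∧ wval (x * simpleRefl j) j = wval x i := by
        refine ⟨?_, ?_, ?_⟩ <;> rw [wval_mul_simpleRefl_pos x j hj0, hpji]
        · rw [Equiv.swap_apply_of_ne_of_ne hai haj]
        · rw [Equiv.swap_apply_left]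
        · rw [Equiv.swap_apply_right]
      have l1 := hlen _ _ hi
      have l2 := hlen (w * simpleRefl i) j (by
        rw [posOn_simpleRefl_pos _ j hj0, hpji, (E0 _).2.1, (E0 _).2.2]; omega)
      have l3 := hlen (w * simpleRefl i * simpleRefl j) i (by
        rw [posOn_simpleRefl_pos _ i hi0, ← ha, (E1 _).1, (E1 _).2.1, (E0 _).1, (E0 _).2.2]; omega)
      have hb := simpleRefl_braid hi0 hji
      refine ⟨w * simpleRefl i * simpleRefl j * simpleRefl i, [i, j], [j, i], ?_, ?_, ?_, ?_, ?_⟩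
      · have := Hgen_braid P i j (by omega) hji
        simp only [Hword, List.cons_append, List.nil_append, List.map_cons, List.map_nil,
          List.prod_cons, List.prod_nil, mul_one, ← mul_assoc, this]
      · simp [wordProd, ← mul_assoc, ss']
      · have e : wordProd ([j, i] ++ [j]) = wordProd ([i, j] ++ [i]) := by
          simpa [wordProd, ← mul_assoc] using hb.symm
        rw [e]
        simp [wordProd, ← mul_assoc, ss']
      · simp; omega
      · simp; omega

/-- Matsumoto's theorem in the Hecke algebra: `H_{i_1} ⋯ H_{i_n}` depends only on the element that
the reduced word represents. -/
theorem Hword_eq_of_isReducedExpr (P : HeckeParam K) {d : ℕ} : ∀ (n : ℕ) {w : WB d}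
    {l l' : List (Fin d)}, l.length = n → IsReducedExpr l w → IsReducedExpr l' w →
    Hword P l = Hword P l' := by
  intro n
  induction n with
  | zero =>
    intro w l l' hn hl hl'
    have h := hl'.2
    rw [← hl.2, hn] at h
    rw [List.length_eq_zero_iff.1 hn, List.length_eq_zero_iff.1 h]
  | succ n ih =>
    -- words with the same last letter
    have same : ∀ {w : WB d} {a b : List (Fin d)} {i : Fin d}, (a ++ [i]).length = n + 1 →
        IsReducedExpr (a ++ [i]) w → IsReducedExpr (b ++ [i]) w →
        Hword P (a ++ [i]) = Hword P (b ++ [i]) := by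
      intro w a b i hn ha hb
      rw [Hword_concat, Hword_concat, ih (by simpa using hn) ha.of_concat hb.of_concat]
    have lt_case : ∀ {w : WB d} {a b : List (Fin d)} {i j : Fin d}, i < j →
        (a ++ [i]).length = n + 1 → IsReducedExpr (a ++ [i]) w → IsReducedExpr (b ++ [j]) w →
        Hword P (a ++ [i]) = Hword P (b ++ [j]) := by
      intro w a b i j hij hn ha hb
      obtain ⟨v, x, y, h1, h2, h3, h4, h5⟩ := exists_dihedral_factor P hij ha.not_posOn hb.not_posOn
      obtain ⟨c, hc1, hc2⟩ := exists_isReducedExpr v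
      have hx : IsReducedExpr ((c ++ x) ++ [i]) w := by
        rw [List.append_assoc]
        exact ⟨by rw [wordProd_append, hc1, h2], by rw [List.length_append, hc2, h4]⟩
      have hy : IsReducedExpr ((c ++ y) ++ [j]) w := by
        rw [List.append_assoc]
        exact ⟨by rw [wordProd_append, hc1, h3], by rw [List.length_append, hc2, h5]⟩
      rw [same hn ha hx, List.append_assoc, Hword_append, h1, ← Hword_append, ← List.append_assoc]
      exact same (by rw [hy.2, ← ha.2, hn]) hy hb
    intro w l l' hn hl hl'
    have hn' : l'.length = n + 1 := by rw [hl'.2, ← hl.2, hn]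
    rcases List.eq_nil_or_concat l with rfl | ⟨a, i, rfl⟩
    · simp at hn
    rcases List.eq_nil_or_concat l' with rfl | ⟨b, j, rfl⟩
    · simp at hn'
    rw [List.concat_eq_append] at hl hn hl' hn'
    rw [List.concat_eq_append, List.concat_eq_append]
    rcases lt_trichotomy i j with h | rfl | h
    · exact lt_case h hn hl hl'
    · exact same hn hl hl'
    · exact (lt_case h hn' hl' hl).symm

/-- The element `H_w` of the Hecke algebra, formed with a chosen reduced expression of `w`. -/
noncomputable def Helt (P : HeckeParam K) {d : ℕ} (w : WB d) : Hecke P d :=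
  Hword P (exists_isReducedExpr w).choose

theorem Hword_eq_Helt (P : HeckeParam K) {d : ℕ} {w : WB d} {l : List (Fin d)}
    (h : IsReducedExpr l w) : Hword P l = Helt P w :=
  Hword_eq_of_isReducedExpr P _ rfl h (exists_isReducedExpr w).choose_spec

theorem Helt_one (P : HeckeParam K) {d : ℕ} : Helt P (1 : WB d) = 1 := by
  rw [← Hword_eq_Helt P (l := []) ⟨wordProd_nil, by rw [len_one]; rfl⟩]
  rfl

theorem Helt_mul_Hgen (P : HeckeParam K) {d : ℕ} {w : WB d} {i : Fin d}
    (h : len w < len (w * simpleRefl i)) : Helt P (w * simpleRefl i) = Helt P w * Hgen P i := by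
  obtain ⟨l, h1, h2⟩ := exists_isReducedExpr w
  have h3 := len_mul_simpleRefl_le w i
  rw [← Hword_eq_Helt P (l := l ++ [i]) ⟨by rw [wordProd_concat, h1], by simp; omega⟩,
    Hword_concat, Hword_eq_Helt P ⟨h1, h2⟩]

theorem Hgen_mul_Helt (P : HeckeParam K) {d : ℕ} {w : WB d} {i : Fin d}
    (h : len w < len (simpleRefl i * w)) : Helt P (simpleRefl i * w) = Hgen P i * Helt P w := by
  obtain ⟨l, h1, h2⟩ := exists_isReducedExpr w
  have h3 : len (simpleRefl i * w) ≤ (i :: l).length := by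
    rw [← h1, ← wordProd_cons]; exact len_wordProd_le _
  rw [← Hword_eq_Helt P (l := i :: l) ⟨by rw [wordProd_cons, h1], by
    rw [List.length_cons] at h3 ⊢; omega⟩, Hword_cons, Hword_eq_Helt P ⟨h1, h2⟩]

end Matsumoto

/-! ### Minimal length representatives -/

theorem mem_stab_iff {r m d : ℕ} {f : Weight r m d} {σ : WB d} : σ ∈ stab f ↔ wact f σ = f :=
  Iff.rfl

theorem mem_minReps_iff_forall_wact {r m d : ℕ} {f : Weight r m d} {σ : WB d} :
    σ ∈ minReps f ↔ ∀ τ, wact f τ = wact f σ → len σ ≤ len τ := by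
  constructor
  · intro h τ hτ
    have h1 : τ * σ⁻¹ ∈ stab f := by
      rw [mem_stab_iff, wact_mul, hτ, ← wact_mul, mul_inv_cancel, wact_one]
    have h2 := h _ h1
    rwa [inv_mul_cancel_right] at h2
  · intro h w hw
    apply h
    rw [wact_mul, mem_stab_iff.1 hw]

theorem wact_eq_of_extWeight {r m d : ℕ} {f : Weight r m d} {t : WB d}
    (h : ∀ z, extWeight f (t.1 z) = extWeight f z) : wact f t = f := by
  funext k
  have := h (k, 1)
  rw [wact, this]
  simp [extWeight]

/-- Two points at which a weight agrees are exchanged by a reflection that stabilizes the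
weight. -/
theorem exists_swapsOnePair {r m d : ℕ} (g : Weight r m d) {x y : SgnIdx d} (hne : x ≠ y)
    (hg : extWeight g x = extWeight g y) :
    ∃ t : WB d, SwapsOnePair t ∧ t.1 x = y ∧ wact g t = g := by
  have hN := negIdx_negIdx (d := d)
  have hNe : ∀ z w : SgnIdx d, negIdx d z = w ↔ z = negIdx d w := fun z w =>
    ⟨fun h => by rw [← h, hN], fun h => by rw [h, hN]⟩
  have hN0 : ∀ z : SgnIdx d, z ≠ negIdx d z := by
    intro z h
    have h1 := congrArg sval h
    have h2 := sval_ne_zero z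
    rw [sval_negIdx] at h1
    omega
  let T : SgnIdx d → SgnIdx d := fun z => if z = x then y else if z = y then x
    else if z = negIdx d x then negIdx d y else if z = negIdx d y then negIdx d x else z
  have T1 : T x = y := by simp [T]
  have T2 : T y = x := by simp [T, hne.symm]
  have T3 : T (negIdx d x) = negIdx d y := by
    by_cases h : negIdx d x = y
    · rw [h, T2, ← h, hN]
    · simp [T, (hN0 x).symm, h]
  have T4 : T (negIdx d y) = negIdx d x := by
    by_cases h : negIdx d y = x
    · rw [h, T1, ← h, hN]
    · have h' : negIdx d y ≠ negIdx d x := fun e => hne ((negIdx d).injective e).symm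
      simp [T, (hN0 y).symm, h, h']
  have T5 : ∀ z, z ≠ x → z ≠ y → z ≠ negIdx d x → z ≠ negIdx d y → T z = z := by
    intro z h1 h2 h3 h4
    simp [T, h1, h2, h3, h4]
  have Tmoved : ∀ z, T z ≠ z → z = x ∨ z = y ∨ z = negIdx d x ∨ z = negIdx d y := by
    intro z hz
    by_contra! h
    exact hz (T5 z h.1 h.2.1 h.2.2.1 h.2.2.2)
  have Tinv : Function.Involutive T := by
    intro z
    by_cases hz : T z = z
    · rw [hz, hz]
    · rcases Tmoved z hz with rfl | rfl | rfl | rfl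
      · rw [T1, T2]
      · rw [T2, T1]
      · rw [T3, T4]
      · rw [T4, T3]
  have Tneg : ∀ z, T (negIdx d z) = negIdx d (T z) := by
    intro z
    by_cases hz : z = x ∨ z = y ∨ z = negIdx d x ∨ z = negIdx d y
    · rcases hz with rfl | rfl | rfl | rfl
      · rw [T3, T1]
      · rw [T4, T2]
      · rw [hN, T3, T1, hN]
      · rw [hN, T4, T2, hN]
    · push Not at hz
      rw [T5 z hz.1 hz.2.1 hz.2.2.1 hz.2.2.2, T5]
      · rw [Ne, hNe]; exact hz.2.2.1
      · rw [Ne, hNe]; exact hz.2.2.2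
      · exact fun e => hz.1 ((negIdx d).injective e)
      · exact fun e => hz.2.1 ((negIdx d).injective e)
  have hmem : Tinv.toPerm T ∈ Subgroup.centralizer {negIdx d} := by
    rw [Subgroup.mem_centralizer_singleton_iff]
    ext1 z
    exact Tneg z
  refine ⟨⟨Tinv.toPerm T, hmem⟩, ⟨?_, ?_, ?_⟩, T1, ?_⟩
  · apply eq_of_apply_one
    intro k
    exact Tinv (k, 1)
  · intro h
    have : T x = x := congrArg (fun w : WB d => w.1 x) h
    rw [T1] at this
    exact hne this.symm
  · intro z w hz hw
    change w = z ∨ w = T z ∨ w = negIdx d z ∨ w = negIdx d (T z)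
    rcases Tmoved z hz with rfl | rfl | rfl | rfl <;>
      rcases Tmoved w hw with rfl | rfl | rfl | rfl <;> simp only [T1, T2, T3, T4, hN] <;> simp
  · apply wact_eq_of_extWeight
    intro z
    change extWeight g (T z) = extWeight g z
    by_cases hz : T z = z
    · rw [hz]
    · rcases Tmoved z hz with rfl | rfl | rfl | rfl
      · rw [T1, hg]
      · rw [T2, hg]
      · rw [T3, extWeight_neg, extWeight_neg, hg]
      · rw [T4, extWeight_neg, extWeight_neg, hg]

/-- `σ` preserves the order of every pair of points at which `f · σ` takes the same value. -/
def MonoOnFibers {r m d : ℕ} (f : Weight r m d) (σ : WB d) : Prop :=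
  ∀ x y, sval x < sval y → extWeight f (σ.1 x) = extWeight f (σ.1 y) →
    sval (σ.1 x) < sval (σ.1 y)

theorem monoOnFibers_of_mem_minReps {r m d : ℕ} {f : Weight r m d} {σ : WB d}
    (h : σ ∈ minReps f) : MonoOnFibers f σ := by
  intro x y hxy hF
  by_contra hle
  have hne : x ≠ y := fun e => by rw [e] at hxy; exact lt_irrefl _ hxy
  obtain ⟨t, ht, htx, hts⟩ := exists_swapsOnePair (wact f σ) hne
    (by rw [extWeight_wact, extWeight_wact, hF])
  have h1 : ¬ PosOn σ t := by
    intro hp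
    have := hp x (by rwa [htx])
    rw [htx] at this
    exact hle this
  have h2 := len_mul_lt_of_not_posOn ht h1
  have h3 := mem_minReps_iff_forall_wact.1 h (σ * t) (by rw [wact_mul, hts])
  omega

/-- For anti-dominant `f` the extended weight is antitone apart from the negative points at which
it is black. -/
theorem extWeight_le {r m d : ℕ} {f : Weight r m d} (hf : AntiDominant f) {x y : SgnIdx d}
    (hx : 0 < sval x ∨ ¬ IsBlack (extWeight f x)) (hy : 0 < sval y ∨ ¬ IsBlack (extWeight f y))
    (hxy : sval x ≤ sval y) : (extWeight f y).val ≤ (extWeight f x).val := by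
  obtain ⟨i, ε⟩ := x
  obtain ⟨j, δ⟩ := y
  have hi := hf.2 i
  have hj := hf.2 j
  have pos : ∀ k : Fin d, extWeight f (k, 1) = f k := fun k => by simp [extWeight]
  have neg : ∀ k : Fin d, extWeight f (k, -1) = signFlip (f k) := fun k => by simp [extWeight]
  rcases Int.units_eq_one_or ε with rfl | rfl <;> rcases Int.units_eq_one_or δ with rfl | rfl <;>
    simp only [sval_one, sval_neg_one, pos, neg, isBlack_signFlip] at *
  · exact Fin.le_def.1 (hf.1 (Fin.le_def.2 (by omega)))
  · omega
  · have hx' := hx.resolve_left (by omega)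
    have h1 := color_cases (f i)
    unfold IsBlack at hx'
    unfold IsBlack IsPlus at h1
    omega
  · have h : f i ≤ f j := hf.1 (Fin.le_def.2 (by omega))
    rw [Fin.le_def] at h
    have h1 := color_cases (f i)
    have h2 := color_cases (f j)
    have hx' := hx.resolve_left (by omega)
    have hy' := hy.resolve_left (by omega)
    unfold IsBlack at hx' hy'
    unfold IsBlack IsPlus at h1 h2
    omega

theorem extWeight_lt_of_pos {r m d : ℕ} {f : Weight r m d} (hf : AntiDominant f) {x : SgnIdx d}
    (hx : 0 < sval x) : (extWeight f x).val < r + m := by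
  obtain ⟨i, ε⟩ := x
  rcases Int.units_eq_one_or ε with rfl | rfl
  · simpa [extWeight] using hf.2 i
  · rw [sval_neg_one] at hx; omega

theorem le_extWeight_of_neg {r m d : ℕ} {f : Weight r m d} (hf : AntiDominant f) {x : SgnIdx d}
    (hx : sval x < 0) : r ≤ (extWeight f x).val := by
  obtain ⟨i, ε⟩ := x
  rcases Int.units_eq_one_or ε with rfl | rfl
  · rw [sval_one] at hx; omega
  · have h1 := hf.2 i
    have h2 := color_cases (f i)
    have : extWeight f (i, -1) = signFlip (f i) := by simp [extWeight]
    rw [this]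
    unfold IsPlus at h2
    omega

theorem signFlip_of_isBlack {r m : ℕ} {a : Idx r m} (h : IsBlack a) : signFlip a = a := by
  rw [signFlip, if_pos h]

theorem signFlip_ne_of_not_isBlack {r m : ℕ} {a : Idx r m} (h : ¬ IsBlack a) :
    signFlip a ≠ a := by
  intro e
  have h1 := congrArg Fin.val e
  have h2 := color_cases a
  unfold IsBlack at h
  omega

/-- At black places `σ` does not change signs, since `f · σ` takes the same value at `x` and
`-x`. -/
theorem MonoOnFibers.pos_iff {r m d : ℕ} {f : Weight r m d} {σ : WB d} (hσ : MonoOnFibers f σ)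
    {x : SgnIdx d} (hx : IsBlack (extWeight f (σ.1 x))) : 0 < sval (σ.1 x) ↔ 0 < sval x := by
  have key : ∀ {x : SgnIdx d}, IsBlack (extWeight f (σ.1 x)) → 0 < sval x →
      0 < sval (σ.1 x) := by
    intro x hx h
    have := hσ (negIdx d x) x (by rw [sval_negIdx]; omega)
      (by rw [apply_neg, extWeight_neg, signFlip_of_isBlack hx])
    rw [sval_apply_negIdx] at this
    omega
  refine ⟨fun h => ?_, key hx⟩
  by_contra h'
  have h0 := sval_ne_zero x
  have := key (x := negIdx d x) (by rwa [apply_neg, extWeight_neg, isBlack_signFlip])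
    (by rw [sval_negIdx]; omega)
  rw [sval_apply_negIdx] at this
  omega

/-- Elements that are monotone on fibers are unique in their cosets: the quotient `τ * σ⁻¹` of two of
them has no descents, because `f` is antitone on the positive points. -/
theorem MonoOnFibers.eq_of_wact_eq {r m d : ℕ} {f : Weight r m d} (hf : AntiDominant f)
    {σ τ : WB d} (hσ : MonoOnFibers f σ) (hτ : MonoOnFibers f τ) (h : wact f σ = wact f τ) :
    σ = τ := by
  have hF : ∀ x, extWeight f (τ.1 x) = extWeight f (σ.1 x) := fun x => by
    rw [← extWeight_wact, ← extWeight_wact, h]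
  have hpos : ∀ a, 0 < sval (σ.1 a) → 0 < sval (τ.1 a) := by
    intro a ha
    by_cases hb : IsBlack (extWeight f (σ.1 a))
    · exact (hτ.pos_iff (by rwa [hF])).2 ((hσ.pos_iff hb).1 ha)
    · by_contra h'
      have h1 := le_extWeight_of_neg hf (lt_of_le_of_ne (not_lt.1 h') (sval_ne_zero _))
      have h2 := extWeight_lt_of_pos hf ha
      rw [hF] at h1
      exact hb ⟨h1, h2⟩
  have hu : τ * σ⁻¹ = 1 := by
    apply eq_one_of_posOn
    intro i
    have hσσ : ∀ z, σ.1 (σ⁻¹.1 z) = z := fun z => σ.1.apply_symm_apply z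
    have hw : ∀ k, 0 < wval (τ * σ⁻¹) k := by
      intro k
      apply hpos
      rw [hσσ, sval_one]
      omega
    by_cases hi : i.val = 0
    · rw [posOn_simpleRefl_zero _ i hi]
      exact hw i
    · rw [posOn_simpleRefl_pos _ i hi]
      have h1 := hw i
      have h2 := hw (prevIdx i)
      change sval (τ.1 (σ⁻¹.1 (prevIdx i, 1))) < sval (τ.1 (σ⁻¹.1 (i, 1)))
      change 0 < sval (τ.1 (σ⁻¹.1 (i, 1))) at h1
      change 0 < sval (τ.1 (σ⁻¹.1 (prevIdx i, 1))) at h2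
      have ha := hσσ (prevIdx i, 1)
      have hb := hσσ (i, 1)
      generalize σ⁻¹.1 (prevIdx i, 1) = a at *
      generalize σ⁻¹.1 (i, 1) = b at *
      have hab : sval (σ.1 a) < sval (σ.1 b) := by
        rw [ha, hb, sval_one, sval_one]; simp only [prevIdx]; omega
      by_cases he : extWeight f (σ.1 a) = extWeight f (σ.1 b)
      · apply hτ _ _ _ (by rw [hF, hF, he])
        by_contra hle
        have hne : sval b ≠ sval a := by
          intro e; rw [sval_injective e] at hab; exact lt_irrefl _ hab
        have := hσ b a (by omega) he.symm
        omega
      · by_contra hle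
        have h3 := extWeight_le hf (Or.inl h1) (Or.inl h2) (not_lt.1 hle)
        have h4 := extWeight_le hf (x := σ.1 a) (y := σ.1 b)
          (Or.inl (by rw [ha, sval_one]; omega)) (Or.inl (by rw [hb, sval_one]; omega)) hab.le
        rw [hF, hF] at h3
        exact he (Fin.ext (le_antisymm h3 h4))
  exact (mul_inv_eq_one.1 hu).symm

theorem exists_mem_minReps {r m d : ℕ} (f : Weight r m d) (σ : WB d) :
    ∃ τ ∈ minReps f, wact f τ = wact f σ := by
  obtain ⟨τ, h1, h2⟩ := Set.exists_min_image {τ | wact f τ = wact f σ} len (Set.toFinite _)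
    ⟨σ, rfl⟩
  exact ⟨τ, mem_minReps_iff_forall_wact.2 fun u hu => h2 u (hu.trans h1), h1⟩

/-- The minimal length representatives are the elements that are monotone on fibers. -/
theorem mem_minReps_iff {r m d : ℕ} {f : Weight r m d} (hf : AntiDominant f) {σ : WB d} :
    σ ∈ minReps f ↔ MonoOnFibers f σ := by
  refine ⟨monoOnFibers_of_mem_minReps, fun h => ?_⟩
  obtain ⟨τ, h1, h2⟩ := exists_mem_minReps f σ
  rwa [← (monoOnFibers_of_mem_minReps h1).eq_of_wact_eq hf h h2]

theorem eq_of_mem_minReps {r m d : ℕ} {f : Weight r m d} (hf : AntiDominant f) {σ τ : WB d}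
    (hσ : σ ∈ minReps f) (hτ : τ ∈ minReps f) (h : wact f σ = wact f τ) : σ = τ :=
  (monoOnFibers_of_mem_minReps hσ).eq_of_wact_eq hf (monoOnFibers_of_mem_minReps hτ) h

theorem one_mem_minReps {r m d : ℕ} (f : Weight r m d) : (1 : WB d) ∈ minReps f := by
  intro w _
  rw [len_one]
  exact Nat.zero_le _

/-- Right multiplication by `s_i` leaves the set of minimal length representatives only if it does
not change the coset. -/
theorem mul_simpleRefl_mem_minReps {r m d : ℕ} {f : Weight r m d} (hf : AntiDominant f)
    {σ : WB d} (hσ : σ ∈ minReps f) {i : Fin d}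
    (hne : wact f (σ * simpleRefl i) ≠ wact f σ) : σ * simpleRefl i ∈ minReps f := by
  rw [mem_minReps_iff hf]
  intro x y hxy hF
  change extWeight f (σ.1 ((simpleRefl i).1 x)) = extWeight f (σ.1 ((simpleRefl i).1 y)) at hF
  by_cases hy : y = (simpleRefl i).1 x
  · exfalso
    apply hne
    rw [wact_mul]
    apply wact_eq_of_extWeight
    subst hy
    have h1 : extWeight (wact f σ) ((simpleRefl i).1 x) = extWeight (wact f σ) x := by
      rw [extWeight_wact, extWeight_wact, hF, simpleRefl_apply_apply]
    intro z
    by_cases hz : (simpleRefl i).1 z = z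
    · rw [hz]
    · have hx : (simpleRefl i).1 x ≠ x := fun e => by rw [e] at hxy; exact lt_irrefl _ hxy
      rcases (swapsOnePair_simpleRefl i).moved x z hx hz with rfl | rfl | rfl | rfl
      · exact h1
      · rw [simpleRefl_apply_apply, h1]
      · rw [apply_neg, extWeight_neg, extWeight_neg, h1]
      · rw [apply_neg, simpleRefl_apply_apply, extWeight_neg, extWeight_neg, h1]
  · exact monoOnFibers_of_mem_minReps hσ _ _ (sval_simpleRefl_lt i hxy hy) hF

theorem posOn_of_wact_eq {r m d : ℕ} {f : Weight r m d} {σ : WB d} (hσ : σ ∈ minReps f)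
    {i : Fin d} (h : wact f (σ * simpleRefl i) = wact f σ) : PosOn σ (simpleRefl i) := by
  by_contra h'
  have h1 := len_mul_simpleRefl_of_not_posOn h'
  have h2 := mem_minReps_iff_forall_wact.1 hσ _ h
  omega

theorem wact_eq_extWeight {r m d : ℕ} (f : Weight r m d) (σ : WB d) (k : Fin d) :
    wact f σ k = extWeight f (σ.1 (k, 1)) := rfl

/-- Removing a descent from a minimal length representative gives one of a different coset. -/
theorem descent_of_mem_minReps {r m d : ℕ} {f : Weight r m d} (hf : AntiDominant f) {τ : WB d}
    {i : Fin d} (hσ : τ * simpleRefl i ∈ minReps f)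
    (hnp : ¬ PosOn (τ * simpleRefl i) (simpleRefl i)) :
    PosOn τ (simpleRefl i) ∧ len (τ * simpleRefl i) = len τ + 1 ∧ τ ∈ minReps f ∧
      wact f (τ * simpleRefl i) ≠ wact f τ := by
  have hp : PosOn τ (simpleRefl i) := by
    by_contra h; exact hnp ((posOn_mul_self (swapsOnePair_simpleRefl i)).2 h)
  have hlen := len_mul_simpleRefl_of_posOn hp
  have hne : wact f (τ * simpleRefl i) ≠ wact f τ := by
    intro e
    have := mem_minReps_iff_forall_wact.1 hσ τ e.symm
    omega
  refine ⟨hp, hlen, ?_, hne⟩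
  have h1 : τ * simpleRefl i * simpleRefl i = τ := by
    rw [mul_assoc, simpleRefl_mul_self, mul_one]
  have h2 := mul_simpleRefl_mem_minReps hf hσ (i := i)
  rw [h1] at h2
  exact h2 hne.symm

/-! ### The action on the standard vectors -/

section Action

variable {K : Type} [Field K] (P : HeckeParam K)

theorem stdVec_smul_of_wact_eq {r m d : ℕ} {g : Weight r m d} {i : Fin d}
    (h : wact g (simpleRefl i) = g) : stdVec P g <• Hgen P i = P.par i • stdVec P g := by
  rw [stdVec_smul_Hgen, genActVec, HeckeParam.par]
  split_ifs with h1 h2 h3 h4 h5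
  · rfl
  · rw [wact_simple_zero g i h1, Function.update_eq_self_iff] at h
    exact absurd h (signFlip_ne_of_not_isBlack h2)
  · rw [wact_simple_zero g i h1, Function.update_eq_self_iff] at h
    exact absurd h (signFlip_ne_of_not_isBlack h2)
  · have := congrFun h i
    rw [wact_simple_pos g i h1, Function.update_self] at this
    rw [this] at h4; exact absurd h4 (lt_irrefl _)
  · have := congrFun h i
    rw [wact_simple_pos g i h1, Function.update_self] at this
    rw [this] at h5; exact absurd h5 (lt_irrefl _)
  · rfl

theorem stdVec_smul_of_posOn {r m d : ℕ} {f : Weight r m d} (hf : AntiDominant f) {σ : WB d}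
    (hσ : σ ∈ minReps f) {i : Fin d} (hp : PosOn σ (simpleRefl i))
    (hne : wact f (σ * simpleRefl i) ≠ wact f σ) :
    stdVec P (wact f σ) <• Hgen P i = stdVec P (wact f (σ * simpleRefl i)) := by
  rw [wact_mul] at hne ⊢
  have hm := monoOnFibers_of_mem_minReps hσ
  rw [stdVec_smul_Hgen, genActVec]
  by_cases hi : i.val = 0
  · rw [posOn_simpleRefl_zero _ i hi] at hp
    have h1 : ¬ IsBlack (wact f σ i) := by
      intro hb
      apply hne
      rw [wact_simple_zero _ i hi, signFlip_of_isBlack hb, Function.update_eq_self]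
    have h2 : ¬ IsPlus (wact f σ i) := by
      have := extWeight_lt_of_pos hf hp
      rw [wact_eq_extWeight, IsPlus]
      omega
    rw [if_pos hi, if_neg h1, if_neg h2]
  · rw [posOn_simpleRefl_pos _ i hi] at hp
    have hpos : ∀ k : Fin d, 0 < sval (σ.1 (k, 1)) ∨ ¬ IsBlack (extWeight f (σ.1 (k, 1))) := by
      intro k
      by_cases hb : IsBlack (extWeight f (σ.1 (k, 1)))
      · exact Or.inl ((hm.pos_iff hb).2 (by rw [sval_one]; omega))
      · exact Or.inr hb
    have h1 := extWeight_le hf (hpos (prevIdx i)) (hpos i) hp.le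
    rw [← wact_eq_extWeight, ← wact_eq_extWeight] at h1
    have h2 : wact f σ i ≠ wact f σ (prevIdx i) := by
      intro e
      apply hne
      rw [wact_simple_pos _ i hi, e]
      funext k
      by_cases hk : k = i
      · subst hk; simp [e]
      · by_cases hk' : k = prevIdx i
        · subst hk'; simp [hk]
        · simp [hk, hk']
    have h3 : wact f σ i < wact f σ (prevIdx i) := lt_of_le_of_ne (Fin.le_def.2 h1) h2
    rw [if_neg hi, if_neg h3.not_gt, if_pos h3]

/-- `M_f · H_w = M_{f · w}` for a minimal length representative `w`. -/
theorem stdVec_smul_Helt {r m d : ℕ} {f : Weight r m d} (hf : AntiDominant f) : ∀ (n : ℕ)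
    {σ : WB d}, len σ = n → σ ∈ minReps f →
    stdVec P f <• Helt P σ = stdVec P (wact f σ) := by
  intro n
  induction n with
  | zero =>
    intro σ hn _
    rw [eq_one_of_len_eq_zero hn, Helt_one, wact_one]
    exact one_smul _ _
  | succ n ih =>
    intro σ hn hσ
    obtain ⟨l, hl⟩ := exists_isReducedExpr σ
    rcases List.eq_nil_or_concat l with rfl | ⟨l, i, rfl⟩
    · have := hl.2; simp [hn] at this
    rw [List.concat_eq_append] at hl
    have hnp := hl.not_posOn
    obtain ⟨τ, rfl⟩ : ∃ τ, σ = τ * simpleRefl i :=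
      ⟨σ * simpleRefl i, by rw [mul_assoc, simpleRefl_mul_self, mul_one]⟩
    obtain ⟨hp, hlen, hτ, hne⟩ := descent_of_mem_minReps hf hσ hnp
    rw [Helt_mul_Hgen P (by omega), MulOpposite.op_mul, mul_smul, ih (by omega) hτ,
      stdVec_smul_of_posOn P hf hτ hp hne]

end Action

section BarInvolution

variable {K : Type} [Field K] (P : HeckeParam K)

/-! ### Bookkeeping for the right action -/

theorem smul_mul_right {r m d : ℕ} (x : TensorSpace P r m d) (a b : Hecke P d) :
    x <• (a * b) = (x <• a) <• b := by rw [MulOpposite.op_mul, mul_smul]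

theorem smul_algebraMap_right {r m d : ℕ} (x : TensorSpace P r m d) (c : K) :
    x <• algebraMap K (Hecke P d) c = c • x := by
  change algebraMap K (Hecke P d)ᵐᵒᵖ c • x = _
  rw [algebraMap_smul]

theorem smul_smul_right {r m d : ℕ} (c : K) (x : TensorSpace P r m d) (a : Hecke P d) :
    (c • x) <• a = c • (x <• a) := smul_comm _ _ _

theorem smul_Hinv {r m d : ℕ} (x : TensorSpace P r m d) (i : Fin d) :
    x <• Hinv P i = x <• Hgen P i - (P.par i - (P.par i)⁻¹) • x := by
  rw [Hinv, MulOpposite.op_sub, sub_smul, smul_algebraMap_right]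

theorem smul_Hinv_of_smul_Hgen {r m d : ℕ} {x : TensorSpace P r m d} {i : Fin d}
    (h : x <• Hgen P i = P.par i • x) : x <• Hinv P i = (P.par i)⁻¹ • x := by
  rw [smul_Hinv, h, ← sub_smul, sub_sub_cancel]

theorem smul_Hgen_Hgen {r m d : ℕ} (x : TensorSpace P r m d) (i : Fin d) :
    (x <• Hgen P i) <• Hgen P i = (P.par i - (P.par i)⁻¹) • (x <• Hgen P i) + x := by
  rw [← smul_mul_right, Hgen_quad', MulOpposite.op_add, add_smul, smul_mul_right,
    smul_algebraMap_right, smul_smul_right, MulOpposite.op_one, one_smul]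

theorem Hecke_induction {d : ℕ} {C : Hecke P d → Prop}
    (alg : ∀ c, C (algebraMap K _ c)) (gen : ∀ i, C (Hgen P i))
    (add : ∀ a b, C a → C b → C (a + b)) (mul : ∀ a b, C a → C b → C (a * b))
    (h : Hecke P d) : C h := by
  obtain ⟨y, rfl⟩ := RingQuot.mkAlgHom_surjective K (HeckeRel P d) h
  induction y using FreeAlgebra.induction with
  | grade0 c => rw [AlgHom.commutes]; exact alg c
  | grade1 i => exact gen i
  | mul a b ha hb => rw [map_mul]; exact mul _ _ ha hb
  | add a b ha hb => rw [map_add]; exact add _ _ ha hb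

theorem heckeBar_Helt_mul {d : ℕ} {w : WB d} {i : Fin d} (h : PosOn w (simpleRefl i)) :
    heckeBar P d (Helt P (w * simpleRefl i)) = heckeBar P d (Helt P w) * Hinv P i := by
  rw [Helt_mul_Hgen P ((len_lt_len_mul_iff (swapsOnePair_simpleRefl i)).2 h), map_mul,
    heckeBar_Hgen]

theorem heckeBar_mul_Helt {d : ℕ} {w : WB d} {i : Fin d} (h : len w < len (simpleRefl i * w)) :
    heckeBar P d (Helt P (simpleRefl i * w)) = Hinv P i * heckeBar P d (Helt P w) := by
  rw [Hgen_mul_Helt P h, map_mul, heckeBar_Hgen]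

/-! ### The relations at fixed places -/

/-- The span of the `M_h` for which the first entries `h(b)`, `b ≤ a`, are black. -/
noncomputable def blackSpan (r m : ℕ) {d : ℕ} (a : Fin d) : Submodule K (TensorSpace P r m d) :=
  Submodule.span K {x | ∃ h : Weight r m d, (∀ b ≤ a, IsBlack (h b)) ∧ x = stdVec P h}

theorem blackSpan_mono (r m : ℕ) {d : ℕ} {a b : Fin d} (h : a ≤ b) :
    blackSpan P r m b ≤ blackSpan P r m a := by
  apply Submodule.span_mono
  rintro x ⟨g, hg, rfl⟩
  exact ⟨g, fun c hc => hg c (hc.trans h), rfl⟩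

theorem blackSpan_smul_zero {r m d : ℕ} {a z : Fin d} (hz : z.val = 0) {x : TensorSpace P r m d}
    (hx : x ∈ blackSpan P r m a) : x <• Hinv P z = (P.par z)⁻¹ • x := by
  apply smul_Hinv_of_smul_Hgen
  induction hx using Submodule.span_induction with
  | mem x hx =>
    obtain ⟨h, hh, rfl⟩ := hx
    apply stdVec_smul_of_wact_eq
    rw [wact_simple_zero _ _ hz,
      signFlip_of_isBlack (hh z (Fin.le_def.2 (by omega))), Function.update_eq_self]
  | zero => rw [smul_zero, smul_zero]
  | add x y _ _ hx hy => rw [smul_add, smul_add, hx, hy]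
  | smul c x _ hx => rw [smul_smul_right, hx, smul_comm]

theorem smul_Hinv_mem_blackSpan {r m d : ℕ} {a i : Fin d} (hi : i.val ≠ 0) (hia : i ≤ a)
    {x : TensorSpace P r m d} (hx : x ∈ blackSpan P r m a) : x <• Hinv P i ∈ blackSpan P r m a := by
  rw [smul_Hinv]
  refine Submodule.sub_mem _ ?_ (Submodule.smul_mem _ _ hx)
  induction hx using Submodule.span_induction with
  | mem x hx =>
    obtain ⟨h, hh, rfl⟩ := hx
    have h1 : stdVec P h ∈ blackSpan P r m a := Submodule.subset_span ⟨h, hh, rfl⟩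
    have h2 : stdVec P (wact h (simpleRefl i)) ∈ blackSpan P r m a := by
      refine Submodule.subset_span ⟨_, ?_, rfl⟩
      intro b hb
      have hp : prevIdx i ≤ a := by
        rw [Fin.le_def] at *; simp only [prevIdx]; omega
      rw [wact_simple_pos _ _ hi]
      by_cases h1 : b = i
      · subst h1; simpa using hh _ hp
      · by_cases h2 : b = prevIdx i
        · subst h2; simpa [h1] using hh _ hia
        · simpa [h1, h2] using hh _ hb
    rw [stdVec_smul_Hgen, genActVec, if_neg hi]
    split_ifs
    · exact Submodule.add_mem _ h2 (Submodule.smul_mem _ _ h1)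
    · exact h2
    · exact Submodule.smul_mem _ _ h1
  | zero => rw [smul_zero]; exact Submodule.zero_mem _
  | add x y _ _ hx hy => rw [smul_add]; exact Submodule.add_mem _ hx hy
  | smul c x _ hx => rw [smul_smul_right]; exact Submodule.smul_mem _ _ hx

/-- If `σ` moves the first place to `a` and the places up to `a` are black, then `H_0⁻¹` acts on
`v · (bar H_σ)` by a scalar: the letters `s_a, …, s_1` can be split off on the left of `σ`, they
keep the first entries black, and the remaining factor commutes with `s_0`. -/
theorem smul_heckeBar_Helt_zero {r m d : ℕ} {z : Fin d} (hz : z.val = 0) : ∀ (n : ℕ) {a : Fin d},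
    a.val = n → ∀ {σ : WB d}, σ.1 (z, 1) = (a, 1) →
    (∀ j ≤ a, 0 < sval (σ⁻¹.1 (j, 1))) → ∀ {v : TensorSpace P r m d}, v ∈ blackSpan P r m a →
    (v <• heckeBar P d (Helt P σ)) <• Hinv P z =
      (P.par z)⁻¹ • (v <• heckeBar P d (Helt P σ)) := by
  intro n
  induction n with
  | zero =>
    intro a ha σ hσ hpos v hv
    have haz : a = z := Fin.ext (by omega)
    subst haz
    have hσ' : σ⁻¹.1 (a, 1) = (a, 1) := σ.1.symm_apply_eq.2 hσ.symm
    have hc : simpleRefl a = σ * simpleRefl a * σ⁻¹ := by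
      apply (swapsOnePair_simpleRefl a).eq_of_apply_eq ((swapsOnePair_simpleRefl a).conj σ)
        (x := (a, 1))
      · rw [simpleRefl_zero_apply hz]; simp
      · change _ = σ.1 ((simpleRefl a).1 (σ⁻¹.1 (a, 1)))
        have e : ((a, -1) : SgnIdx d) = negIdx d (a, 1) := by simp [negIdx]
        rw [hσ', simpleRefl_zero_apply hz, e, apply_neg, hσ]
    have hc' : simpleRefl a * σ = σ * simpleRefl a := by
      nth_rewrite 1 [hc]; group
    have hp : PosOn σ (simpleRefl a) := by
      rw [posOn_simpleRefl_zero _ _ hz, wval, hσ, sval_one]; omega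
    have hl := (len_lt_len_mul_iff (swapsOnePair_simpleRefl a)).2 hp
    rw [← smul_mul_right, ← heckeBar_Helt_mul P hp, ← hc',
      heckeBar_mul_Helt P (by rwa [hc']), smul_mul_right, blackSpan_smul_zero P hz hv,
      smul_smul_right]
  | succ n ih =>
    intro a ha σ hσ hpos v hv
    have ha0 : a.val ≠ 0 := by omega
    obtain ⟨τ, rfl⟩ : ∃ τ, σ = simpleRefl a * τ :=
      ⟨simpleRefl a * σ, by rw [← mul_assoc, simpleRefl_mul_self, one_mul]⟩
    have hτ : τ.1 (z, 1) = (prevIdx a, 1) := by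
      have h1 : (simpleRefl a).1 (τ.1 (z, 1)) = (a, 1) := hσ
      rw [← simpleRefl_pos_apply ha0, ← h1, simpleRefl_apply_apply]
    have hτ' : τ⁻¹.1 (prevIdx a, 1) = (z, 1) := τ.1.symm_apply_eq.2 hτ.symm
    have hinv : ∀ x, (simpleRefl a * τ)⁻¹.1 x = τ⁻¹.1 ((simpleRefl a).1 x) := by
      intro x
      rw [mul_inv_rev, simpleRefl_inv]; rfl
    have hp : PosOn τ⁻¹ (simpleRefl a) := by
      have h1 := hpos (prevIdx a) (by rw [Fin.le_def]; simp only [prevIdx]; omega)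
      rw [hinv, simpleRefl_pos_apply_prevIdx ha0] at h1
      have h2 : sval (τ⁻¹.1 (a, 1)) ≠ sval (τ⁻¹.1 (prevIdx a, 1)) := by
        intro e
        have := τ⁻¹.1.injective (sval_injective e)
        exact prevIdx_ne a ha0 (congrArg Prod.fst this).symm
      rw [posOn_simpleRefl_pos _ _ ha0, wval, wval]
      rw [hτ', sval_one] at h2 ⊢
      omega
    have hl : len τ < len (simpleRefl a * τ) := by
      have := (len_lt_len_mul_iff (swapsOnePair_simpleRefl a)).2 hp
      rw [len_inv] at this
      rwa [← len_inv (simpleRefl a * τ), mul_inv_rev, simpleRefl_inv]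
    rw [heckeBar_mul_Helt P hl, smul_mul_right]
    have hpa : prevIdx a ≤ a := by rw [Fin.le_def]; simp only [prevIdx]; omega
    refine ih (a := prevIdx a) (by simp only [prevIdx]; omega) hτ ?_
      (blackSpan_mono P r m hpa (smul_Hinv_mem_blackSpan P ha0 le_rfl hv))
    intro j hj
    by_cases hj' : j = prevIdx a
    · rw [hj', hτ', sval_one]; omega
    · have hja : j ≠ a := by
        intro e; rw [e, Fin.le_def] at hj; simp only [prevIdx] at hj; omega
      have := hpos j (hj.trans hpa)
      rwa [hinv, simpleRefl_pos_apply_of_ne ha0 hj' hja] at this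

/-- If a minimal length representative `σ` and `s_i`, `i > 0`, satisfy `f · σ · s_i = f · σ`, then
`σ * s_i = s_c * σ` for a simple reflection `s_c`. -/
theorem exists_simpleRefl_mul {r m d : ℕ} {f : Weight r m d} (hf : AntiDominant f) {σ : WB d}
    (hσ : σ ∈ minReps f) {i : Fin d} (hi : i.val ≠ 0)
    (h : wact f (σ * simpleRefl i) = wact f σ) :
    ∃ c : Fin d, c.val ≠ 0 ∧ simpleRefl c * σ = σ * simpleRefl i := by
  have hm := monoOnFibers_of_mem_minReps hσ
  have hFAB : extWeight f (σ.1 (prevIdx i, 1)) = extWeight f (σ.1 (i, 1)) := by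
    have := congrFun h (prevIdx i)
    rw [wact_eq_extWeight, wact_eq_extWeight] at this
    rw [← this]
    change extWeight f (σ.1 ((simpleRefl i).1 (prevIdx i, 1))) = _
    rw [simpleRefl_pos_apply_prevIdx hi]
  have hAB : sval (σ.1 (prevIdx i, 1)) < sval (σ.1 (i, 1)) :=
    hm _ _ (by rw [sval_one, sval_one]; simp only [prevIdx]; omega) hFAB
  -- no point of the fiber lies strictly between the two images
  have hbetween : ∀ C, sval (σ.1 (prevIdx i, 1)) < sval C → sval C < sval (σ.1 (i, 1)) →
      extWeight f C ≠ extWeight f (σ.1 (i, 1)) := by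
    intro C h1 h2 h3
    obtain ⟨x, rfl⟩ := σ.1.surjective C
    have e1 : sval x < sval ((i, 1) : SgnIdx d) := by
      by_contra hle
      rcases (not_lt.1 hle).eq_or_lt with e | hlt
      · rw [sval_injective e] at h2; exact lt_irrefl _ h2
      · have := hm _ _ hlt h3.symm; omega
    have e2 : sval ((prevIdx i, 1) : SgnIdx d) < sval x := by
      by_contra hle
      rcases (not_lt.1 hle).eq_or_lt with e | hlt
      · rw [sval_injective e] at h1; exact lt_irrefl _ h1
      · have := hm _ _ hlt (h3.trans hFAB.symm); omega
    rw [sval_one] at e1 e2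
    simp only [prevIdx] at e2
    omega
  have hsign : ¬ (sval (σ.1 (prevIdx i, 1)) < 0 ∧ 0 < sval (σ.1 (i, 1))) := by
    rintro ⟨h1, h2⟩
    have h3 := le_extWeight_of_neg hf h1
    have h4 := extWeight_lt_of_pos hf h2
    rw [← hFAB] at h4
    have h5 := (hm.pos_iff (x := (prevIdx i, 1)) ⟨h3, h4⟩).2 (by rw [sval_one]; omega)
    omega
  have conclude : ∀ (c : Fin d), c.val ≠ 0 → (simpleRefl c).1 (σ.1 (i, 1)) = σ.1 (prevIdx i, 1) →
      simpleRefl c * σ = σ * simpleRefl i := by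
    intro c hc e
    have h1 : simpleRefl c = σ * simpleRefl i * σ⁻¹ := by
      apply (swapsOnePair_simpleRefl c).eq_of_apply_eq ((swapsOnePair_simpleRefl i).conj σ)
        (x := σ.1 (i, 1))
      · intro e'
        rw [e] at e'; rw [e'] at hAB; exact lt_irrefl _ hAB
      · change _ = σ.1 ((simpleRefl i).1 (σ⁻¹.1 (σ.1 (i, 1))))
        have : σ⁻¹.1 (σ.1 (i, 1)) = (i, 1) := σ.1.symm_apply_apply _
        rw [this, simpleRefl_pos_apply hi, e]
    rw [h1]; group
  have hpos : ∀ k : Fin d, extWeight f (k, 1) = f k := fun k => by simp [extWeight]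
  have hneg : ∀ k : Fin d, extWeight f (k, -1) = signFlip (f k) := fun k => by simp [extWeight]
  obtain ⟨a, ε, hA⟩ : ∃ a ε, σ.1 (prevIdx i, 1) = (a, ε) := ⟨_, _, rfl⟩
  obtain ⟨b, δ, hB⟩ : ∃ b δ, σ.1 (i, 1) = (b, δ) := ⟨_, _, rfl⟩
  rw [hA, hB] at hAB hFAB hbetween hsign conclude
  rcases Int.units_eq_one_or ε with rfl | rfl <;> rcases Int.units_eq_one_or δ with rfl | rfl
  · rw [sval_one, sval_one] at hAB
    rw [hpos, hpos] at hFAB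
    have hb0 : b.val ≠ 0 := by omega
    have hab : a = prevIdx b := by
      by_contra hne
      have h1 : a.val ≠ b.val - 1 := fun e => hne (Fin.ext e)
      refine hbetween (prevIdx b, 1) ?_ ?_ ?_
      · rw [sval_one, sval_one]; simp only [prevIdx]; omega
      · rw [sval_one, sval_one]; simp only [prevIdx]; omega
      · rw [hpos, hpos]
        apply le_antisymm
        · rw [← hFAB]
          exact hf.1 (by rw [Fin.le_def]; simp only [prevIdx]; omega)
        · exact hf.1 (by rw [Fin.le_def]; simp only [prevIdx]; omega)
    refine ⟨b, hb0, conclude b hb0 ?_⟩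
    rw [simpleRefl_pos_apply hb0, hab]
  · rw [sval_one, sval_neg_one] at hAB; omega
  · exfalso
    apply hsign
    rw [sval_one, sval_neg_one]
    omega
  · rw [sval_neg_one, sval_neg_one] at hAB
    rw [hneg, hneg] at hFAB
    have hfab : f a = f b := by rw [← signFlip_signFlip (f a), hFAB, signFlip_signFlip]
    have ha0 : a.val ≠ 0 := by omega
    have hab : b = prevIdx a := by
      by_contra hne
      have h1 : b.val ≠ a.val - 1 := fun e => hne (Fin.ext e)
      refine hbetween (prevIdx a, -1) ?_ ?_ ?_
      · rw [sval_neg_one, sval_neg_one]; simp only [prevIdx]; omega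
      · rw [sval_neg_one, sval_neg_one]; simp only [prevIdx]; omega
      · rw [hneg, hneg]
        congr 1
        apply le_antisymm
        · exact hf.1 (by rw [Fin.le_def]; simp only [prevIdx]; omega)
        · rw [← hfab]
          exact hf.1 (by rw [Fin.le_def]; simp only [prevIdx]; omega)
    refine ⟨a, ha0, conclude a ha0 ?_⟩
    rw [hab, ← simpleRefl_pos_apply ha0, simpleRefl_apply_apply]

/-- The vector `M_f · (bar H_σ)`. -/
noncomputable def barVec {r m d : ℕ} (f : Weight r m d) (σ : WB d) : TensorSpace P r m d :=
  stdVec P f <• heckeBar P d (Helt P σ)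

/-- The relation `M_{f · σ} · H_i = q_i M_{f · σ}` is preserved by the bar involution. -/
theorem barVec_smul_of_wact_eq {r m d : ℕ} {f : Weight r m d} (hf : AntiDominant f) {σ : WB d}
    (hσ : σ ∈ minReps f) {i : Fin d} (h : wact f (σ * simpleRefl i) = wact f σ) :
    barVec P f σ <• Hinv P i = (P.par i)⁻¹ • barVec P f σ := by
  by_cases hi : i.val = 0
  · have hm := monoOnFibers_of_mem_minReps hσ
    have hb : IsBlack (extWeight f (σ.1 (i, 1))) := by
      by_contra hb
      rw [wact_mul, wact_simple_zero _ _ hi, Function.update_eq_self_iff] at h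
      exact signFlip_ne_of_not_isBlack hb h
    have hp := (hm.pos_iff hb).2 (by rw [sval_one]; omega)
    obtain ⟨a, ε, hA⟩ : ∃ a ε, σ.1 (i, 1) = (a, ε) := ⟨_, _, rfl⟩
    rw [hA] at hp hb
    rcases Int.units_eq_one_or ε with rfl | rfl
    · have hpos : ∀ k : Fin d, extWeight f (k, 1) = f k := fun k => by simp [extWeight]
      rw [hpos] at hb
      have hbl : ∀ b ≤ a, IsBlack (f b) := by
        intro b hba
        have h1 := Fin.le_def.1 (hf.1 hba)
        exact ⟨hb.1.trans h1, hf.2 b⟩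
      refine smul_heckeBar_Helt_zero P hi _ rfl hA ?_ (Submodule.subset_span ⟨f, hbl, rfl⟩)
      intro j hj
      have hσσ : σ.1 (σ⁻¹.1 (j, 1)) = (j, 1) := σ.1.apply_symm_apply _
      rw [← hm.pos_iff (by rw [hσσ, hpos]; exact hbl j hj), hσσ, sval_one]
      omega
    · rw [sval_neg_one] at hp; omega
  · obtain ⟨c, hc, e⟩ := exists_simpleRefl_mul hf hσ hi h
    have hp := posOn_of_wact_eq hσ h
    have hl := (len_lt_len_mul_iff (swapsOnePair_simpleRefl i)).2 hp
    have hfc : wact f (simpleRefl c) = f := by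
      have : wact (wact f (simpleRefl c)) σ = wact f σ := by rw [← wact_mul, e, h]
      have h2 := congrArg (fun g => wact g σ⁻¹) this
      simpa only [← wact_mul, mul_inv_cancel_right, mul_inv_cancel, wact_one] using h2
    have hpar : P.par i = P.par c := by rw [HeckeParam.par, HeckeParam.par, if_neg hi, if_neg hc]
    rw [barVec, ← smul_mul_right, ← heckeBar_Helt_mul P hp, ← e,
      heckeBar_mul_Helt P (by rwa [e]), smul_mul_right,
      smul_Hinv_of_smul_Hgen P (stdVec_smul_of_wact_eq P hfc), smul_smul_right, hpar]

/-! ### Construction of the bar involution -/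

open Classical in
/-- The image of `M_g` under the bar involution; it is `0` for `g` outside the orbit of `f`. -/
noncomputable def barImage {r m d : ℕ} (f g : Weight r m d) : TensorSpace P r m d :=
  if h : ∃ σ ∈ minReps f, wact f σ = g then barVec P f h.choose else 0

theorem barImage_wact {r m d : ℕ} {f : Weight r m d} (hf : AntiDominant f) {σ : WB d}
    (hσ : σ ∈ minReps f) : barImage P f (wact f σ) = barVec P f σ := by
  have h : ∃ τ ∈ minReps f, wact f τ = wact f σ := ⟨σ, hσ, rfl⟩
  rw [barImage, dif_pos h, eq_of_mem_minReps hf h.choose_spec.1 hσ h.choose_spec.2]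

/-- The anti-linear map on a space of finitely supported functions with prescribed values on the
standard basis. -/
noncomputable def antilinearExtension {ι V : Type*} [AddCommGroup V] [Module K V] (v : ι → V) :
    (ι →₀ K) →ₛₗ[P.bar] V where
  toFun x := Finsupp.linearCombination K v (Finsupp.mapRange P.bar (map_zero _) x)
  map_add' x y := by
    rw [← map_add]
    congr 1
    ext g; simp
  map_smul' c x := by
    rw [← map_smul]
    congr 1
    ext g; simp

theorem antilinearExtension_single {ι V : Type*} [AddCommGroup V] [Module K V] (v : ι → V)
    (i : ι) : antilinearExtension P v (Finsupp.single i 1) = v i := by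
  change Finsupp.linearCombination K v (Finsupp.mapRange P.bar (map_zero _)
    (Finsupp.single i 1)) = _
  rw [Finsupp.mapRange_single, map_one, Finsupp.linearCombination_single, one_smul]

/-- The anti-linear map on the tensor space with `M_{f · σ} ↦ M_f · (bar H_σ)`, and with `M_g ↦ 0`
for `g` outside the orbit of `f`. -/
noncomputable def tensorBar {r m d : ℕ} (f : Weight r m d) :
    TensorSpace P r m d →ₛₗ[P.bar] TensorSpace P r m d :=
  antilinearExtension (ι := Weight r m d) (V := TensorSpace P r m d) P (barImage P f)

theorem tensorBar_stdVec {r m d : ℕ} {f : Weight r m d} (hf : AntiDominant f) {σ : WB d}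
    (hσ : σ ∈ minReps f) : tensorBar P f (stdVec P (wact f σ)) = barVec P f σ := by
  exact (antilinearExtension_single P _ _).trans (barImage_wact P hf hσ)

theorem barVec_one {r m d : ℕ} (f : Weight r m d) : barVec P f 1 = stdVec P f := by
  rw [barVec, Helt_one, map_one, MulOpposite.op_one, one_smul]

theorem tensorBar_stdVec_self {r m d : ℕ} {f : Weight r m d} (hf : AntiDominant f) :
    tensorBar P f (stdVec P f) = stdVec P f := by
  have := tensorBar_stdVec P hf (one_mem_minReps f)
  rwa [wact_one, barVec_one] at this

/-- The span of the `M_g` with `g` in the orbit of `f`. It is the underlying vector space of `𝕄_f`, see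
`mem_QPerm_iff_mem_orbitSpan`. -/
noncomputable def orbitSpan {r m d : ℕ} (f : Weight r m d) : Submodule K (TensorSpace P r m d) :=
  Submodule.span K {x | ∃ σ ∈ minReps f, x = stdVec P (wact f σ)}

theorem stdVec_mem_orbitSpan {r m d : ℕ} {f : Weight r m d} {σ : WB d} (hσ : σ ∈ minReps f) :
    stdVec P (wact f σ) ∈ orbitSpan P f := Submodule.subset_span ⟨σ, hσ, rfl⟩

theorem tensorBar_stdVec_smul_Hgen {r m d : ℕ} {f : Weight r m d} (hf : AntiDominant f)
    {σ : WB d} (hσ : σ ∈ minReps f) (i : Fin d) :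
    stdVec P (wact f σ) <• Hgen P i ∈ orbitSpan P f ∧
    tensorBar P f (stdVec P (wact f σ) <• Hgen P i) =
      tensorBar P f (stdVec P (wact f σ)) <• Hinv P i := by
  by_cases hfix : wact f (σ * simpleRefl i) = wact f σ
  · rw [stdVec_smul_of_wact_eq P (by rw [← wact_mul, hfix])]
    refine ⟨Submodule.smul_mem _ _ (stdVec_mem_orbitSpan P hσ), ?_⟩
    rw [map_smulₛₗ, tensorBar_stdVec P hf hσ, barVec_smul_of_wact_eq P hf hσ hfix, P.bar_par]
  · have up : ∀ {τ : WB d}, τ ∈ minReps f → wact f (τ * simpleRefl i) ≠ wact f τ →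
        PosOn τ (simpleRefl i) → tensorBar P f (stdVec P (wact f (τ * simpleRefl i))) =
          tensorBar P f (stdVec P (wact f τ)) <• Hinv P i := by
      intro τ hτ hne hp
      rw [tensorBar_stdVec P hf (mul_simpleRefl_mem_minReps hf hτ hne), tensorBar_stdVec P hf hτ,
        barVec, heckeBar_Helt_mul P hp, smul_mul_right, barVec]
    have hσi := mul_simpleRefl_mem_minReps hf hσ hfix
    by_cases hp : PosOn σ (simpleRefl i)
    · rw [stdVec_smul_of_posOn P hf hσ hp hfix]
      exact ⟨stdVec_mem_orbitSpan P hσi, up hσ hfix hp⟩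
    · obtain ⟨τ, rfl⟩ : ∃ τ, σ = τ * simpleRefl i :=
        ⟨σ * simpleRefl i, by rw [mul_assoc, simpleRefl_mul_self, mul_one]⟩
      have hτ1 : τ * simpleRefl i * simpleRefl i = τ := by
        rw [mul_assoc, simpleRefl_mul_self, mul_one]
      rw [hτ1] at hfix hσi
      have hp' : PosOn τ (simpleRefl i) := by
        by_contra h; exact hp ((posOn_mul_self (swapsOnePair_simpleRefl i)).2 h)
      have h1 := up hσi (Ne.symm hfix) hp'
      have h2 : stdVec P (wact f (τ * simpleRefl i)) <• Hgen P i =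
          (P.par i - (P.par i)⁻¹) • stdVec P (wact f (τ * simpleRefl i)) +
            stdVec P (wact f τ) := by
        rw [← stdVec_smul_of_posOn P hf hσi hp' (Ne.symm hfix), smul_Hgen_Hgen]
      rw [h2]
      refine ⟨Submodule.add_mem _ (Submodule.smul_mem _ _ (stdVec_mem_orbitSpan P hσ))
        (stdVec_mem_orbitSpan P hσi), ?_⟩
      -- `H_i⁻¹ * H_i = 1` recovers the image of `M_{f · τ}` from that of `M_{f · τ s_i}`
      have h3 : tensorBar P f (stdVec P (wact f τ)) =
          tensorBar P f (stdVec P (wact f (τ * simpleRefl i))) <• Hgen P i := by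
        rw [h1, ← smul_mul_right, Hinv_mul_Hgen, MulOpposite.op_one, one_smul]
      rw [map_add, map_smulₛₗ, map_sub, map_inv₀, P.bar_par, inv_inv, h3, smul_Hinv,
        ← neg_sub (P.par i), neg_smul]
      abel

theorem tensorBar_smul {r m d : ℕ} {f : Weight r m d} (hf : AntiDominant f) (h : Hecke P d) :
    ∀ x ∈ orbitSpan P f, x <• h ∈ orbitSpan P f ∧
      tensorBar P f (x <• h) = tensorBar P f x <• heckeBar P d h := by
  induction h using Hecke_induction with
  | alg c =>
    intro x hx
    rw [smul_algebraMap_right, heckeBar_algebraMap, smul_algebraMap_right, map_smulₛₗ]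
    exact ⟨Submodule.smul_mem _ _ hx, rfl⟩
  | gen i =>
    intro x hx
    rw [heckeBar_Hgen]
    induction hx using Submodule.span_induction with
    | mem x hx =>
      obtain ⟨σ, hσ, rfl⟩ := hx
      exact tensorBar_stdVec_smul_Hgen P hf hσ i
    | zero => simp only [smul_zero, map_zero, and_true]; exact Submodule.zero_mem _
    | add x y _ _ hx hy =>
      rw [smul_add, map_add, map_add, smul_add, hx.2, hy.2]
      exact ⟨Submodule.add_mem _ hx.1 hy.1, rfl⟩
    | smul c x _ hx =>
      rw [smul_smul_right, map_smulₛₗ (tensorBar P f) c (x <• Hgen P i),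
        map_smulₛₗ (tensorBar P f) c x, smul_smul_right, hx.2]
      exact ⟨Submodule.smul_mem _ _ hx.1, rfl⟩
  | add a b ha hb =>
    intro x hx
    rw [MulOpposite.op_add, add_smul, map_add, map_add, MulOpposite.op_add, add_smul,
      (ha x hx).2, (hb x hx).2]
    exact ⟨Submodule.add_mem _ (ha x hx).1 (hb x hx).1, rfl⟩
  | mul a b ha hb =>
    intro x hx
    have h1 := ha x hx
    have h2 := hb _ h1.1
    rw [smul_mul_right, map_mul, smul_mul_right, ← h1.2]
    exact h2

theorem mem_QPerm_iff {r m d : ℕ} {f : Weight r m d} {x : TensorSpace P r m d} :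
    x ∈ QPerm P f ↔ ∃ h : Hecke P d, x = stdVec P f <• h := by
  rw [QPerm, Submodule.mem_span_singleton]
  constructor
  · rintro ⟨a, rfl⟩; exact ⟨a.unop, rfl⟩
  · rintro ⟨h, rfl⟩; exact ⟨MulOpposite.op h, rfl⟩

theorem stdVec_self_mem_orbitSpan {r m d : ℕ} (f : Weight r m d) :
    stdVec P f ∈ orbitSpan P f := by
  have := stdVec_mem_orbitSpan P (one_mem_minReps f)
  rwa [wact_one] at this

theorem stdVec_mem_QPerm {r m d : ℕ} {f : Weight r m d} (hf : AntiDominant f) {σ : WB d}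
    (hσ : σ ∈ minReps f) : stdVec P (wact f σ) ∈ QPerm P f :=
  (mem_QPerm_iff P).2 ⟨Helt P σ, (stdVec_smul_Helt P hf _ rfl hσ).symm⟩

theorem mem_QPerm_iff_mem_orbitSpan {r m d : ℕ} {f : Weight r m d} (hf : AntiDominant f)
    {x : TensorSpace P r m d} : x ∈ QPerm P f ↔ x ∈ orbitSpan P f := by
  constructor
  · rw [mem_QPerm_iff]
    rintro ⟨h, rfl⟩
    exact (tensorBar_smul P hf h _ (stdVec_self_mem_orbitSpan P f)).1
  · intro hx
    have : orbitSpan P f ≤ (QPerm P f).restrictScalars K := by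
      rw [orbitSpan, Submodule.span_le]
      rintro x ⟨σ, hσ, rfl⟩
      exact stdVec_mem_QPerm P hf hσ
    exact this hx

theorem tensorBar_gen_smul {r m d : ℕ} {f : Weight r m d} (hf : AntiDominant f) (h : Hecke P d) :
    tensorBar P f (stdVec P f <• h) = stdVec P f <• heckeBar P d h := by
  rw [(tensorBar_smul P hf h _ (stdVec_self_mem_orbitSpan P f)).2, tensorBar_stdVec_self P hf]

/-- The bar involution of the quasi-permutation module. -/
noncomputable def qpermBar {r m d : ℕ} {f : Weight r m d} (hf : AntiDominant f) :
    QPerm P f →ₛₗ[P.bar] QPerm P f where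
  toFun x := ⟨tensorBar P f x, by
    obtain ⟨h, hh⟩ := (mem_QPerm_iff P).1 x.2
    rw [hh, tensorBar_gen_smul P hf]
    exact (mem_QPerm_iff P).2 ⟨_, rfl⟩⟩
  map_add' x y := Subtype.ext (map_add (tensorBar P f) _ _)
  map_smul' c x := Subtype.ext (map_smulₛₗ (tensorBar P f) c _)

theorem coe_qpermBar {r m d : ℕ} {f : Weight r m d} (hf : AntiDominant f) (x : QPerm P f) :
    (qpermBar P hf x : TensorSpace P r m d) = tensorBar P f x := rfl

theorem isBarInvolution_qpermBar {r m d : ℕ} {f : Weight r m d} (hf : AntiDominant f) :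
    IsBarInvolution P f (qpermBar P hf) where
  map_gen := Subtype.ext (tensorBar_stdVec_self P hf)
  map_act x h := Subtype.ext
    (tensorBar_smul P hf h _ ((mem_QPerm_iff_mem_orbitSpan P hf).1 x.2)).2
  involutive x := by
    apply Subtype.ext
    rw [coe_qpermBar, coe_qpermBar]
    obtain ⟨h, hh⟩ := (mem_QPerm_iff P).1 x.2
    rw [hh, tensorBar_gen_smul P hf, tensorBar_gen_smul P hf, heckeBar_heckeBar]
  map_std σ hσ l hl := by
    refine ⟨⟨_, stdVec_mem_QPerm P hf hσ⟩, rfl, Subtype.ext ?_⟩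
    rw [coe_qpermBar, tensorBar_stdVec P hf hσ, barVec, Hword_eq_Helt P hl]
    rfl

end BarInvolution

/-! ### Integral Laurent polynomials in `ℚ(q)` -/

section Laurent

open LaurentPolynomial Polynomial

/-- The evaluation of integral Laurent polynomials at `q`. -/
noncomputable def laurentEval : LaurentPolynomial ℤ →+* Qq :=
  LaurentPolynomial.eval₂ (Int.castRingHom Qq) (Units.mk0 RatFunc.X RatFunc.X_ne_zero)

theorem laurentEval_toLaurent (p : ℤ[X]) :
    laurentEval (toLaurent p) = p.eval₂ (Int.castRingHom Qq) RatFunc.X := by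
  rw [laurentEval, LaurentPolynomial.eval₂_toLaurent, Units.val_mk0]

theorem laurentEval_T (n : ℤ) : laurentEval (T n) = (RatFunc.X : Qq) ^ n := by
  rw [laurentEval, LaurentPolynomial.eval₂_T]; simp

theorem laurentEval_C (a : ℤ) : laurentEval (LaurentPolynomial.C a) = (a : Qq) := by
  rw [laurentEval, LaurentPolynomial.eval₂_C]; simp

theorem barQq_X : barQq RatFunc.X = (RatFunc.X : Qq)⁻¹ := ratBar_X _

theorem laurentEval_invert (A : LaurentPolynomial ℤ) :
    laurentEval (invert A) = barQq (laurentEval A) := by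
  induction A using LaurentPolynomial.induction_on' with
  | add p q hp hq => rw [map_add, map_add, map_add, map_add, hp, hq]
  | C_mul_T n a =>
    rw [map_mul, invert_T, invert_C, map_mul, map_mul, laurentEval_T, laurentEval_T, laurentEval_C,
      map_mul, map_intCast, map_zpow₀, barQq_X, zpow_neg, inv_zpow]

theorem laurentEval_injective : Function.Injective laurentEval := by
  rw [injective_iff_map_eq_zero]
  intro A hA
  obtain ⟨n, p, hp⟩ := LaurentPolynomial.exists_T_pow A
  have h1 : p.eval₂ (Int.castRingHom Qq) RatFunc.X = 0 := by
    rw [← laurentEval_toLaurent, hp, map_mul, hA, zero_mul]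
  have h3 : p.map (Int.castRingHom ℚ) = 0 := by
    apply RatFunc.algebraMap_injective ℚ
    rw [map_zero, ← h1]
    have h2 : (algebraMap ℚ[X] Qq).comp (Polynomial.mapRingHom (Int.castRingHom ℚ)) =
        Polynomial.eval₂RingHom (Int.castRingHom Qq) RatFunc.X := by
      apply Polynomial.ringHom_ext
      · intro a; simp
      · simp
    exact RingHom.congr_fun h2 p
  have h4 : p = 0 := Polynomial.map_injective _ (Int.castRingHom ℚ).injective_int
    (h3.trans (Polynomial.map_zero _).symm)
  rw [h4, map_zero] at hp
  exact ((LaurentPolynomial.isUnit_T (n : ℤ)).mul_left_eq_zero).1 hp.symm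

/-- `trunc` discards the terms of negative degree. -/
theorem trunc_invert_toLaurent (w : ℤ[X]) : trunc (invert (toLaurent (X * w))) = 0 := by
  induction w using Polynomial.induction_on' with
  | add p q hp hq => rw [mul_add, map_add, map_add, map_add, hp, hq, add_zero]
  | monomial n a =>
    have : (X * monomial n a : ℤ[X]) = Polynomial.C a * X ^ (n + 1) := by
      rw [← Polynomial.C_mul_X_pow_eq_monomial]; ring
    rw [this, Polynomial.toLaurent_C_mul_X_pow, map_mul, invert_C, invert_T, trunc_C_mul_T,
      if_neg (by push_cast; omega)]

theorem exists_eq_toLaurent_add (A : LaurentPolynomial ℤ) : ∃ (u v : ℤ[X]) (n : ℤ),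
    A = toLaurent (X * u) + LaurentPolynomial.C n + invert (toLaurent (X * v)) := by
  induction A using LaurentPolynomial.induction_on' with
  | add p q hp hq =>
    obtain ⟨u, v, n, rfl⟩ := hp
    obtain ⟨u', v', n', rfl⟩ := hq
    refine ⟨u + u', v + v', n + n', ?_⟩
    simp only [mul_add, map_add]
    abel
  | C_mul_T n a =>
    have hm : ∀ k : ℕ, (X * monomial k a : ℤ[X]) = Polynomial.C a * X ^ (k + 1) := by
      intro k
      rw [← Polynomial.C_mul_X_pow_eq_monomial]; ring
    rcases lt_trichotomy n 0 with h | rfl | h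
    · refine ⟨0, monomial (n.natAbs - 1) a, 0, ?_⟩
      rw [hm, Polynomial.toLaurent_C_mul_X_pow, map_mul invert, invert_C, invert_T]
      simp only [mul_zero, map_zero, zero_add]
      congr 2
      omega
    · exact ⟨0, 0, a, by simp⟩
    · refine ⟨monomial (n.natAbs - 1) a, 0, 0, ?_⟩
      rw [hm, Polynomial.toLaurent_C_mul_X_pow]
      simp only [mul_zero, map_zero, add_zero]
      congr 2
      omega

/-- The ring `ℤ[q, q⁻¹]` inside `ℚ(q)`. -/
noncomputable def laurentSubring : Subring Qq := laurentEval.range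

theorem zpow_mem_laurentSubring (n : ℤ) : (RatFunc.X : Qq) ^ n ∈ laurentSubring :=
  ⟨T n, laurentEval_T n⟩

theorem barQq_mem_laurentSubring {a : Qq} (ha : a ∈ laurentSubring) :
    barQq a ∈ laurentSubring := by
  obtain ⟨A, rfl⟩ := ha
  exact ⟨invert A, laurentEval_invert A⟩

theorem inv_mul_eval₂_inv (g : ℤ[X]) :
    (RatFunc.X : Qq)⁻¹ * g.eval₂ (Int.castRingHom Qq) (RatFunc.X)⁻¹ =
      barQq (laurentEval (toLaurent (X * g))) := by
  rw [laurentEval_toLaurent, Polynomial.eval₂_mul, Polynomial.eval₂_X, map_mul, barQq_X,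
    Polynomial.hom_eval₂, barQq_X]
  congr 2
  exact RingHom.ext_int _ _

/-- The additive group `q⁻¹ ℤ[q⁻¹]`. -/
noncomputable def qInvIntSubgroup {K : Type} [Field K] (P : HeckeParam K) : AddSubgroup K where
  carrier := qInvIntPoly P
  zero_mem' := ⟨0, by simp⟩
  add_mem' := by
    rintro a b ⟨g, rfl⟩ ⟨h, rfl⟩
    exact ⟨g + h, by rw [map_add, mul_add]⟩
  neg_mem' := by
    rintro a ⟨g, rfl⟩
    exact ⟨-g, by rw [map_neg, mul_neg]⟩

theorem mem_qInvIntSubgroup_iff_eval₂ {K : Type} [Field K] {P : HeckeParam K} {c : K} :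
    c ∈ qInvIntSubgroup P ↔ ∃ g : ℤ[X], c = P.q⁻¹ * g.eval₂ (Int.castRingHom K) P.q⁻¹ :=
  Iff.rfl

theorem mem_qInvIntSubgroup_iff {k : ℤ} {c : Qq} : c ∈ qInvIntSubgroup (oneParam k) ↔
    ∃ g : ℤ[X], c = barQq (laurentEval (toLaurent (X * g))) := by
  rw [mem_qInvIntSubgroup_iff_eval₂]
  exact exists_congr fun g => by rw [← inv_mul_eval₂_inv]; rfl

theorem mem_laurentSubring_of_mem_qInvIntSubgroup {k : ℤ} {c : Qq}
    (h : c ∈ qInvIntSubgroup (oneParam k)) : c ∈ laurentSubring := by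
  obtain ⟨g, rfl⟩ := mem_qInvIntSubgroup_iff.1 h
  exact barQq_mem_laurentSubring ⟨_, rfl⟩

/-- No nonzero element of `q⁻¹ ℤ[q⁻¹]` is bar invariant. -/
theorem eq_zero_of_barQq_eq {k : ℤ} {c : Qq} (h : c ∈ qInvIntSubgroup (oneParam k))
    (hc : barQq c = c) : c = 0 := by
  obtain ⟨g, rfl⟩ := mem_qInvIntSubgroup_iff.1 h
  rw [barQq_barQq, ← laurentEval_invert] at hc
  have h1 := congrArg trunc (laurentEval_injective hc)
  rw [trunc_invert_toLaurent, Polynomial.trunc_toLaurent] at h1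
  rw [h1]; simp

/-- An anti-invariant Laurent polynomial is `b - bar b`, where `b` is its part of negative
degree. -/
theorem exists_eq_sub_barQq (k : ℤ) {a : Qq} (ha : a ∈ laurentSubring) (h : barQq a = -a) :
    ∃ b ∈ qInvIntSubgroup (oneParam k), a = b - barQq b := by
  obtain ⟨A, rfl⟩ := ha
  rw [← laurentEval_invert, ← map_neg] at h
  have h1 := laurentEval_injective h
  obtain ⟨u, v, n, rfl⟩ := exists_eq_toLaurent_add A
  have hinv : ∀ B : LaurentPolynomial ℤ, invert (invert B) = B := involutive_invert
  have h2 : trunc (toLaurent (X * (u + v)) + toLaurent (Polynomial.C (2 * n)) +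
      invert (toLaurent (X * (u + v)))) = 0 := by
    rw [← map_zero trunc]
    congr 1
    rw [eq_neg_iff_add_eq_zero] at h1
    rw [← h1, Polynomial.toLaurent_C, two_mul]
    simp only [mul_add, map_add, invert_C, hinv]
    abel
  rw [map_add, map_add, trunc_invert_toLaurent, Polynomial.trunc_toLaurent,
    Polynomial.trunc_toLaurent, add_zero] at h2
  have h3 : n = 0 := by
    have := congrArg (Polynomial.eval 0) h2
    simpa using this
  subst h3
  have h4 : X * u = -(X * v) := by
    simp only [mul_zero, map_zero, add_zero, mul_add] at h2
    exact eq_neg_of_add_eq_zero_left h2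
  refine ⟨_, mem_qInvIntSubgroup_iff.2 ⟨v, rfl⟩, ?_⟩
  rw [map_add, map_add, map_zero, map_zero, add_zero, h4, map_neg, map_neg, laurentEval_invert,
    barQq_barQq]
  ring

end Laurent

/-! ### Bar invariant bases -/

section KazhdanLusztig

variable {K V ι : Type*} [Field K] [AddCommGroup V] [Module K V]

/-- The linear combinations of the `v i`, `i ∈ D`, with coefficients in `A`. -/
def coeffSpan (A : AddSubgroup K) (v : ι → V) (D : Set ι) : AddSubgroup V :=
  AddSubgroup.closure {x | ∃ i ∈ D, ∃ c ∈ A, x = c • v i}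

theorem smul_mem_coeffSpan {A : AddSubgroup K} {v : ι → V} {D : Set ι} {i : ι} (hi : i ∈ D)
    {c : K} (hc : c ∈ A) : c • v i ∈ coeffSpan A v D :=
  AddSubgroup.subset_closure ⟨i, hi, c, hc, rfl⟩

theorem coeffSpan_mono {A B : AddSubgroup K} (hAB : A ≤ B) (v : ι → V) {D E : Set ι}
    (hDE : D ⊆ E) : coeffSpan A v D ≤ coeffSpan B v E := by
  apply AddSubgroup.closure_mono
  rintro x ⟨i, hi, c, hc, rfl⟩
  exact ⟨i, hDE hi, c, hAB hc, rfl⟩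

theorem coeffSpan_le {A : AddSubgroup K} {v : ι → V} {D : Set ι} {N : Submodule K V}
    (h : ∀ i ∈ D, v i ∈ N) {x : V} (hx : x ∈ coeffSpan A v D) : x ∈ N := by
  have : coeffSpan A v D ≤ N.toAddSubgroup := by
    rw [coeffSpan, AddSubgroup.closure_le]
    rintro x ⟨i, hi, c, _, rfl⟩
    exact N.smul_mem c (h i hi)
  exact this hx

theorem exists_eq_smul_add_of_mem_coeffSpan [DecidableEq ι] {A : AddSubgroup K} {v : ι → V}
    {D : Finset ι} {i : ι} {x : V} (hx : x ∈ coeffSpan A v (D : Set ι)) :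
    ∃ c ∈ A, ∃ y ∈ coeffSpan A v (D.erase i : Set ι), x = c • v i + y := by
  induction hx using AddSubgroup.closure_induction with
  | mem x hx =>
    obtain ⟨j, hj, c, hc, rfl⟩ := hx
    by_cases hji : j = i
    · subst hji
      exact ⟨c, hc, 0, AddSubgroup.zero_mem _, (add_zero _).symm⟩
    · refine ⟨0, A.zero_mem, c • v j, smul_mem_coeffSpan ?_ hc, by rw [zero_smul, zero_add]⟩
      exact Finset.mem_coe.2 (Finset.mem_erase.2 ⟨hji, hj⟩)
  | zero => exact ⟨0, A.zero_mem, 0, AddSubgroup.zero_mem _, by rw [zero_smul, zero_add]⟩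
  | add x y _ _ hx hy =>
    obtain ⟨c, hc, x', hx', rfl⟩ := hx
    obtain ⟨e, he, y', hy', rfl⟩ := hy
    refine ⟨c + e, A.add_mem hc he, x' + y', AddSubgroup.add_mem _ hx' hy', ?_⟩
    rw [add_smul]; abel
  | neg x _ hx =>
    obtain ⟨c, hc, x', hx', rfl⟩ := hx
    refine ⟨-c, A.neg_mem hc, -x', AddSubgroup.neg_mem _ hx', ?_⟩
    rw [neg_smul]; abel

theorem smul_mem_coeffSpan_subring {L : Subring K} {v : ι → V} {D : Set ι} {c : K} (hc : c ∈ L)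
    {x : V} (hx : x ∈ coeffSpan L.toAddSubgroup v D) : c • x ∈ coeffSpan L.toAddSubgroup v D := by
  induction hx using AddSubgroup.closure_induction with
  | mem x hx =>
    obtain ⟨j, hj, e, he, rfl⟩ := hx
    rw [smul_smul]
    exact smul_mem_coeffSpan hj (L.mul_mem hc he)
  | zero => rw [smul_zero]; exact AddSubgroup.zero_mem _
  | add x y _ _ hx hy => rw [smul_add]; exact AddSubgroup.add_mem _ hx hy
  | neg x _ hx => rw [smul_neg]; exact AddSubgroup.neg_mem _ hx

/-- The setting of Lusztig's lemma: a family `v` of vectors, of which those with index in `I` are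
independent, as witnessed by the coordinates `coord`, and an anti-linear map `ψ` that is involutive
and unitriangular on them, with off-diagonal entries in the subring `L`. The model for `A ≤ L`
is `q⁻¹ ℤ[q⁻¹] ≤ ℤ[q, q⁻¹]`, and `ht` is a height function for the order `lt`. -/
structure LusztigData (bar : K →+* K) (ψ : V →ₛₗ[bar] V) (v : ι → V) (I : Set ι)
    (coord : ι → V →ₗ[K] K) (lt : ι → ι → Prop) (ht : ι → ℕ) (L : Subring K)
    (A : AddSubgroup K) : Prop where
  coord_self : ∀ i ∈ I, coord i (v i) = 1
  coord_ne : ∀ i ∈ I, ∀ j ∈ I, i ≠ j → coord i (v j) = 0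
  ht_lt : ∀ i j, lt i j → ht i < ht j
  trans : ∀ i j k, lt i j → lt j k → lt i k
  involutive : ∀ i ∈ I, ψ (ψ (v i)) = v i
  triangular : ∀ i ∈ I, ψ (v i) - v i ∈ coeffSpan L.toAddSubgroup v {j | j ∈ I ∧ lt j i}
  bar_bar : ∀ c, bar (bar c) = c
  bar_mem : ∀ c ∈ L, bar c ∈ L
  le : A ≤ L.toAddSubgroup
  exists_sub : ∀ a ∈ L, bar a = -a → ∃ b ∈ A, a = b - bar b
  eq_zero : ∀ c ∈ A, bar c = c → c = 0

variable {bar : K →+* K} {ψ : V →ₛₗ[bar] V} {v : ι → V} {I : Set ι} {coord : ι → V →ₗ[K] K}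
  {lt : ι → ι → Prop} {ht : ι → ℕ} {L : Subring K} {A : AddSubgroup K}

theorem LusztigData.coord_eq_zero (H : LusztigData bar ψ v I coord lt ht L A) {i : ι} (hi : i ∈ I)
    {D : Set ι} (hD : D ⊆ I) (hiD : i ∉ D) {B : AddSubgroup K} {x : V}
    (hx : x ∈ coeffSpan B v D) : coord i x = 0 := by
  have := coeffSpan_le (N := LinearMap.ker (coord i)) (fun j hj => ?_) hx
  · exact this
  · exact H.coord_ne i hi j (hD hj) (fun e => hiD (e ▸ hj))

/-- A subset of `I` that contains with an index all smaller ones. -/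
structure IsLowerIn (I : Set ι) (lt : ι → ι → Prop) (D : Set ι) : Prop where
  subset : D ⊆ I
  lower : ∀ i ∈ D, ∀ j ∈ I, lt j i → j ∈ D

theorem LusztigData.isLowerIn_erase [DecidableEq ι] (H : LusztigData bar ψ v I coord lt ht L A)
    {D : Finset ι} (hD : IsLowerIn I lt (D : Set ι)) {i : ι} (hmax : ∀ j ∈ D, ht j ≤ ht i) :
    IsLowerIn I lt (D.erase i : Set ι) where
  subset j hj := hD.subset (Finset.mem_of_mem_erase hj)
  lower j hj k hk hkj := by
    have hj' := Finset.mem_of_mem_erase (Finset.mem_coe.1 hj)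
    refine Finset.mem_coe.2 (Finset.mem_erase.2 ⟨?_, hD.lower j hj' k hk hkj⟩)
    rintro rfl
    have h1 := H.ht_lt _ _ hkj
    have h2 := hmax j hj'
    omega

theorem LusztigData.map_sub_mem (H : LusztigData bar ψ v I coord lt ht L A) [DecidableEq ι]
    {D : Finset ι} (hD : IsLowerIn I lt (D : Set ι)) {i : ι} (hi : i ∈ D) :
    ψ (v i) - v i ∈ coeffSpan L.toAddSubgroup v (D.erase i : Set ι) := by
  refine coeffSpan_mono le_rfl v ?_ (H.triangular i (hD.subset hi))
  rintro j ⟨hj, hji⟩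
  refine Finset.mem_coe.2 (Finset.mem_erase.2 ⟨?_, hD.lower i hi j hj hji⟩)
  rintro rfl
  exact lt_irrefl _ (H.ht_lt _ _ hji)

theorem LusztigData.map_mem (H : LusztigData bar ψ v I coord lt ht L A) {D : Set ι}
    (hD : IsLowerIn I lt D) {x : V} (hx : x ∈ coeffSpan L.toAddSubgroup v D) :
    ψ x ∈ coeffSpan L.toAddSubgroup v D := by
  induction hx using AddSubgroup.closure_induction with
  | mem x hx =>
    obtain ⟨i, hi, c, hc, rfl⟩ := hx
    rw [map_smulₛₗ]
    apply smul_mem_coeffSpan_subring (H.bar_mem c hc)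
    have h1 := H.triangular i (hD.subset hi)
    have h2 : coeffSpan L.toAddSubgroup v {j | j ∈ I ∧ lt j i} ≤ coeffSpan L.toAddSubgroup v D :=
      coeffSpan_mono le_rfl v fun j hj => hD.lower i hi j hj.1 hj.2
    have h3 : v i ∈ coeffSpan L.toAddSubgroup v D := by
      have := smul_mem_coeffSpan (v := v) hi (A := L.toAddSubgroup) L.one_mem
      rwa [one_smul] at this
    have := AddSubgroup.add_mem _ (h2 h1) h3
    rwa [sub_add_cancel] at this
  | zero => rw [map_zero]; exact AddSubgroup.zero_mem _
  | add x y _ _ hx hy => rw [map_add]; exact AddSubgroup.add_mem _ hx hy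
  | neg x _ hx => rw [map_neg]; exact AddSubgroup.neg_mem _ hx

/-- An invariant combination with coefficients in `A` vanishes: its leading coefficient would be a
nonzero bar invariant element of `A`. -/
theorem LusztigData.eq_zero_of_invariant (H : LusztigData bar ψ v I coord lt ht L A)
    [DecidableEq ι] : ∀ (n : ℕ) {D : Finset ι}, D.card = n → IsLowerIn I lt (D : Set ι) →
    ∀ {x : V}, x ∈ coeffSpan A v (D : Set ι) → ψ x = x → x = 0 := by
  intro n
  induction n with
  | zero =>
    intro D hn _ x hx _
    rw [Finset.card_eq_zero] at hn
    subst hn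
    exact coeffSpan_le (N := ⊥) (fun i hi => absurd hi (by simp)) hx
  | succ n ih =>
    intro D hn hD x hx hψ
    obtain ⟨i, hi, hmax⟩ := Finset.exists_max_image D ht (Finset.card_pos.1 (by omega))
    have hD' := H.isLowerIn_erase hD hmax
    obtain ⟨c, hc, y, hy, rfl⟩ := exists_eq_smul_add_of_mem_coeffSpan (i := i) hx
    have hiI := hD.subset hi
    have hni : i ∉ (D.erase i : Set ι) := by simp
    have hy' := coeffSpan_mono H.le v subset_rfl hy
    have hc0 : c = 0 := by
      apply H.eq_zero c hc
      have h1 : ψ (c • v i + y) =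
          bar c • v i + (bar c • (ψ (v i) - v i) + ψ y) := by
        rw [map_add, map_smulₛₗ, smul_sub]; abel
      have h2 := congrArg (coord i) (h1.symm.trans hψ)
      rw [map_add (coord i) (bar c • v i), map_add (coord i) (c • v i), map_smul, map_smul,
        H.coord_self i hiI,
        H.coord_eq_zero hiI hD'.subset hni hy, H.coord_eq_zero hiI hD'.subset hni
          (AddSubgroup.add_mem _ (smul_mem_coeffSpan_subring (H.bar_mem c (H.le hc))
            (H.map_sub_mem hD hi)) (H.map_mem hD' hy'))] at h2
      simpa using h2
    rw [hc0, zero_smul, zero_add] at hψ ⊢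
    exact ih (by rw [Finset.card_erase_of_mem hi]; omega) hD' hy hψ

/-- An anti-invariant combination with coefficients in `L` has the form `y - ψ y`, where `y` has
coefficients in `A`. -/
theorem LusztigData.exists_sub_map (H : LusztigData bar ψ v I coord lt ht L A)
    [DecidableEq ι] : ∀ (n : ℕ) {D : Finset ι}, D.card = n → IsLowerIn I lt (D : Set ι) →
    ∀ {x : V}, x ∈ coeffSpan L.toAddSubgroup v (D : Set ι) → ψ x = -x →
      ∃ y ∈ coeffSpan A v (D : Set ι), x = y - ψ y := by
  intro n
  induction n with
  | zero =>
    intro D hn _ x hx _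
    rw [Finset.card_eq_zero] at hn
    subst hn
    have hx0 : x = 0 := coeffSpan_le (N := ⊥) (fun i hi => absurd hi (by simp)) hx
    exact ⟨0, AddSubgroup.zero_mem _, by rw [hx0, map_zero, sub_zero]⟩
  | succ n ih =>
    intro D hn hD x hx hψ
    obtain ⟨i, hi, hmax⟩ := Finset.exists_max_image D ht (Finset.card_pos.1 (by omega))
    have hD' := H.isLowerIn_erase hD hmax
    obtain ⟨a, ha, x', hx', rfl⟩ := exists_eq_smul_add_of_mem_coeffSpan (i := i) hx
    have hiI := hD.subset hi
    have hni : i ∉ (D.erase i : Set ι) := by simp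
    have hR := H.map_sub_mem hD hi
    -- comparing leading coefficients shows that `a` is anti-invariant
    have ha' : bar a = -a := by
      have h1 : ψ (a • v i + x') =
          bar a • v i + (bar a • (ψ (v i) - v i) + ψ x') := by
        rw [map_add, map_smulₛₗ, smul_sub]; abel
      have h2 := congrArg (coord i) (h1.symm.trans hψ)
      rw [map_neg (coord i), map_add (coord i) (bar a • v i), map_add (coord i) (a • v i), map_smul, map_smul,
        H.coord_self i hiI,
        H.coord_eq_zero hiI hD'.subset hni hx', H.coord_eq_zero hiI hD'.subset hni
          (AddSubgroup.add_mem _ (smul_mem_coeffSpan_subring (H.bar_mem a ha)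
            hR) (H.map_mem hD' hx'))] at h2
      simpa using h2
    obtain ⟨b, hb, hab⟩ := H.exists_sub a ha ha'
    have hψb : ψ (b • v i) = bar b • v i + bar b • (ψ (v i) - v i) := by
      rw [map_smulₛₗ, smul_sub]; abel
    have hx2 : a • v i + x' - (b • v i - ψ (b • v i)) = x' + bar b • (ψ (v i) - v i) := by
      rw [hψb, hab, sub_smul]; abel
    obtain ⟨y, hy, hxy⟩ := ih (D := D.erase i) (by rw [Finset.card_erase_of_mem hi]; omega) hD'
      (AddSubgroup.add_mem _ hx' (smul_mem_coeffSpan_subring (H.bar_mem b (H.le hb)) hR)) (by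
        rw [← hx2, map_sub, hψ, map_sub, map_smulₛₗ, map_smulₛₗ, H.involutive i hiI, H.bar_bar]
        abel)
    refine ⟨b • v i + y, AddSubgroup.add_mem _ (smul_mem_coeffSpan hi hb)
      (coeffSpan_mono le_rfl v (fun j hj => Finset.mem_of_mem_erase hj) hy), ?_⟩
    rw [← hx2, sub_eq_iff_eq_add] at hxy
    rw [hxy, map_add]
    abel

/-- Existence of the bar invariant element with leading term `v i`. -/
theorem LusztigData.exists_invariant (H : LusztigData bar ψ v I coord lt ht L A) [Finite ι] {i : ι}
    (hi : i ∈ I) : ∃ y ∈ coeffSpan A v {j | j ∈ I ∧ lt j i}, ψ (v i + y) = v i + y := by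
  classical
  have hfin : {j | j ∈ I ∧ lt j i}.Finite := Set.toFinite _
  have hD : IsLowerIn I lt (hfin.toFinset : Set ι) := by
    rw [Set.Finite.coe_toFinset]
    exact ⟨fun j hj => hj.1, fun j hj k hk hkj => ⟨hk, H.trans _ _ _ hkj hj.2⟩⟩
  obtain ⟨y, hy, h⟩ := H.exists_sub_map _ rfl hD (x := ψ (v i) - v i)
    (by rw [Set.Finite.coe_toFinset]; exact H.triangular i hi)
    (by rw [map_sub, H.involutive i hi, neg_sub])
  rw [Set.Finite.coe_toFinset] at hy
  refine ⟨y, hy, ?_⟩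
  rw [map_add, ← sub_eq_zero]
  rw [← sub_eq_zero] at h
  rw [← h]; abel

theorem LusztigData.eq_zero_of_mem (H : LusztigData bar ψ v I coord lt ht L A) [Finite ι] {x : V}
    (hx : x ∈ coeffSpan A v I) (hψ : ψ x = x) : x = 0 := by
  classical
  have hfin : I.Finite := Set.toFinite _
  refine H.eq_zero_of_invariant _ rfl (D := hfin.toFinset) ?_
    (by rwa [Set.Finite.coe_toFinset]) hψ
  rw [Set.Finite.coe_toFinset]
  exact ⟨subset_rfl, fun _ _ j hj _ => hj⟩

/-- Uniqueness of the bar invariant element with leading term `v i`. -/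
theorem LusztigData.eq_of_sub_mem (H : LusztigData bar ψ v I coord lt ht L A) [Finite ι] {i : ι}
    {x y : V} (hx : ψ x = x) (hy : ψ y = y) (hxi : x - v i ∈ coeffSpan A v I)
    (hyi : y - v i ∈ coeffSpan A v {j | j ∈ I ∧ lt j i}) : x = y := by
  rw [← sub_eq_zero]
  apply H.eq_zero_of_mem
  · have h := AddSubgroup.sub_mem _ hxi (coeffSpan_mono le_rfl _ (fun j hj => hj.1) hyi)
    rwa [sub_sub_sub_cancel_right] at h
  · rw [map_sub, hx, hy]

theorem LusztigData.linearIndependent (H : LusztigData bar ψ v I coord lt ht L A)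
    {C : I → V} (hC : ∀ i : I, C i - v i ∈ coeffSpan A v {j | j ∈ I ∧ lt j i}) :
    LinearIndependent K C := by
  classical
  rw [linearIndependent_iff']
  intro s g hg
  by_contra! hne
  obtain ⟨i₀, hi₀, hgi₀⟩ := hne
  obtain ⟨i, hi, hmax⟩ := Finset.exists_max_image (s.filter fun i => g i ≠ 0) (fun i => ht i)
    ⟨i₀, Finset.mem_filter.2 ⟨hi₀, hgi₀⟩⟩
  obtain ⟨his, hgi⟩ := Finset.mem_filter.1 hi
  apply hgi
  have h1 := congrArg (coord i) hg
  rw [map_zero, map_sum, Finset.sum_eq_single_of_mem i his] at h1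
  · have h2 := H.coord_eq_zero i.2 (fun j hj => hj.1) (fun h => lt_irrefl _ (H.ht_lt _ _ h.2)) (hC i)
    rw [map_sub, H.coord_self i i.2, sub_eq_zero] at h2
    rwa [map_smul, h2, smul_eq_mul, mul_one] at h1
  · intro j hj hji
    by_cases hgj : g j = 0
    · rw [hgj, zero_smul, map_zero]
    · have h3 := hmax j (Finset.mem_filter.2 ⟨hj, hgj⟩)
      have h2 := H.coord_eq_zero i.2 (fun k hk => hk.1) (fun h => by
        have := H.ht_lt _ _ h.2; omega) (hC j)
      rw [map_sub, H.coord_ne i i.2 j j.2 (fun e => hji (Subtype.ext e.symm)), sub_zero] at h2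
      rw [map_smul, h2, smul_zero]

theorem LusztigData.mem_span (H : LusztigData bar ψ v I coord lt ht L A)
    {C : I → V} (hC : ∀ i : I, C i - v i ∈ coeffSpan A v {j | j ∈ I ∧ lt j i}) :
    ∀ (n : ℕ) (i : ι), i ∈ I → ht i = n → v i ∈ Submodule.span K (Set.range C) := by
  intro n
  induction n using Nat.strong_induction_on with
  | _ n ih =>
    intro i hi hn
    have h1 := coeffSpan_le (N := Submodule.span K (Set.range C))
      (fun j hj => ih (ht j) (hn ▸ H.ht_lt _ _ hj.2) j hj.1 rfl) (hC ⟨i, hi⟩)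
    have h2 : C ⟨i, hi⟩ ∈ Submodule.span K (Set.range C) := Submodule.subset_span ⟨_, rfl⟩
    have := Submodule.sub_mem _ h2 h1
    rwa [sub_sub_cancel] at this

end KazhdanLusztig

/-! ### Triangularity and the canonical basis -/

section Triangularity

variable {K : Type} [Field K] (P : HeckeParam K)

/-- The standard vector `M_{f · w}`. -/
noncomputable def orbitVec {r m d : ℕ} (f : Weight r m d) (w : WB d) : TensorSpace P r m d :=
  stdVec P (wact f w)

theorem orbitVec_smul_Hinv_mem {r m d : ℕ} {f : Weight r m d} (hf : AntiDominant f)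
    {L : Subring K} (hL : ∀ i : Fin d, P.par i ∈ L ∧ (P.par i)⁻¹ ∈ L) {w : WB d}
    (hw : w ∈ minReps f) (i : Fin d) :
    orbitVec P f w <• Hinv P i ∈ coeffSpan L.toAddSubgroup (orbitVec P f)
      {u | u ∈ minReps f ∧ (u = w ∨ u = w * simpleRefl i)} := by
  have hd : P.par i - (P.par i)⁻¹ ∈ L.toAddSubgroup := L.sub_mem (hL i).1 (hL i).2
  by_cases hfix : wact f (w * simpleRefl i) = wact f w
  · rw [orbitVec, smul_Hinv_of_smul_Hgen P (stdVec_smul_of_wact_eq P (by rw [← wact_mul, hfix]))]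
    exact smul_mem_coeffSpan (v := orbitVec P f)
      (D := {u | u ∈ minReps f ∧ (u = w ∨ u = w * simpleRefl i)}) ⟨hw, Or.inl rfl⟩ (hL i).2
  · have hwi := mul_simpleRefl_mem_minReps hf hw hfix
    by_cases hp : PosOn w (simpleRefl i)
    · rw [smul_Hinv, orbitVec, stdVec_smul_of_posOn P hf hw hp hfix]
      refine AddSubgroup.sub_mem _ ?_
        (smul_mem_coeffSpan (v := orbitVec P f)
          (D := {u | u ∈ minReps f ∧ (u = w ∨ u = w * simpleRefl i)}) ⟨hw, Or.inl rfl⟩ hd)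
      have := smul_mem_coeffSpan (A := L.toAddSubgroup) (v := orbitVec P f)
        (D := {u | u ∈ minReps f ∧ (u = w ∨ u = w * simpleRefl i)}) ⟨hwi, Or.inr rfl⟩ L.one_mem
      rwa [one_smul] at this
    · obtain ⟨u, rfl⟩ : ∃ u, w = u * simpleRefl i :=
        ⟨w * simpleRefl i, by rw [mul_assoc, simpleRefl_mul_self, mul_one]⟩
      have hu : u * simpleRefl i * simpleRefl i = u := by
        rw [mul_assoc, simpleRefl_mul_self, mul_one]
      rw [hu] at hfix hwi
      have hp' : PosOn u (simpleRefl i) := by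
        by_contra h; exact hp ((posOn_mul_self (swapsOnePair_simpleRefl i)).2 h)
      rw [orbitVec, ← stdVec_smul_of_posOn P hf hwi hp' (Ne.symm hfix), ← smul_mul_right,
        Hgen_mul_Hinv, MulOpposite.op_one, one_smul]
      have := smul_mem_coeffSpan (A := L.toAddSubgroup) (v := orbitVec P f)
        (D := {v | v ∈ minReps f ∧ (v = u * simpleRefl i ∨ v = u * simpleRefl i * simpleRefl i)})
        ⟨hwi, Or.inr hu.symm⟩ L.one_mem
      rwa [one_smul] at this

/-- The bar involution is unitriangular for the Bruhat order. -/
theorem barVec_sub_mem {r m d : ℕ} {f : Weight r m d} (hf : AntiDominant f)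
    {L : Subring K} (hL : ∀ i : Fin d, P.par i ∈ L ∧ (P.par i)⁻¹ ∈ L) : ∀ (n : ℕ) {σ : WB d},
    len σ = n → σ ∈ minReps f → barVec P f σ - orbitVec P f σ ∈
      coeffSpan L.toAddSubgroup (orbitVec P f) {w | w ∈ minReps f ∧ BruhatLT w σ} := by
  intro n
  induction n with
  | zero =>
    intro σ hn _
    rw [eq_one_of_len_eq_zero hn, barVec_one, orbitVec, wact_one, sub_self]
    exact AddSubgroup.zero_mem _
  | succ n ih =>
    intro σ hn hσ
    obtain ⟨l, hl⟩ := exists_isReducedExpr σ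
    rcases List.eq_nil_or_concat l with rfl | ⟨l, i, rfl⟩
    · have := hl.2; simp [hn] at this
    rw [List.concat_eq_append] at hl
    have hnp := hl.not_posOn
    obtain ⟨τ, rfl⟩ : ∃ τ, σ = τ * simpleRefl i :=
      ⟨σ * simpleRefl i, by rw [mul_assoc, simpleRefl_mul_self, mul_one]⟩
    obtain ⟨hp, hlen, hτ, hne⟩ := descent_of_mem_minReps hf hσ hnp
    have hbruhat := bruhatLT_mul_simpleRefl hp
    have h1 : barVec P f (τ * simpleRefl i) = barVec P f τ <• Hinv P i := by
      rw [barVec, heckeBar_Helt_mul P hp, smul_mul_right, barVec]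
    have h2 : orbitVec P f τ <• Hinv P i =
        orbitVec P f (τ * simpleRefl i) - (P.par i - (P.par i)⁻¹) • orbitVec P f τ := by
      rw [smul_Hinv, orbitVec, stdVec_smul_of_posOn P hf hτ hp hne, orbitVec]
    have h3 : barVec P f (τ * simpleRefl i) - orbitVec P f (τ * simpleRefl i) =
        (barVec P f τ - orbitVec P f τ) <• Hinv P i -
          (P.par i - (P.par i)⁻¹) • orbitVec P f τ := by
      rw [h1, smul_sub, h2]; abel
    rw [h3]
    refine AddSubgroup.sub_mem _ ?_ (smul_mem_coeffSpan (v := orbitVec P f)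
      (D := {w | w ∈ minReps f ∧ BruhatLT w (τ * simpleRefl i)}) ⟨hτ, hbruhat⟩
      (L.sub_mem (hL i).1 (hL i).2))
    have h4 := ih (by omega) hτ
    generalize barVec P f τ - orbitVec P f τ = y at h4
    induction h4 using AddSubgroup.closure_induction with
    | mem x hx =>
      obtain ⟨w, ⟨hw, hwτ⟩, c, hc, rfl⟩ := hx
      rw [smul_smul_right]
      apply smul_mem_coeffSpan_subring hc
      refine coeffSpan_mono le_rfl _ ?_ (orbitVec_smul_Hinv_mem P hf hL hw i)
      rintro u ⟨hu, rfl | rfl⟩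
      · exact ⟨hu, hwτ.trans hbruhat⟩
      · exact ⟨hu, hwτ.mul_simpleRefl hp⟩
    | zero => rw [smul_zero]; exact AddSubgroup.zero_mem _
    | add x y _ _ hx hy => rw [smul_add]; exact AddSubgroup.add_mem _ hx hy
    | neg x _ hx => rw [smul_neg]; exact AddSubgroup.neg_mem _ hx

/-- The coordinate of `M_{f · w}`. -/
noncomputable def orbitCoord {r m d : ℕ} (f : Weight r m d) (w : WB d) :
    TensorSpace P r m d →ₗ[K] K :=
  Finsupp.lapply (R := K) (M := K) (wact f w)

open Classical in
theorem orbitCoord_orbitVec {r m d : ℕ} (f : Weight r m d) (u w : WB d) :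
    orbitCoord P f u (orbitVec P f w) = if wact f w = wact f u then 1 else 0 :=
  Finsupp.single_apply

end Triangularity

theorem par_mem_laurentSubring (k : ℤ) {d : ℕ} (i : Fin d) :
    (oneParam k).par i ∈ laurentSubring ∧ ((oneParam k).par i)⁻¹ ∈ laurentSubring := by
  have hp : (oneParam k).p = (RatFunc.X : Qq) ^ k := rfl
  have hq : (oneParam k).q = (RatFunc.X : Qq) ^ (1 : ℤ) := (zpow_one _).symm
  unfold HeckeParam.par
  split_ifs
  · rw [hp, ← zpow_neg]; exact ⟨zpow_mem_laurentSubring _, zpow_mem_laurentSubring _⟩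
  · rw [hq, ← zpow_neg]; exact ⟨zpow_mem_laurentSubring _, zpow_mem_laurentSubring _⟩

theorem lusztigData_tensorBar (k : ℤ) {r m d : ℕ} {f : Weight r m d} (hf : AntiDominant f) :
    LusztigData (oneParam k).bar (tensorBar (oneParam k) f) (orbitVec (oneParam k) f) (minReps f)
      (orbitCoord (oneParam k) f) BruhatLT len laurentSubring (qInvIntSubgroup (oneParam k)) where
  coord_self w _ := by rw [orbitCoord_orbitVec, if_pos rfl]
  coord_ne u hu w hw hne := by
    rw [orbitCoord_orbitVec, if_neg fun e => hne (eq_of_mem_minReps hf hu hw e.symm)]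
  ht_lt _ _ h := h.len_lt
  trans _ _ _ h h' := h.trans h'
  involutive w hw := by
    have h := (isBarInvolution_qpermBar (oneParam k) hf).involutive ⟨_, stdVec_mem_QPerm _ hf hw⟩
    exact congrArg Subtype.val h
  triangular w hw := by
    have h := barVec_sub_mem (oneParam k) hf (par_mem_laurentSubring k) _ rfl hw
    rw [← tensorBar_stdVec (oneParam k) hf hw] at h
    exact h
  bar_bar := (oneParam k).bar_bar
  bar_mem _ h := barQq_mem_laurentSubring h
  le _ h := mem_laurentSubring_of_mem_qInvIntSubgroup h
  exists_sub _ h h' := exists_eq_sub_barQq k h h'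
  eq_zero _ h h' := eq_zero_of_barQq_eq h h'

end QuasiKL

theorem theoremA (r m d : ℕ) (f : Weight r m d) (hf : AntiDominant f) :
    (∃ ψ : QPerm twoParam f →ₛₗ[twoParam.bar] QPerm twoParam f, IsBarInvolution twoParam f ψ) ∧
    ∀ k : ℤ, ∃ ψ : QPerm (oneParam k) f →ₛₗ[(oneParam k).bar] QPerm (oneParam k) f,
      IsBarInvolution (oneParam k) f ψ ∧
      ∃ C : minReps f → QPerm (oneParam k) f,
        (∀ σ, ψ (C σ) = C σ) ∧
        (∀ σ : minReps f, (C σ : TensorSpace (oneParam k) r m d) - stdVec (oneParam k) (wact f σ) ∈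
          qInvSpan (oneParam k) f {w | w ∈ minReps f ∧ BruhatLT w σ}) ∧
        (∀ (σ : minReps f) (x : QPerm (oneParam k) f), ψ x = x →
          (x : TensorSpace (oneParam k) r m d) - stdVec (oneParam k) (wact f σ) ∈
            qInvSpan (oneParam k) f (minReps f) → x = C σ) ∧
        LinearIndependent Qq C ∧ Submodule.span Qq (Set.range C) = ⊤ := by
  refine ⟨⟨qpermBar twoParam hf, isBarInvolution_qpermBar twoParam hf⟩, fun k => ?_⟩
  refine ⟨qpermBar (oneParam k) hf, isBarInvolution_qpermBar (oneParam k) hf, ?_⟩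
  have H := lusztigData_tensorBar k hf
  choose y hy hψ using fun σ : minReps f => H.exists_invariant σ.2
  have hmem : ∀ σ : minReps f, orbitVec (oneParam k) f σ + y σ ∈ QPerm (oneParam k) f := by
    intro σ
    rw [mem_QPerm_iff_mem_orbitSpan _ hf]
    exact Submodule.add_mem _ (stdVec_mem_orbitSpan _ σ.2)
      (coeffSpan_le (fun w hw => stdVec_mem_orbitSpan _ hw.1) (hy σ))
  have hsub : ∀ σ : minReps f, orbitVec (oneParam k) f σ + y σ - orbitVec (oneParam k) f σ ∈
      coeffSpan (qInvIntSubgroup (oneParam k)) (orbitVec (oneParam k) f)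
        {w | w ∈ minReps f ∧ BruhatLT w σ} := by
    intro σ
    rw [add_sub_cancel_left]
    exact hy σ
  refine ⟨fun σ => ⟨_, hmem σ⟩, fun σ => Subtype.ext (hψ σ), hsub, ?_, ?_, ?_⟩
  · intro σ x hx hxσ
    exact Subtype.ext (H.eq_of_sub_mem (congrArg Subtype.val hx) (hψ σ) hxσ (hsub σ))
  · exact LinearIndependent.of_comp ((QPerm (oneParam k) f).subtype.restrictScalars Qq)
      (H.linearIndependent hsub)
  · rw [eq_top_iff]
    rintro x -
    have h1 : (x : TensorSpace (oneParam k) r m d) ∈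
        Submodule.span Qq (Set.range fun σ : minReps f => orbitVec (oneParam k) f σ + y σ) := by
      have h2 := (mem_QPerm_iff_mem_orbitSpan _ hf).1 x.2
      refine Submodule.span_le.2 ?_ h2
      rintro _ ⟨w, hw, rfl⟩
      exact H.mem_span hsub _ w hw rfl
    have h3 : (Set.range fun σ : minReps f => orbitVec (oneParam k) f σ + y σ) =
        ((QPerm (oneParam k) f).subtype.restrictScalars Qq) ''
          Set.range fun σ : minReps f => (⟨_, hmem σ⟩ : QPerm (oneParam k) f) := by
      rw [← Set.range_comp]; rfl
    rw [h3, Submodule.span_image] at h1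
    obtain ⟨x', hx', e⟩ := h1
    rwa [← Subtype.ext e]
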